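/- **Setting.** Let $d\ge 1$ and let $\Sigma_p,\Sigma_q$ be positive definite $d\times d$ matrices. Let $\mathcal P=\{P_\mu=N(\mu,\Sigma_p):\mu\in\mathbb R^d\}$ and $\mathcal Q=\{Q_\mu=N(\mu,\Sigma_q):\mu\in\mathbb R^d\}$, with Lebesgue densities $p_\mu,q_\mu$, extended to $U^n=(U_1,\dots,U_n)$ by independence; write $p_W(U^n)=\int p_\mu(U^n)\,dW(\mu)$ for a prior $W$, and likewise $q_W$, $Q_W$. Let $R$ be a probability distribution on $\mathbb R^d$ with finite second moments, mean $\mu^*$ and covariance matrix $\Sigma_r$, and let $U_1,U_2,\dots$ be i.i.d. $\sim R$. Put $d_{ab}=\mathrm{tr}(\Sigma_a\Sigma_b^{-1})$, $$D_{\Sigma_r}(\Sigma_q\|\Sigma_p)=-\tfrac12\log\det(\Sigma_q\Sigma_p^{-1})+\tfrac12(d_{rp}-d_{rq}),\qquad D_R(Q\|P)=\mathbb E_{U\sim R}\Big[\log\frac{q(U)}{p(U)}\Big].$$ Let $\hat\mu_{|n}=n^{-1}\sum_{i\le n}U_i$ (the maximum likelihood estimator) and, for fixed $n_0>0$ and $x_0\in\mathbb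 R^d$, $\breve\mu_{|i}=(n_0x_0+\sum_{j\le i}U_j)/(n_0+i)$. Let $W_1=N(\mu_1,\Pi_1)$ with $\Pi_1$ positive definite and density $w_1$. For a law $Q$ with $\inf_{P\in\mathrm{conv}(\mathcal C)}D(Q\|P)<\infty$, the reverse information projection (RIPr) of $Q$ on $\mathrm{conv}(\mathcal C)$ is the sub-probability density $p_{\leftsquigarrow q}$, positive $Q$-a.s. and unique up to null sets, such that $\log p_k\to\log p_{\leftsquigarrow q}$ in $L^1(Q)$ for every sequence $P_k\in \mathrm{conv}(\mathcal C)$ with $D(Q\|P_k)\to\inf_{P\in\mathrm{conv}(\mathcal C)}D(Q\|P)$. Define $$S^{(n)}_{\breve\mu,\mathrm{UI}}=\frac{\prod_{i=1}^n q_{\breve\mu_{|i-1}}(U_i)}{p_{\hat\mu_{|n}}(U^n)},\qquad S^{(n)}_{W_1,\mathrm{UI}}=\frac{q_{W_1}(U^n)}{p_{\hat\mu_{|n}}(U^n)},\qquad S^{(n)}_{\mathrm{COND}}=\frac{q(U^n\mid Z)}{p(U^n\mid Z)},$$ $$S^{(n)}_{\breve\mu,\mathrm{seq\text{-}rip}}=\prod_{i=1}^n\frac{q_{\breve\mu_{|i-1}}(U_i)}{p_{\leftsquigarrow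 q_{\breve\mu_{|i-1}}}(U_i)},\qquad S^{(n)}_{W_1,\mathrm{RIP}}=\frac{q_{W_1}(U^n)}{p_{\leftsquigarrow q_{W_1}}(U^n)},$$ where $Z=n^{-1/2}\sum_{i\le n}U_i$; $p(\cdot\mid Z),q(\cdot\mid Z)$ are densities, relative to a common measure $\nu'(\cdot\mid Z)$, of the regular conditional distributions of $U^n$ given $Z$ (which are the same for all elements of $\mathcal P$, respectively of $\mathcal Q$); in $S_{\mathrm{seq\text{-}rip}}$ the RIPr is onto $\mathrm{conv}(\mathcal P)$ for a single outcome (densities chosen jointly measurably in the parameter and the outcome), and in $S_{W_1,\mathrm{RIP}}$ it is the RIPr of $Q_{W_1}(U^n)$ onto $\mathrm{conv}(\mathcal P(U^n))$. In the expectations of $\log S_{\mathrm{COND}}$ and $\log S_{\mathrm{seq\text{-}rip}}$, which are defined up to Lebesgue-null sets, it is assumed that $R$ has a Lebesgue density or that the continuous version is used. With $v=\mu^*-x_0$, $w=\mu^*-\mu_1$ and $\Sigma$ either of $\Sigma_p,\Sigma_q$, put $$A_{\Sigma}(n)=\sum_{i=0}^{n-1}\frac{v^\top\Sigma^{-1}v}{(1+i/n_0)^2},\qquad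 B(n)=-\log n+\sum_{i=1}^{n-1}\frac{i}{(n_0+i)^2}.$$ **Theorem.** $D_R(Q_{\mu^*}\|P_{\mu^*})$ is finite and equals $D_{\Sigma_r}(\Sigma_q\|\Sigma_p)$, and for all $n\ge1$ (all logarithms below being integrable under $R$): 1. **(UI)** $$\mathbb E_R[\log S^{(n)}_{\breve\mu,\mathrm{UI}}]=n\,D_R(Q_{\mu^*}\|P_{\mu^*})-\tfrac{d_{rq}}2\log n+O_{\breve\mu,\mathrm{UI}},\qquad O_{\breve\mu,\mathrm{UI}}=-\tfrac{d_{rp}}2-\tfrac12A_{\Sigma_q}(n)-\tfrac{d_{rq}}2B(n),$$ which is $O(1)$ as $n\to\infty$; and $$\mathbb E_R[\log S^{(n)}_{W_1,\mathrm{UI}}]=n\,D_R(Q_{\mu^*}\|P_{\mu^*})-\tfrac d2\log\tfrac n{2\pi}+O_{W_1,\mathrm{UI}},$$ $$O_{W_1,\mathrm{UI}}=-\tfrac{d_{rp}}2-D_{\Sigma_r}(\Sigma_q\|\Sigma_q+n\Pi_1)+\tfrac d2\log\tfrac n{2\pi}-\tfrac12w^\top(\Pi_1+\Sigma_q/n)^{-1}w,$$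 and, as $n\to\infty$, $O_{W_1,\mathrm{UI}}=\tfrac{d_{rq}-d_{rp}}2+\tfrac12\log\det\Sigma_q+\log w_1(\mu^*)+o(1)$. 2. **(COND)** $\mathbb E_R[\log S^{(n)}_{\mathrm{COND}}]=(n-1)D_{\Sigma_r}(\Sigma_q\|\Sigma_p)=n\,D_R(Q_{\mu^*}\|P_{\mu^*})-D_{\Sigma_r}(\Sigma_q\|\Sigma_p)$. 3. **(seq-RIPr)** If $\Sigma_q-\Sigma_p$ is negative semidefinite (simple case), then $p_{\leftsquigarrow q_{\breve\mu_{|i-1}}}=p_{\breve\mu_{|i-1}}$ a.e. for every $i$, and $$\mathbb E_R[\log S^{(n)}_{\breve\mu,\mathrm{seq\text{-}rip}}]=n\,D_R(Q_{\mu^*}\|P_{\mu^*})+\tfrac{d_{rp}-d_{rq}}2\log n+O_{\mathrm{seq\text{-}rip}},$$ $$O_{\mathrm{seq\text{-}rip}}=\tfrac12\big(A_{\Sigma_p}(n)-A_{\Sigma_q}(n)\big)+\tfrac{d_{rp}-d_{rq}}2B(n),$$ which is $O(1)$. If $\Sigma_q-\Sigma_p$ is positive semidefinite (anti-simple case), then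 $S^{(n)}_{\breve\mu,\mathrm{seq\text{-}rip}}=1$ a.e. 4. **(RIPr)** For every $n$ such that $\Pi_1+(\Sigma_q-\Sigma_p)/n$ is positive semidefinite (in the anti-simple case this holds for all $n$), a.e. $$p_{\leftsquigarrow q_{W_1}}(U^n)=p_{W_0}(U^n),\quad W_0=N\big(\mu_1,\Pi_1+(\Sigma_q-\Sigma_p)/n\big),\qquad S^{(n)}_{W_1,\mathrm{RIP}}=\frac{q_{W_1}(U^n)}{p_{W_0}(U^n)}=S^{(n)}_{\mathrm{COND}},$$ and $S^{(n)}_{W_1,\mathrm{RIP}}$ is growth-rate optimal: it is an e-variable for $\mathcal P$ that maximizes $\mathbb E_{Q_{W_1}}[\log S]$ over all e-variables $S=S(U^n)$ for $\mathcal P$. -/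

import Mathlib

open MeasureTheory ProbabilityTheory Filter Topology Asymptotics
open scoped ENNReal NNReal Matrix

noncomputable section

namespace GaussE

/-- The space of a single outcome `X = U`, with its Euclidean structure and Lebesgue measure. -/
abbrev Vec (d : ℕ) : Type := EuclideanSpace ℝ (Fin d)

/-- The space of samples `U^n = (U₁, …, Uₙ)`. The `i`-th entry, `i : Fin n`, is `U_{i+1}`. -/
abbrev Sample (d n : ℕ) : Type := Fin n → Vec d

variable {d : ℕ}

/-! ### Gaussian quantities -/

/-- The quadratic form `vᵀ A v`. -/
def quad (A : Matrix (Fin d) (Fin d) ℝ) (v : Vec d) : ℝ :=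
  (WithLp.ofLp v) ⬝ᵥ (A *ᵥ (WithLp.ofLp v))

/-- The Lebesgue density of the Gaussian with mean `m` and nondegenerate covariance matrix `S`. -/
def gaussPDF (m : Vec d) (S : Matrix (Fin d) (Fin d) ℝ) (x : Vec d) : ℝ :=
  (Real.sqrt ((2 * Real.pi) ^ d * S.det))⁻¹ * Real.exp (-(quad S⁻¹ (x - m)) / 2)

/-- The density of `n` independent outcomes of the Gaussian with mean `m` and covariance `S`. -/
def gaussPDFn (m : Vec d) (S : Matrix (Fin d) (Fin d) ℝ) {n : ℕ} (u : Sample d n) : ℝ :=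
  ∏ i, gaussPDF m S (u i)

/-- The law of `n` independent outcomes of the Gaussian with mean `m` and covariance `S`. -/
def gaussLaw (n : ℕ) (m : Vec d) (S : Matrix (Fin d) (Fin d) ℝ) : Measure (Sample d n) :=
  Measure.pi fun _ => multivariateGaussian m S

/-- The Bayes marginal density of `U^n` for the location family with covariance `S` and the
prior `W` on the mean. -/
def mixPDF (W : Measure (Vec d)) (S : Matrix (Fin d) (Fin d) ℝ) {n : ℕ} (u : Sample d n) : ℝ :=
  ∫ m, gaussPDFn m S u ∂W

/-- The Bayes marginal law of `U^n` for the location family with covariance `S` and the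
prior `W` on the mean. -/
def mixLaw (n : ℕ) (W : Measure (Vec d)) (S : Matrix (Fin d) (Fin d) ℝ) : Measure (Sample d n) :=
  W.bind fun m => gaussLaw n m S

/-- `d_{ab} = tr(Σ_a Σ_b⁻¹)`. -/
def dTr (A B : Matrix (Fin d) (Fin d) ℝ) : ℝ := (A * B⁻¹).trace

/-- `D_{Σ_r}(Σ_q ‖ Σ_p) = -½ log det(Σ_q Σ_p⁻¹) + (d_{rp} - d_{rq}) / 2`. -/
def covDiv (Sr Sq Sp : Matrix (Fin d) (Fin d) ℝ) : ℝ :=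
  -(1 / 2) * Real.log (Sq * Sp⁻¹).det + (dTr Sr Sp - dTr Sr Sq) / 2

/-- The generalized Kullback-Leibler divergence `D_R(Q ‖ P) = E_{U ∼ R}[log (q(U) / p(U))]`
of densities `q`, `p`. -/
def genKL {Ω : Type*} [MeasurableSpace Ω] (R : Measure Ω) (q p : Ω → ℝ) : ℝ :=
  ∫ u, Real.log (q u / p u) ∂ R

/-! ### E-power, e-variables and growth optimality -/

/-- `S` is almost surely positive under `R`, `log S` is integrable, and `E_R[log S] = c`. -/
def HasEPower {Ω : Type*} [MeasurableSpace Ω] (R : Measure Ω) (S : Ω → ℝ) (c : ℝ) : Prop :=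
  (∀ᵐ u ∂ R, 0 < S u) ∧ Integrable (fun u => Real.log (S u)) R ∧ ∫ u, Real.log (S u) ∂ R = c

/-- `S` is an e-variable for the null hypothesis `C`. -/
def IsEVariable {Ω : Type*} [MeasurableSpace Ω] (C : Set (Measure Ω)) (S : Ω → ℝ≥0∞) : Prop :=
  Measurable S ∧ ∀ P ∈ C, ∫⁻ u, S u ∂P ≤ 1

/-- `E_Q[log S]` as an extended real number, with `log 0 = -∞` and `∞ - ∞ = -∞`. -/
def extEPower {Ω : Type*} [MeasurableSpace Ω] (Q : Measure Ω) (S : Ω → ℝ≥0∞) : EReal :=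
  ((∫⁻ u, (ENNReal.log (S u)).toENNReal ∂Q : ℝ≥0∞) : EReal) -
    ((∫⁻ u, (-ENNReal.log (S u)).toENNReal ∂Q : ℝ≥0∞) : EReal)

/-- `S` is a growth-rate optimal (GRO) e-variable for `C` relative to `Q`. -/
def IsGRO {Ω : Type*} [MeasurableSpace Ω] (C : Set (Measure Ω)) (Q : Measure Ω)
    (S : Ω → ℝ≥0∞) : Prop :=
  IsEVariable C S ∧ ∀ S', IsEVariable C S' → extEPower Q S' ≤ extEPower Q S

/-! ### Reverse information projection -/

/-- `ρ` is (a version of the Lebesgue density of) the reverse information projection of `Q` on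
the convex hull of `C`: the divergence of `Q` from the convex hull is finite, and `ρ` is a
sub-probability density such that `log (dP_k/dν) → log ρ` in `L¹(Q)` for each sequence `P_k` in
the convex hull whose divergences `D(Q ‖ P_k)` tend to the infimum. -/
structure IsRIPr {Ω : Type*} [MeasureSpace Ω] (Q : Measure Ω) (C : Set (Measure Ω))
    (ρ : Ω → ℝ) : Prop where
  measurable : Measurable ρ
  nonneg : ∀ u, 0 ≤ ρ u
  subprob : ∫⁻ u, ENNReal.ofReal (ρ u) ≤ 1
  pos : ∀ᵐ u ∂Q, 0 < ρ u
  finite : ⨅ P ∈ convexHull ℝ≥0 C, InformationTheory.klDiv Q P < ∞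
  tendsto : ∀ P : ℕ → Measure Ω, (∀ k, P k ∈ convexHull ℝ≥0 C) →
    Tendsto (fun k => InformationTheory.klDiv Q (P k)) atTop
      (𝓝 (⨅ P ∈ convexHull ℝ≥0 C, InformationTheory.klDiv Q P)) →
    Tendsto (fun k => eLpNorm
      (fun u => Real.log (((P k).rnDeriv volume u).toReal) - Real.log (ρ u)) 1 Q) atTop (𝓝 0)

/-- The set of laws of a single outcome under the location family with covariance `S`. -/
def family (S : Matrix (Fin d) (Fin d) ℝ) : Set (Measure (Vec d)) :=
  Set.range fun m => multivariateGaussian m S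

/-- The set of laws of `U^n` under the location family with covariance `S`. -/
def familyN (n : ℕ) (S : Matrix (Fin d) (Fin d) ℝ) : Set (Measure (Sample d n)) :=
  Set.range fun m => gaussLaw n m S

/-! ### Estimators and the e-variables -/

/-- The maximum likelihood estimator `n⁻¹ ∑ X_i`. -/
def mle {n : ℕ} (u : Sample d n) : Vec d := (n : ℝ)⁻¹ • ∑ i, u i

/-- The prequential plug-in estimator `(x₀ n₀ + ∑_{j ≤ i} x_j) / (i + n₀)` based on the first
`i` outcomes, which is used to predict the outcome `u i = U_{i+1}`. -/
def plugin (x₀ : Vec d) (n₀ : ℝ) {n : ℕ} (u : Sample d n) (i : Fin n) : Vec d :=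
  ((i : ℝ) + n₀)⁻¹ • (n₀ • x₀ + ∑ j ∈ Finset.Iio i, u j)

/-- The universal inference e-variable with the plug-in method. -/
def pluginUI (Sp Sq : Matrix (Fin d) (Fin d) ℝ) (x₀ : Vec d) (n₀ : ℝ) {n : ℕ}
    (u : Sample d n) : ℝ :=
  (∏ i, gaussPDF (plugin x₀ n₀ u i) Sq (u i)) / gaussPDFn (mle u) Sp u

/-- The universal inference e-variable with the prior `W` on the alternative. -/
def bayesUI (Sp Sq : Matrix (Fin d) (Fin d) ℝ) (W : Measure (Vec d)) {n : ℕ}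
    (u : Sample d n) : ℝ :=
  mixPDF W Sq u / gaussPDFn (mle u) Sp u

/-- The sufficient statistic `Z = n^{-1/2} ∑ X_i`. -/
def suffStat {n : ℕ} (u : Sample d n) : Vec d := (Real.sqrt n)⁻¹ • ∑ i, u i

/-- `S` is (a version of) the conditional e-variable `q(U^n ∣ Z) / p(U^n ∣ Z)`. Here `κp` and `κq`
are the regular conditional distributions of `U^n` given `Z`, the same for all elements of the
null and of the alternative, and `p`, `q` are their densities relative to a common random
measure `ν'(· ∣ Z)`. -/
def IsCond (Sp Sq : Matrix (Fin d) (Fin d) ℝ) {n : ℕ} (S : Sample d n → ℝ) : Prop :=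
  ∃ (κp κq ν' : Kernel (Vec d) (Sample d n)) (p q : Vec d → Sample d n → ℝ),
    IsMarkovKernel κp ∧ IsMarkovKernel κq ∧
    (∀ m, HasCondDistrib id suffStat κp (gaussLaw n m Sp)) ∧
    (∀ m, HasCondDistrib id suffStat κq (gaussLaw n m Sq)) ∧
    Measurable (Function.uncurry p) ∧ Measurable (Function.uncurry q) ∧
    (∀ z u, 0 ≤ p z u) ∧ (∀ z u, 0 ≤ q z u) ∧
    (∀ z, κp z = (ν' z).withDensity fun u => ENNReal.ofReal (p z u)) ∧
    (∀ z, κq z = (ν' z).withDensity fun u => ENNReal.ofReal (q z u)) ∧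
    ∀ u, S u = q (suffStat u) u / p (suffStat u) u

/-- `S` is (a version of) the sequential RIPr e-variable with the plug-in method. Here `ρ m` is the
density of the single-outcome reverse information projection of `Q_m`, chosen jointly
measurably. -/
def IsSeqRIPr (Sp Sq : Matrix (Fin d) (Fin d) ℝ) (x₀ : Vec d) (n₀ : ℝ) {n : ℕ}
    (S : Sample d n → ℝ) : Prop :=
  ∃ ρ : Vec d → Vec d → ℝ, Measurable (Function.uncurry ρ) ∧
    (∀ m, IsRIPr (multivariateGaussian m Sq) (family Sp) (ρ m)) ∧
    ∀ u, S u = ∏ i, gaussPDF (plugin x₀ n₀ u i) Sq (u i) / ρ (plugin x₀ n₀ u i) (u i)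

/-- `S` is (a version of) the RIPr e-variable `q_W / p_{↜ q_W}` with the prior `W` on the
alternative. -/
def IsBayesRIPr (Sp Sq : Matrix (Fin d) (Fin d) ℝ) (W : Measure (Vec d)) {n : ℕ}
    (S : Sample d n → ℝ) : Prop :=
  ∃ ρ : Sample d n → ℝ, IsRIPr (mixLaw n W Sq) (familyN n Sp) ρ ∧
    ∀ u, S u = mixPDF W Sq u / ρ u

/-! ### The bounded remainder terms -/

/-- `∑_{i=0}^{n-1} (1 + i/n₀)⁻² vᵀ S⁻¹ v`. -/
def remA (S : Matrix (Fin d) (Fin d) ℝ) (n₀ : ℝ) (v : Vec d) (n : ℕ) : ℝ :=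
  ∑ i ∈ Finset.range n, 1 / (1 + (i : ℝ) / n₀) ^ 2 * quad S⁻¹ v

/-- `-log n + ∑_{i=1}^{n-1} i / (n₀ + i)²`. -/
def remB (n₀ : ℝ) (n : ℕ) : ℝ :=
  -Real.log n + ∑ i ∈ Finset.Ico 1 n, (i : ℝ) / (n₀ + i) ^ 2

/-- The remainder of the plug-in universal inference e-variable. -/
def remPluginUI (Sp Sq Sr : Matrix (Fin d) (Fin d) ℝ) (n₀ : ℝ) (v : Vec d) (n : ℕ) : ℝ :=
  -(dTr Sr Sp / 2) - 1 / 2 * remA Sq n₀ v n - dTr Sr Sq / 2 * remB n₀ n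

/-- The remainder of the Bayesian universal inference e-variable with prior covariance `V`. -/
def remBayesUI (Sp Sq Sr V : Matrix (Fin d) (Fin d) ℝ) (v : Vec d) (n : ℕ) : ℝ :=
  -(dTr Sr Sp / 2) - covDiv Sr Sq (Sq + (n : ℝ) • V) + (d : ℝ) / 2 * Real.log (n / (2 * Real.pi))
    - 1 / 2 * quad (V + (n : ℝ)⁻¹ • Sq)⁻¹ v

/-- The remainder of the plug-in sequential RIPr e-variable in the simple case. -/
def remSeqRIPr (Sp Sq Sr : Matrix (Fin d) (Fin d) ℝ) (n₀ : ℝ) (v : Vec d) (n : ℕ) : ℝ :=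
  1 / 2 * (remA Sp n₀ v n - remA Sq n₀ v n) + (dTr Sr Sp - dTr Sr Sq) / 2 * remB n₀ n

end GaussE

end

open GaussE

open GaussE

namespace GaussE

variable {d : ℕ}

/-! Everything rests on the sufficiency of the sample mean and on one convexity argument for reverse
information projections.

Sufficiency: the exponent of the joint density splits at the sample mean (`sum_quad_sub`), so the
joint density is a factor `profile S u` free of the parameter times the density of N(m, S/n) at the
mean (`gaussPDFn_eq_profile_mul`). A Gaussian prior N(m, V) only convolves the second factor into
N(m, V + S/n) (`mixPDF_multivariateGaussian`). With V₀ = V + (Sq - Sp)/n the second factors for the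
alternative and the null coincide, so the ratio of Bayes marginals collapses to `condRatio`, the
quotient of the profiles, which is also the conditional likelihood ratio given the sufficient
statistic (`mixPDF_div_mixPDF`, `IsCond.ae_eq`).

Projection: suppose q/ρ is an e-variable for the null. For P in the convex hull with density p, the
function t = log(p/ρ) satisfies E_Q[exp t] ≤ 1. Hence E_Q[t] ≤ 0, which says that P has divergence
at least E_Q[log(q/ρ)], and E_Q|t| is small whenever E_Q[t] is close to 0
(`integral_abs_le_of_lintegral_exp`). So if ρ is moreover approached in divergence by finite
mixtures, it is the projection (`isRIPr_of_compatibleLaws`). A mixture over an arbitrary prior is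
approached in this way by pushing the prior through simple functions
(`IsDensityFamily.exists_tendsto_klDiv`). The same bound, with t = log S' - log(q/ρ) for a competing
e-variable S', gives growth optimality (`isGRO_of_lintegral_le`). The e-variable inequality comes
from exponential tilting in the simple case (`gaussPDF_mul_div`), is trivial in the anti-simple case
because there ρ = q, and for the Gaussian prior holds because `condRatio` has conditional mean one
under the null.

E-powers: each explicit e-variable is built from constants and Gaussian densities evaluated at
affine statistics of the sample. Their expected logarithms involve only second moments, all
instances of `HasMeanCov.quad_linear`. The remainders are then controlled by convergent series, the
harmonic sum and the continuity of determinant and inverse. Projections and conditional densities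
are only determined almost everywhere; every version is compared with an explicit continuous one,
and the comparison is carried to R by absolute continuity or by continuity of the version. -/

/-! ### Quadratic forms -/

lemma quad_add {A : Matrix (Fin d) (Fin d) ℝ} (hA : Aᵀ = A) (x y : Vec d) :
    quad A (x + y) = quad A x + quad A y + 2 * (WithLp.ofLp x ⬝ᵥ A *ᵥ WithLp.ofLp y) := by
  have h : WithLp.ofLp y ⬝ᵥ A *ᵥ WithLp.ofLp x = WithLp.ofLp x ⬝ᵥ A *ᵥ WithLp.ofLp y := by
    rw [Matrix.dotProduct_mulVec, ← Matrix.mulVec_transpose, hA, dotProduct_comm]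
  simp only [quad, WithLp.ofLp_add, Matrix.mulVec_add, add_dotProduct, dotProduct_add, h]
  ring

lemma quad_smul (A : Matrix (Fin d) (Fin d) ℝ) (c : ℝ) (x : Vec d) :
    quad A (c • x) = c ^ 2 * quad A x := by
  simp only [quad, WithLp.ofLp_smul, Matrix.mulVec_smul, smul_dotProduct, dotProduct_smul,
    smul_eq_mul]
  ring

lemma quad_zero (A : Matrix (Fin d) (Fin d) ℝ) : quad A 0 = 0 := by
  simp [quad]

lemma quad_neg (A : Matrix (Fin d) (Fin d) ℝ) (x : Vec d) : quad A (-x) = quad A x := by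
  simpa using quad_smul A (-1) x

lemma quad_smul_matrix (A : Matrix (Fin d) (Fin d) ℝ) (c : ℝ) (x : Vec d) :
    quad (c • A) x = c * quad A x := by
  simp [quad, Matrix.smul_mulVec]

lemma quad_eq_sum (A : Matrix (Fin d) (Fin d) ℝ) (x : Vec d) :
    quad A x = ∑ i, ∑ j, A i j * (x i * x j) := by
  simp only [quad, dotProduct, Matrix.mulVec, Finset.mul_sum]
  refine Finset.sum_congr rfl fun i _ => Finset.sum_congr rfl fun j _ => by ring

@[fun_prop]
lemma continuous_quad (A : Matrix (Fin d) (Fin d) ℝ) : Continuous (quad A) := by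
  simp_rw [funext (quad_eq_sum A)]
  fun_prop

@[fun_prop]
lemma continuous_quad_comp {X : Type*} [TopologicalSpace X] (A : Matrix (Fin d) (Fin d) ℝ)
    {f : X → Vec d} (hf : Continuous f) : Continuous fun x => quad A (f x) :=
  (continuous_quad A).comp hf

lemma quad_nonneg {A : Matrix (Fin d) (Fin d) ℝ} (hA : A.PosSemidef) (x : Vec d) :
    0 ≤ quad A x := by
  simpa [quad] using hA.dotProduct_mulVec_nonneg (WithLp.ofLp x)

lemma exists_quad_le (A : Matrix (Fin d) (Fin d) ℝ) :
    ∃ C : ℝ, 0 ≤ C ∧ ∀ x : Vec d, |quad A x| ≤ C * ‖x‖ ^ 2 := by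
  refine ⟨∑ i, ∑ j, |A i j|, by positivity, fun x => ?_⟩
  rw [quad_eq_sum, Finset.sum_mul]
  refine (Finset.abs_sum_le_sum_abs _ _).trans (Finset.sum_le_sum fun i _ => ?_)
  rw [Finset.sum_mul]
  refine (Finset.abs_sum_le_sum_abs _ _).trans (Finset.sum_le_sum fun j _ => ?_)
  rw [abs_mul, abs_mul, sq]
  have h : ∀ i, |x i| ≤ ‖x‖ := fun i => by simpa using PiLp.norm_apply_le x i
  gcongr <;> exact h _

lemma posDef_transpose {S : Matrix (Fin d) (Fin d) ℝ} (hS : S.PosDef) : Sᵀ = S := by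
  simpa using hS.isHermitian.eq

/-! ### The Gaussian density -/

lemma gaussPDF_const_pos {S : Matrix (Fin d) (Fin d) ℝ} (hS : S.PosDef) :
    0 < (2 * Real.pi) ^ d * S.det := by
  have := hS.det_pos
  positivity

lemma gaussPDF_pos {S : Matrix (Fin d) (Fin d) ℝ} (hS : S.PosDef) (m x : Vec d) :
    0 < gaussPDF m S x := by
  have := gaussPDF_const_pos hS
  unfold gaussPDF
  positivity

lemma continuous_gaussPDF {X : Type*} [TopologicalSpace X] (S : Matrix (Fin d) (Fin d) ℝ)
    {f g : X → Vec d} (hf : Continuous f) (hg : Continuous g) :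
    Continuous fun x => gaussPDF (f x) S (g x) := by
  unfold gaussPDF
  fun_prop

lemma log_gaussPDF {S : Matrix (Fin d) (Fin d) ℝ} (hS : S.PosDef) (m x : Vec d) :
    Real.log (gaussPDF m S x) =
      -(1 / 2) * Real.log ((2 * Real.pi) ^ d * S.det) - quad S⁻¹ (x - m) / 2 := by
  have := gaussPDF_const_pos hS
  rw [gaussPDF, Real.log_mul (by positivity) (by positivity), Real.log_exp, Real.log_inv,
    Real.log_sqrt this.le]
  ring

lemma gaussPDF_le {S : Matrix (Fin d) (Fin d) ℝ} (hS : S.PosDef) (m x : Vec d) :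
    gaussPDF m S x ≤ (Real.sqrt ((2 * Real.pi) ^ d * S.det))⁻¹ := by
  unfold gaussPDF
  refine mul_le_of_le_one_right (by positivity) (Real.exp_le_one_iff.2 ?_)
  have := quad_nonneg hS.inv.posSemidef (x - m)
  linarith

lemma gaussPDF_comm (S : Matrix (Fin d) (Fin d) ℝ) (m x : Vec d) :
    gaussPDF m S x = gaussPDF x S m := by
  unfold gaussPDF
  rw [← neg_sub, quad_neg]

open Matrix in
open scoped MatrixOrder in
-- `multivariateGaussian` is the affine image of the standard Gaussian under this particular root,
-- whose determinant becomes the Jacobian of the change of variables.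
lemma exists_sqrt {S : Matrix (Fin d) (Fin d) ℝ} (hS : S.PosDef) :
    (CFC.sqrt S) * (CFC.sqrt S) = S ∧ (CFC.sqrt S).det = Real.sqrt S.det ∧
      (CFC.sqrt S)ᵀ = CFC.sqrt S := by
  have h1 : (CFC.sqrt S) * (CFC.sqrt S) = S := CFC.sqrt_mul_sqrt_self S hS.posSemidef.nonneg
  have h2 : (CFC.sqrt S).PosSemidef := Matrix.nonneg_iff_posSemidef.1 (CFC.sqrt_nonneg S)
  refine ⟨h1, ?_, by simpa using h2.isHermitian.eq⟩
  have h3 : (CFC.sqrt S).det * (CFC.sqrt S).det = S.det := by rw [← Matrix.det_mul, h1]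
  rw [← h3, Real.sqrt_mul_self h2.det_nonneg]

/-- Whitening: S⁻¹ = T⁻¹T⁻¹, and by symmetry of T one inverse cancels on each side of the form. -/
lemma quad_inv_sqrt {S T : Matrix (Fin d) (Fin d) ℝ} (hS : S.PosDef) (hT : T * T = S)
    (hT' : Tᵀ = T) (x : Vec d) :
    quad S⁻¹ (Matrix.toEuclideanCLM (𝕜 := ℝ) T x) = ‖x‖ ^ 2 := by
  have hu : IsUnit T.det := by
    have : T.det * T.det = S.det := by rw [← Matrix.det_mul, hT]
    rw [isUnit_iff_ne_zero]
    intro h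
    have := hS.det_pos
    simp_all
  rw [quad, Matrix.ofLp_toEuclideanCLM, ← hT, Matrix.mul_inv_rev, Matrix.mulVec_mulVec,
    Matrix.mul_assoc, Matrix.nonsing_inv_mul _ hu, Matrix.mul_one, dotProduct_comm,
    Matrix.dotProduct_mulVec, ← Matrix.mulVec_transpose, Matrix.mulVec_mulVec,
    hT', Matrix.mul_nonsing_inv _ hu, Matrix.one_mulVec, EuclideanSpace.real_norm_sq_eq]
  simp [dotProduct, sq]

/-- Finite measures are determined by their characteristic functions, and that of the right-hand
side is the classical Gaussian Fourier integral with b = 1/2. -/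
lemma stdGaussian_eq_withDensity :
    stdGaussian (Vec d) = (volume : Measure (Vec d)).withDensity fun x =>
      ENNReal.ofReal ((Real.sqrt ((2 * Real.pi) ^ d))⁻¹ * Real.exp (-(‖x‖ ^ 2) / 2)) := by
  have hpos : (0 : ℝ) < (2 * Real.pi) ^ d := by positivity
  have hi : Integrable (fun x : Vec d =>
      (Real.sqrt ((2 * Real.pi) ^ d))⁻¹ * Real.exp (-(‖x‖ ^ 2) / 2)) := by
    refine Integrable.const_mul ?_ _
    have := (GaussianFourier.integrable_cexp_neg_mul_sq_norm_add (V := Vec d) (b := 1 / 2)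
      (by norm_num) 0 0).norm
    refine this.congr (Eventually.of_forall fun x => ?_)
    simp only [Complex.norm_exp]
    congr 1
    have : (-(1 / 2 : ℂ) * (‖x‖ : ℂ) ^ 2 + 0 * ((inner ℝ (0 : Vec d) x : ℝ) : ℂ)) =
      ((-(‖x‖ ^ 2) / 2 : ℝ) : ℂ) := by push_cast; ring
    rw [this, Complex.ofReal_re]
  have : IsFiniteMeasure ((volume : Measure (Vec d)).withDensity fun x =>
      ENNReal.ofReal ((Real.sqrt ((2 * Real.pi) ^ d))⁻¹ * Real.exp (-(‖x‖ ^ 2) / 2))) :=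
    isFiniteMeasure_withDensity_ofReal hi.2
  apply Measure.ext_of_charFun
  ext t
  rw [charFun_stdGaussian, charFun_apply,
    integral_withDensity_eq_integral_toReal_smul (by fun_prop)
      (Eventually.of_forall fun _ => ENNReal.ofReal_lt_top)]
  have h := GaussianFourier.integral_cexp_neg_mul_sq_norm_add (V := Vec d) (b := 1 / 2)
      (by norm_num) Complex.I t
  have h2 : ∀ x : Vec d, (ENNReal.ofReal ((Real.sqrt ((2 * Real.pi) ^ d))⁻¹ *
      Real.exp (-(‖x‖ ^ 2) / 2))).toReal • Complex.exp (inner ℝ x t * Complex.I) =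
      ((Real.sqrt ((2 * Real.pi) ^ d))⁻¹ : ℝ) *
        Complex.exp (-(1 / 2) * ‖x‖ ^ 2 + Complex.I * (inner ℝ t x : ℝ)) := by
    intro x
    rw [ENNReal.toReal_ofReal (by positivity), Complex.real_smul, Complex.ofReal_mul, mul_assoc,
      Complex.ofReal_exp, ← Complex.exp_add, real_inner_comm x t]
    congr 2
    push_cast
    ring
  simp_rw [h2]
  rw [integral_const_mul, h, ← mul_assoc]
  -- The Fourier integral comes with the complex power (π/b)^(d/2) for b = 1/2, which is the real
  -- normalizing constant.
  have h3 : ((Real.sqrt ((2 * Real.pi) ^ d))⁻¹ : ℝ) *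
      ((Real.pi : ℂ) / (1 / 2)) ^ ((Module.finrank ℝ (Vec d) : ℂ) / 2) = 1 := by
    have h4 : ((Real.pi : ℂ) / (1 / 2)) = ((2 * Real.pi : ℝ) : ℂ) := by push_cast; ring
    rw [h4, finrank_euclideanSpace_fin]
    have h5 : ((d : ℂ) / 2) = (((d : ℝ) / 2 : ℝ) : ℂ) := by push_cast; ring
    rw [h5, ← Complex.ofReal_cpow (by positivity), ← Complex.ofReal_mul]
    have h6 : (2 * Real.pi) ^ ((d : ℝ) / 2) = Real.sqrt ((2 * Real.pi) ^ d) := by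
      rw [Real.sqrt_eq_rpow, ← Real.rpow_natCast, ← Real.rpow_mul (by positivity)]
      congr 1
      ring
    rw [h6, inv_mul_cancel₀ (by positivity), Complex.ofReal_one]
  rw [h3, one_mul]
  congr 1
  rw [Complex.I_sq]
  ring

lemma map_withDensity_equiv {X Y : Type*} [MeasurableSpace X] [MeasurableSpace Y] (μ : Measure X)
    (e : X ≃ᵐ Y) (f : X → ℝ≥0∞) :
    (μ.withDensity f).map e = (μ.map e).withDensity (f ∘ e.symm) := by
  ext s hs
  rw [e.map_apply, withDensity_apply _ (e.measurable hs), withDensity_apply _ hs,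
    e.restrict_map, MeasureTheory.lintegral_map_equiv]
  simp

open scoped MatrixOrder in
-- Change of variables along x ↦ m + Tx, with T the positive root of S: Lebesgue measure is scaled
-- by det(S)^(-1/2), and whitening turns the squared norm into the form of S⁻¹.
lemma multivariateGaussian_eq_withDensity {S : Matrix (Fin d) (Fin d) ℝ} (hS : S.PosDef)
    (m : Vec d) :
    multivariateGaussian m S =
      volume.withDensity fun x => ENNReal.ofReal (gaussPDF m S x) := by
  obtain ⟨h1, h2, h3⟩ := exists_sqrt hS
  have hdS := hS.det_pos
  set T := CFC.sqrt S with hTdef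
  set L : Vec d →L[ℝ] Vec d := Matrix.toEuclideanCLM (𝕜 := ℝ) T with hL
  have hdet : LinearMap.det (L : Vec d →ₗ[ℝ] Vec d) = Real.sqrt S.det := by
    rw [← h2]
    have : (L : Vec d →ₗ[ℝ] Vec d) = Matrix.toLpLin 2 2 T := by
      ext x; rfl
    rw [this, Matrix.toLpLin_eq_toLin, LinearMap.det_toLin]
  have hdet0 : LinearMap.det (L : Vec d →ₗ[ℝ] Vec d) ≠ 0 := by rw [hdet]; positivity
  let e1 : Vec d ≃L[ℝ] Vec d :=
    (LinearEquiv.ofIsUnitDet (f := (L : Vec d →ₗ[ℝ] Vec d)) (v := Module.finBasis ℝ (Vec d))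
      (v' := Module.finBasis ℝ (Vec d)) (by
        rw [LinearMap.det_toMatrix]; exact isUnit_iff_ne_zero.2 hdet0)).toContinuousLinearEquiv
  have he1 : ∀ x, e1 x = L x := fun x => rfl
  let e : Vec d ≃ᵐ Vec d :=
    (e1.toHomeomorph.trans (Homeomorph.addLeft m)).toMeasurableEquiv
  have he : ∀ x, e x = m + L x := fun x => rfl
  have hvol : (volume : Measure (Vec d)).map e =
      ENNReal.ofReal (Real.sqrt S.det)⁻¹ • (volume : Measure (Vec d)) := by
    have : (e : Vec d → Vec d) = (fun x => m + x) ∘ (L : Vec d →ₗ[ℝ] Vec d) := rfl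
    rw [this, ← Measure.map_map (by fun_prop) (by exact L.measurable),
      Measure.map_linearMap_addHaar_eq_smul_addHaar _ hdet0, Measure.map_smul,
      MeasureTheory.map_add_left_eq_self, hdet, abs_of_nonneg (by positivity)]
  rw [multivariateGaussian, stdGaussian_eq_withDensity]
  change Measure.map e _ = _
  rw [map_withDensity_equiv, hvol, withDensity_smul_measure, ← withDensity_smul]
  · congr 1
    ext x
    obtain ⟨y, rfl⟩ := e.surjective x
    simp only [Pi.smul_apply, Function.comp, e.symm_apply_apply, smul_eq_mul]
    rw [← ENNReal.ofReal_mul (by positivity), gaussPDF, he, add_sub_cancel_left,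
      quad_inv_sqrt hS h1 h3, Real.sqrt_mul (by positivity), mul_inv, ← mul_assoc,
      mul_comm (Real.sqrt S.det)⁻¹]
  · refine Measurable.comp ?_ e.symm.measurable
    fun_prop

end GaussE

namespace GaussE

variable {d : ℕ}

/-! ### Products of densities and convolutions -/

lemma pi_withDensity_ofReal {ι X : Type*} [Fintype ι] [MeasurableSpace X] (μ : Measure X)
    [SigmaFinite μ] {f : ι → X → ℝ} (hf : ∀ i x, 0 ≤ f i x) (hfi : ∀ i, Integrable (f i) μ) :
    (Measure.pi fun i : ι => μ.withDensity fun x => ENNReal.ofReal (f i x)) =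
      (Measure.pi fun _ : ι => μ).withDensity fun u => ENNReal.ofReal (∏ i, f i (u i)) := by
  have : ∀ i, IsFiniteMeasure (μ.withDensity fun x => ENNReal.ofReal (f i x)) := fun i =>
    isFiniteMeasure_withDensity_ofReal (hfi i).2
  refine Measure.pi_eq fun s hs => ?_
  rw [withDensity_apply _ (MeasurableSet.univ_pi hs), Measure.restrict_pi_pi,
    ← ofReal_integral_eq_lintegral_ofReal, integral_fintype_prod_eq_prod,
    ENNReal.ofReal_prod_of_nonneg]
  · refine Finset.prod_congr rfl fun i _ => ?_
    rw [withDensity_apply _ (hs i), ← ofReal_integral_eq_lintegral_ofReal (hfi i).restrict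
      (Eventually.of_forall (hf i))]
  · exact fun i _ => integral_nonneg (hf i)
  · exact Integrable.fintype_prod fun i => (hfi i).restrict
  · exact Eventually.of_forall fun u => Finset.prod_nonneg fun i _ => hf i _

lemma pi_absolutelyContinuous {ι X : Type*} [Fintype ι] [MeasurableSpace X] {μ ν : Measure X}
    [SigmaFinite μ] [IsFiniteMeasure ν] (h : ν ≪ μ) :
    (Measure.pi fun _ : ι => ν) ≪ Measure.pi fun _ : ι => μ := by
  -- A Radon–Nikodym density for one factor gives a product density for the product law.
  have h1 : ν = μ.withDensity fun x => ENNReal.ofReal (ν.rnDeriv μ x).toReal := by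
    conv_lhs => rw [← Measure.withDensity_rnDeriv_eq ν μ h]
    refine withDensity_congr_ae ?_
    filter_upwards [Measure.rnDeriv_lt_top ν μ] with x hx
    rw [ENNReal.ofReal_toReal hx.ne]
  rw [h1, pi_withDensity_ofReal μ (fun _ _ => ENNReal.toReal_nonneg)
    fun _ => Measure.integrable_toReal_rnDeriv]
  exact withDensity_absolutelyContinuous _ _

lemma measurable_gaussPDF_uncurry (S : Matrix (Fin d) (Fin d) ℝ) :
    Measurable fun p : Vec d × Vec d => gaussPDF p.1 S p.2 :=
  (continuous_gaussPDF S continuous_fst continuous_snd).measurable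

lemma lintegral_gaussPDF {S : Matrix (Fin d) (Fin d) ℝ} (hS : S.PosDef) (m : Vec d) :
    ∫⁻ x, ENNReal.ofReal (gaussPDF m S x) = 1 := by
  have : IsProbabilityMeasure (multivariateGaussian m S) := inferInstance
  rw [multivariateGaussian_eq_withDensity hS] at this
  have h := this.measure_univ
  rwa [withDensity_apply _ MeasurableSet.univ, Measure.restrict_univ] at h

lemma integrable_gaussPDF {S : Matrix (Fin d) (Fin d) ℝ} (hS : S.PosDef) (m : Vec d) :
    Integrable (gaussPDF m S) := by
  refine ⟨(continuous_gaussPDF S continuous_const continuous_id).aestronglyMeasurable, ?_⟩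
  rw [hasFiniteIntegral_iff_ofReal (Eventually.of_forall fun x => (gaussPDF_pos hS m x).le),
    lintegral_gaussPDF hS]
  exact ENNReal.one_lt_top

lemma gaussLaw_eq_withDensity {S : Matrix (Fin d) (Fin d) ℝ} (hS : S.PosDef) (n : ℕ)
    (m : Vec d) :
    gaussLaw n m S = volume.withDensity fun u => ENNReal.ofReal (gaussPDFn m S u) := by
  simp_rw [gaussLaw, multivariateGaussian_eq_withDensity hS]
  exact pi_withDensity_ofReal _ (fun _ x => (gaussPDF_pos hS m x).le)
    fun _ => integrable_gaussPDF hS m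

instance (n : ℕ) (m : Vec d) (S : Matrix (Fin d) (Fin d) ℝ) :
    IsProbabilityMeasure (gaussLaw n m S) := by
  unfold gaussLaw; infer_instance

lemma multivariateGaussian_conv {S V : Matrix (Fin d) (Fin d) ℝ} (hS : S.PosSemidef)
    (hV : V.PosSemidef) (m : Vec d) :
    multivariateGaussian m V ∗ multivariateGaussian 0 S = multivariateGaussian m (V + S) := by
  apply Measure.ext_of_charFun
  ext t
  rw [charFun_conv, charFun_multivariateGaussian hV, charFun_multivariateGaussian hS,
    charFun_multivariateGaussian (hV.add hS), ← Complex.exp_add, Matrix.add_mulVec, dotProduct_add]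
  congr 1
  simp
  ring

lemma lintegral_add_multivariateGaussian {S : Matrix (Fin d) (Fin d) ℝ} (hS : S.PosDef)
    (y : Vec d) {f : Vec d → ℝ≥0∞} (hf : Measurable f) :
    ∫⁻ x, f (y + x) ∂multivariateGaussian 0 S =
      ∫⁻ x, ENNReal.ofReal (gaussPDF y S x) * f x := by
  have h0 : Measurable fun x => ENNReal.ofReal (gaussPDF 0 S x) :=
    (continuous_gaussPDF S continuous_const continuous_id).measurable.ennreal_ofReal
  rw [multivariateGaussian_eq_withDensity hS, lintegral_withDensity_eq_lintegral_mul _ h0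
    (g := fun x => f (y + x)) (hf.comp (measurable_const_add y)),
    ← lintegral_add_left_eq_self (fun x => ENNReal.ofReal (gaussPDF y S x) * f x) y]
  refine lintegral_congr fun x => ?_
  simp [gaussPDF]

lemma measurable_lintegral_gaussPDF (S : Matrix (Fin d) (Fin d) ℝ) (W : Measure (Vec d))
    [SFinite W] : Measurable fun x : Vec d => ∫⁻ y, ENNReal.ofReal (gaussPDF y S x) ∂W := by
  have h1 : Measurable fun p : Vec d × Vec d => ENNReal.ofReal (gaussPDF p.2 S p.1) :=
    (continuous_gaussPDF S continuous_snd continuous_fst).measurable.ennreal_ofReal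
  exact Measurable.lintegral_prod_right h1

/-- Averaging the translates of N(0, S) over a random centre is convolution with the law of the
centre. Only S needs to be nondegenerate; V may be singular, as the prior covariance for the null
can be. -/
lemma withDensity_lintegral_gaussPDF {S V : Matrix (Fin d) (Fin d) ℝ} (hS : S.PosDef)
    (hV : V.PosSemidef) (m : Vec d) :
    (volume.withDensity fun x => ∫⁻ y, ENNReal.ofReal (gaussPDF y S x) ∂multivariateGaussian m V)
      = multivariateGaussian m (V + S) := by
  rw [← multivariateGaussian_conv hS.posSemidef hV]
  have hmeas := (measurable_gaussPDF_uncurry S).ennreal_ofReal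
  refine Measure.ext_of_lintegral _ fun f hf => ?_
  rw [Measure.lintegral_conv hf, lintegral_withDensity_eq_lintegral_mul _
    (measurable_lintegral_gaussPDF S _) hf]
  simp_rw [lintegral_add_multivariateGaussian hS _ hf]
  rw [lintegral_lintegral_swap ((hmeas.mul (hf.comp measurable_snd)).aemeasurable)]
  refine lintegral_congr fun x => ?_
  have h4 : Measurable fun y => ENNReal.ofReal (gaussPDF y S x) :=
    (continuous_gaussPDF S continuous_id continuous_const).measurable.ennreal_ofReal
  rw [lintegral_mul_const _ h4]
  rfl

lemma integrable_gaussPDF_mean {S : Matrix (Fin d) (Fin d) ℝ} (hS : S.PosDef)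
    (W : Measure (Vec d)) [IsFiniteMeasure W] (x : Vec d) :
    Integrable (fun m => gaussPDF m S x) W := by
  refine Integrable.of_bound (C := (Real.sqrt ((2 * Real.pi) ^ d * S.det))⁻¹)
    (continuous_gaussPDF S continuous_id continuous_const).aestronglyMeasurable
    (Eventually.of_forall fun m => ?_)
  rw [Real.norm_of_nonneg (gaussPDF_pos hS m x).le]
  exact gaussPDF_le hS m x

/-- Gaussian convolution, as an identity of densities. -/
lemma integral_gaussPDF_multivariateGaussian {S V : Matrix (Fin d) (Fin d) ℝ} (hS : S.PosDef)
    (hV : V.PosSemidef) (m x : Vec d) :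
    ∫ y, gaussPDF y S x ∂multivariateGaussian m V = gaussPDF m (V + S) x := by
  have hVS : (V + S).PosDef := hS.posSemidef_add hV
  -- The equality of measures identifies the densities almost everywhere only; continuity of both
  -- sides makes the identity hold at every point.
  have hcont : Continuous fun x => ∫ y, gaussPDF y S x ∂multivariateGaussian m V := by
    refine continuous_of_dominated (F := fun x y => gaussPDF y S x)
      (bound := fun _ => (Real.sqrt ((2 * Real.pi) ^ d * S.det))⁻¹)
      (fun x => (continuous_gaussPDF S continuous_id continuous_const).aestronglyMeasurable)
      (fun x => Eventually.of_forall fun y => ?_) (integrable_const _)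
      (Eventually.of_forall fun y => continuous_gaussPDF S continuous_const continuous_id)
    rw [Real.norm_of_nonneg (gaussPDF_pos hS y x).le]
    exact gaussPDF_le hS y x
  have h := withDensity_lintegral_gaussPDF hS hV m
  rw [multivariateGaussian_eq_withDensity hVS, withDensity_eq_iff_of_sigmaFinite] at h
  rotate_left
  · exact (measurable_lintegral_gaussPDF S _).aemeasurable
  · exact (continuous_gaussPDF _ continuous_const continuous_id).measurable.ennreal_ofReal.aemeasurable
  have h2 : (fun x => ∫ y, gaussPDF y S x ∂multivariateGaussian m V) =ᵐ[volume]
      gaussPDF m (V + S) := by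
    filter_upwards [h] with x hx
    rw [← ofReal_integral_eq_lintegral_ofReal (integrable_gaussPDF_mean hS _ x)
      (Eventually.of_forall fun y => (gaussPDF_pos hS y x).le)] at hx
    exact (ENNReal.ofReal_eq_ofReal_iff (integral_nonneg fun y => (gaussPDF_pos hS y x).le)
      (gaussPDF_pos hVS m x).le).1 hx
  exact congrFun (Continuous.ae_eq_iff_eq volume hcont
    (continuous_gaussPDF _ continuous_const continuous_id) |>.1 h2) x

/-! ### Samples and their mean -/

@[fun_prop]
lemma continuous_mle {n : ℕ} : Continuous (mle : Sample d n → Vec d) := by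
  unfold mle; fun_prop

@[fun_prop]
lemma continuous_suffStat {n : ℕ} : Continuous (suffStat : Sample d n → Vec d) := by
  unfold suffStat; fun_prop

/-- The cross terms vanish because the deviations from the sample mean sum to zero. -/
lemma sum_quad_sub {n : ℕ} (hn : 1 ≤ n) {A : Matrix (Fin d) (Fin d) ℝ} (hA : Aᵀ = A)
    (u : Sample d n) (m : Vec d) :
    ∑ i, quad A (u i - m) = ∑ i, quad A (u i - mle u) + n * quad A (mle u - m) := by
  have hn0 : (n : ℝ) ≠ 0 := by positivity
  have h1 : ∀ i, quad A (u i - m) = quad A (u i - mle u) + quad A (mle u - m) +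
      2 * (WithLp.ofLp (u i - mle u) ⬝ᵥ A *ᵥ WithLp.ofLp (mle u - m)) := fun i => by
    rw [← quad_add hA, sub_add_sub_cancel]
  have h2 : ∑ i, (u i - mle u) = 0 := by
    rw [Finset.sum_sub_distrib, mle, Finset.sum_const, Finset.card_univ, Fintype.card_fin,
      ← Nat.cast_smul_eq_nsmul ℝ, smul_smul, mul_inv_cancel₀ hn0, one_smul, sub_self]
  have h3 : ∑ i, (WithLp.ofLp (u i - mle u) ⬝ᵥ A *ᵥ WithLp.ofLp (mle u - m)) = 0 := by
    rw [← sum_dotProduct, ← WithLp.ofLp_sum, h2]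
    simp
  simp_rw [h1, Finset.sum_add_distrib, ← Finset.mul_sum, h3]
  simp

lemma gaussPDFn_eq {n : ℕ} (S : Matrix (Fin d) (Fin d) ℝ) (m : Vec d) (u : Sample d n) :
    gaussPDFn m S u = (Real.sqrt ((2 * Real.pi) ^ d * S.det))⁻¹ ^ n *
      Real.exp (-(∑ i, quad S⁻¹ (u i - m)) / 2) := by
  simp only [gaussPDFn, gaussPDF, Finset.prod_mul_distrib, Finset.prod_const, Finset.card_univ,
    Fintype.card_fin, ← Real.exp_sum]
  rw [← Finset.sum_div, Finset.sum_neg_distrib]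

lemma gaussPDFn_pos {n : ℕ} {S : Matrix (Fin d) (Fin d) ℝ} (hS : S.PosDef) (m : Vec d)
    (u : Sample d n) : 0 < gaussPDFn m S u :=
  Finset.prod_pos fun _ _ => gaussPDF_pos hS _ _

lemma continuous_gaussPDFn {X : Type*} [TopologicalSpace X] {n : ℕ}
    (S : Matrix (Fin d) (Fin d) ℝ) {f : X → Vec d} {g : X → Sample d n} (hf : Continuous f)
    (hg : Continuous g) : Continuous fun x => gaussPDFn (f x) S (g x) := by
  unfold gaussPDFn
  exact continuous_finsetProd _ fun i _ => continuous_gaussPDF S hf (by fun_prop)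

lemma gaussPDFn_le_mle {n : ℕ} (hn : 1 ≤ n) {S : Matrix (Fin d) (Fin d) ℝ} (hS : S.PosDef)
    (u : Sample d n) (m : Vec d) : gaussPDFn m S u ≤ gaussPDFn (mle u) S u := by
  have := gaussPDF_const_pos hS
  rw [gaussPDFn_eq, gaussPDFn_eq, sum_quad_sub hn (posDef_transpose hS.inv)]
  have := quad_nonneg hS.inv.posSemidef (mle u - m)
  have hn0 : (0 : ℝ) ≤ n := by positivity
  gcongr
  nlinarith

lemma posDef_inv_smul {n : ℕ} (hn : 1 ≤ n) {S : Matrix (Fin d) (Fin d) ℝ} (hS : S.PosDef) :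
    ((n : ℝ)⁻¹ • S).PosDef := hS.smul (by positivity)

lemma inv_inv_smul {n : ℕ} (hn : 1 ≤ n) (S : Matrix (Fin d) (Fin d) ℝ) (hS : S.PosDef) :
    ((n : ℝ)⁻¹ • S)⁻¹ = (n : ℝ) • S⁻¹ := by
  have hn0 : (n : ℝ)⁻¹ ≠ 0 := by positivity
  refine Matrix.inv_eq_left_inv ?_
  rw [Matrix.smul_mul, Matrix.mul_smul, smul_smul,
    Matrix.nonsing_inv_mul _ (isUnit_iff_ne_zero.2 hS.det_pos.ne'), mul_inv_cancel₀ (by positivity),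
    one_smul]

/-- The density of a sample relative to the density of its mean. -/
noncomputable def profile (S : Matrix (Fin d) (Fin d) ℝ) {n : ℕ} (u : Sample d n) : ℝ :=
  gaussPDFn (mle u) S u * Real.sqrt ((2 * Real.pi) ^ d * ((n : ℝ)⁻¹ • S).det)

lemma profile_pos {n : ℕ} (hn : 1 ≤ n) {S : Matrix (Fin d) (Fin d) ℝ} (hS : S.PosDef)
    (u : Sample d n) : 0 < profile S u :=
  mul_pos (gaussPDFn_pos hS _ _) (Real.sqrt_pos.2 (gaussPDF_const_pos (posDef_inv_smul hn hS)))

lemma continuous_profile {n : ℕ} (S : Matrix (Fin d) (Fin d) ℝ) :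
    Continuous (profile S : Sample d n → ℝ) :=
  (continuous_gaussPDFn S (by fun_prop) continuous_id).mul continuous_const

/-- Factorization expressing sufficiency of the mean: after `sum_quad_sub` the parameter enters only
through n · quad S⁻¹ (mle u - m), which is the exponent of N(m, S/n). -/
lemma gaussPDFn_eq_profile_mul {n : ℕ} (hn : 1 ≤ n) {S : Matrix (Fin d) (Fin d) ℝ}
    (hS : S.PosDef) (m : Vec d) (u : Sample d n) :
    gaussPDFn m S u = profile S u * gaussPDF m ((n : ℝ)⁻¹ • S) (mle u) := by
  have h := Real.sqrt_pos.2 (gaussPDF_const_pos (posDef_inv_smul hn hS))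
  rw [profile, gaussPDF, mul_assoc, mul_inv_cancel_left₀ h.ne', gaussPDFn_eq, gaussPDFn_eq,
    mul_assoc, ← Real.exp_add, inv_inv_smul hn S hS, quad_smul_matrix,
    sum_quad_sub hn (posDef_transpose hS.inv)]
  congr 2
  ring

/-- The Bayes marginal density with a Gaussian prior. -/
lemma mixPDF_multivariateGaussian {n : ℕ} (hn : 1 ≤ n) {S V : Matrix (Fin d) (Fin d) ℝ}
    (hS : S.PosDef) (hV : V.PosSemidef) (m : Vec d) (u : Sample d n) :
    mixPDF (multivariateGaussian m V) S u =
      profile S u * gaussPDF m (V + (n : ℝ)⁻¹ • S) (mle u) := by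
  simp_rw [mixPDF, gaussPDFn_eq_profile_mul hn hS]
  rw [integral_const_mul, integral_gaussPDF_multivariateGaussian (posDef_inv_smul hn hS) hV]

/-- The law of the sample mean. -/
lemma gaussLaw_map_mle {n : ℕ} (hn : 1 ≤ n) {S : Matrix (Fin d) (Fin d) ℝ} (hS : S.PosDef)
    (m : Vec d) : (gaussLaw n m S).map mle = multivariateGaussian m ((n : ℝ)⁻¹ • S) := by
  have hn0 : (n : ℂ) ≠ 0 := by exact_mod_cast (by omega : n ≠ 0)
  have h : (mle : Sample d n → Vec d) = (fun x => (n : ℝ)⁻¹ • x) ∘ fun u => ∑ i, u i := rfl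
  have hm : Measurable fun u : Sample d n => ∑ i, u i := by fun_prop
  have : IsProbabilityMeasure ((gaussLaw n m S).map fun u => ∑ i, u i) :=
    Measure.isProbabilityMeasure_map hm.aemeasurable
  rw [h, ← Measure.map_map (by fun_prop) hm]
  apply Measure.ext_of_charFun
  ext t
  rw [charFun_map_smul, gaussLaw, charFun_map_sum_pi_eq_prod, Finset.prod_const, Pi.pow_apply,
    charFun_multivariateGaussian hS.posSemidef,
    charFun_multivariateGaussian (posDef_inv_smul hn hS).posSemidef, ← Complex.exp_nat_mul]
  congr 1
  simp [real_inner_smul_left, Matrix.mulVec_smul, Matrix.smul_mulVec]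
  field_simp

end GaussE

namespace GaussE

/-! ### Reverse information projections on a measure space -/

section RIPr

variable {Ω : Type*} [MeasurableSpace Ω]

/-- For t ≥ 0 combine exp t - 1 - t ≥ t²/2 with 2t ≤ ε + t²/ε; for t ≤ 0 the first summand already
suffices. Integrated, this turns control of E[exp t] and E[t] into control of E|t|. -/
lemma abs_le_of_exp (t : ℝ) {ε : ℝ} (hε : 0 < ε) :
    |t| ≤ -t + ε + 2 / ε * (Real.exp t - 1 - t) := by
  rcases le_total 0 t with ht | ht
  · have h := Real.quadratic_le_exp_of_nonneg ht
    have h2 : 2 / ε * (t ^ 2 / 2) ≤ 2 / ε * (Real.exp t - 1 - t) := by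
      gcongr; linarith
    have h3 : 2 * t ≤ ε + 2 / ε * (t ^ 2 / 2) := by
      have : ε + 2 / ε * (t ^ 2 / 2) - 2 * t = (t - ε) ^ 2 / ε := by field_simp; ring
      have : 0 ≤ (t - ε) ^ 2 / ε := by positivity
      linarith
    rw [abs_of_nonneg ht]
    linarith
  · have h := Real.add_one_le_exp t
    have h2 : 0 ≤ 2 / ε * (Real.exp t - 1 - t) := by
      refine mul_nonneg (by positivity) (by linarith)
    rw [abs_of_nonpos ht]
    linarith

lemma integrable_exp_of_lintegral {Q : Measure Ω} {t : Ω → ℝ} (ht : AEStronglyMeasurable t Q)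
    (h : ∫⁻ u, ENNReal.ofReal (Real.exp (t u)) ∂Q ≤ 1) :
    Integrable (fun u => Real.exp (t u)) Q ∧ ∫ u, Real.exp (t u) ∂Q ≤ 1 := by
  have hm : AEStronglyMeasurable (fun u => Real.exp (t u)) Q :=
    Real.continuous_exp.comp_aestronglyMeasurable ht
  have h0 : 0 ≤ᵐ[Q] fun u => Real.exp (t u) := Eventually.of_forall fun u => (Real.exp_pos _).le
  refine ⟨⟨hm, ?_⟩, ?_⟩
  · rw [hasFiniteIntegral_iff_ofReal h0]
    exact h.trans_lt ENNReal.one_lt_top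
  · rw [integral_eq_lintegral_of_nonneg_ae h0 hm]
    exact ENNReal.toReal_le_of_le_ofReal zero_le_one (by simpa using h)

/-- Integrate t ≤ exp t - 1. -/
lemma integral_nonpos_of_lintegral_exp {Q : Measure Ω} [IsProbabilityMeasure Q] {t : Ω → ℝ}
    (ht : Integrable t Q) (h : ∫⁻ u, ENNReal.ofReal (Real.exp (t u)) ∂Q ≤ 1) :
    ∫ u, t u ∂Q ≤ 0 := by
  obtain ⟨h1, h2⟩ := integrable_exp_of_lintegral ht.1 h
  have h3 : ∫ u, t u ∂Q ≤ ∫ u, (Real.exp (t u) - 1) ∂Q :=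
    integral_mono ht (h1.sub (integrable_const _)) fun u => by
      have := Real.add_one_le_exp (t u)
      simp only
      linarith
  rw [integral_sub h1 (integrable_const _)] at h3
  simp at h3
  linarith

/-- The quantitative version of `integral_nonpos_of_lintegral_exp`: if the mean of t tends to 0 then
so does its L¹ norm, since ε is free. -/
lemma integral_abs_le_of_lintegral_exp {Q : Measure Ω} [IsProbabilityMeasure Q] {t : Ω → ℝ}
    (ht : Integrable t Q) (h : ∫⁻ u, ENNReal.ofReal (Real.exp (t u)) ∂Q ≤ 1) {ε : ℝ}
    (hε : 0 < ε) :
    ∫ u, |t u| ∂Q ≤ ε + (1 + 2 / ε) * -∫ u, t u ∂Q := by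
  obtain ⟨h1, h2⟩ := integrable_exp_of_lintegral ht.1 h
  have h7 : Integrable (fun u => Real.exp (t u) - 1) Q := h1.sub (integrable_const _)
  have h3 : Integrable (fun u => Real.exp (t u) - 1 - t u) Q := h7.sub ht
  have h5 : Integrable (fun u => -t u + ε) Q := ht.neg.add (integrable_const _)
  have h4 : ∫ u, |t u| ∂Q ≤ ∫ u, (-t u + ε + 2 / ε * (Real.exp (t u) - 1 - t u)) ∂Q :=
    integral_mono ht.abs (h5.add (h3.const_mul _)) fun u => abs_le_of_exp (t u) hε
  rw [integral_add h5 (h3.const_mul _),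
    integral_add ht.fun_neg (integrable_const _), integral_const_mul,
    integral_sub h7 ht, integral_sub h1 (integrable_const _), integral_neg] at h4
  simp only [integral_const, probReal_univ, smul_eq_mul, one_mul] at h4
  have h6 : 2 / ε * (∫ u, Real.exp (t u) ∂Q - 1 - ∫ u, t u ∂Q) ≤
      2 / ε * (1 - 1 - ∫ u, t u ∂Q) := by gcongr
  linarith

variable {μ : Measure Ω}

/-- Chain rule dQ/dP · dP/dμ = dQ/dμ, where q > 0 excludes zeros of either factor off a Q-null set.
-/
lemma log_rnDeriv_eq [SigmaFinite μ] {Q P : Measure Ω} [IsProbabilityMeasure Q] [IsProbabilityMeasure P]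
    {q : Ω → ℝ} {p : Ω → ℝ≥0∞} (hq : Measurable q) (hq0 : ∀ u, 0 < q u)
    (hQ : Q = μ.withDensity fun u => ENNReal.ofReal (q u)) (hp : Measurable p)
    (hP : P = μ.withDensity p) (hac : Q ≪ P) :
    (∀ᵐ u ∂Q, 0 < (p u).toReal) ∧
      llr Q P =ᵐ[Q] fun u => Real.log (q u) - Real.log (p u).toReal := by
  have hPμ : P ≪ μ := hP ▸ withDensity_absolutelyContinuous _ _
  have hQμ : Q ≪ μ := hac.trans hPμ
  have h1 : P.rnDeriv μ =ᵐ[Q] p := hQμ.ae_le (hP ▸ Measure.rnDeriv_withDensity μ hp)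
  have h2 : Q.rnDeriv μ =ᵐ[Q] fun u => ENNReal.ofReal (q u) :=
    hQμ.ae_le (hQ ▸ Measure.rnDeriv_withDensity μ hq.ennreal_ofReal)
  have h3 : Q.rnDeriv P * P.rnDeriv μ =ᵐ[Q] Q.rnDeriv μ :=
    hQμ.ae_le (Measure.rnDeriv_mul_rnDeriv hac)
  have h4 : ∀ᵐ u ∂Q, P.rnDeriv μ u < ∞ := hQμ.ae_le (Measure.rnDeriv_lt_top P μ)
  have h5 : ∀ᵐ u ∂Q, Q.rnDeriv P u < ∞ := hac.ae_le (Measure.rnDeriv_lt_top Q P)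
  have h6 : ∀ᵐ u ∂Q, 0 < (p u).toReal ∧
      llr Q P u = Real.log (q u) - Real.log (p u).toReal := by
    filter_upwards [h1, h2, h3, h4, h5] with u h1 h2 h3 h4 h5
    rw [Pi.mul_apply, h1, h2] at h3
    rw [h1] at h4
    have h7 : (Q.rnDeriv P u).toReal * (p u).toReal = q u := by
      rw [← ENNReal.toReal_mul, h3, ENNReal.toReal_ofReal (hq0 u).le]
    have h8 := hq0 u
    have h9 : 0 < (p u).toReal := by
      refine lt_of_le_of_ne ENNReal.toReal_nonneg fun h => ?_
      rw [← h, mul_zero] at h7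
      exact h8.ne h7
    refine ⟨h9, ?_⟩
    have h10 : (Q.rnDeriv P u).toReal ≠ 0 := by
      intro h
      rw [h, zero_mul] at h7
      exact h8.ne h7
    rw [llr, ← h7, Real.log_mul h10 h9.ne']
    ring
  exact ⟨h6.mono fun _ h => h.1, h6.mono fun _ h => h.2⟩

lemma klDiv_eq_ofReal_integral [SigmaFinite μ] {Q P : Measure Ω} [IsProbabilityMeasure Q]
    [IsProbabilityMeasure P] {q p : Ω → ℝ} (hq : Measurable q) (hq0 : ∀ u, 0 < q u)
    (hQ : Q = μ.withDensity fun u => ENNReal.ofReal (q u)) (hp : Measurable p)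
    (hp0 : ∀ u, 0 < p u) (hP : P = μ.withDensity fun u => ENNReal.ofReal (p u))
    (hi : Integrable (fun u => Real.log (q u) - Real.log (p u)) Q) :
    InformationTheory.klDiv Q P =
      ENNReal.ofReal (∫ u, (Real.log (q u) - Real.log (p u)) ∂Q) := by
  have hac : Q ≪ P := by
    rw [hQ, hP]
    refine (withDensity_absolutelyContinuous _ _).trans
      (withDensity_absolutelyContinuous' hp.ennreal_ofReal.aemeasurable ?_)
    exact Eventually.of_forall fun u => by simpa using hp0 u
  have h := (log_rnDeriv_eq hq hq0 hQ hp.ennreal_ofReal hP hac).2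
  have h2 : llr Q P =ᵐ[Q] fun u => Real.log (q u) - Real.log (p u) := by
    filter_upwards [h] with u hu
    rw [hu, ENNReal.toReal_ofReal (hp0 u).le]
  rw [InformationTheory.klDiv_of_ac_of_integrable hac (hi.congr h2.symm), integral_congr_ae h2]
  simp

/-- The probability laws with a density for which `q / ρ` is an e-variable. -/
def compatibleLaws (μ Q : Measure Ω) (ρ : Ω → ℝ) : Set (Measure Ω) :=
  {P | IsProbabilityMeasure P ∧ ∃ p : Ω → ℝ≥0∞, Measurable p ∧ P = μ.withDensity p ∧
    ∫⁻ u, p u / ENNReal.ofReal (ρ u) ∂Q ≤ 1}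

/-- The e-variable constraint is affine in the density p, so it passes from the null hypothesis to
its convex hull. -/
lemma convex_compatibleLaws (Q : Measure Ω) {ρ : Ω → ℝ} (hρ : Measurable ρ) :
    Convex ℝ≥0 (compatibleLaws μ Q ρ) := by
  rintro _ ⟨h1, p1, hp1, rfl, hi1⟩ _ ⟨h2, p2, hp2, rfl, hi2⟩ a b - - hab
  have hab' : (a : ℝ≥0∞) + b = 1 := by exact_mod_cast hab
  refine ⟨⟨?_⟩, fun u => a * p1 u + b * p2 u, by fun_prop, ?_, ?_⟩
  · simp only [Measure.coe_add, Measure.coe_smul, Pi.add_apply, Pi.smul_apply, measure_univ]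
    simpa [ENNReal.smul_def] using hab'
  · ext s hs
    rw [withDensity_apply _ hs, lintegral_add_left (by fun_prop), lintegral_const_mul _ hp1,
      lintegral_const_mul _ hp2, Measure.add_apply, Measure.smul_apply, Measure.smul_apply,
      withDensity_apply _ hs, withDensity_apply _ hs]
    rfl
  · simp_rw [ENNReal.add_div, mul_div_assoc]
    rw [lintegral_add_left (by fun_prop), lintegral_const_mul _ (by fun_prop),
      lintegral_const_mul _ (by fun_prop)]
    calc _ ≤ (a : ℝ≥0∞) * 1 + b * 1 := by gcongr
      _ = 1 := by simpa using hab'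

/-- The divergence bound and the log-likelihood bound behind the reverse information
projection. -/
lemma log_ratio_of_mem_compatibleLaws [SigmaFinite μ] {Q P : Measure Ω} [IsProbabilityMeasure Q] {q ρ : Ω → ℝ}
    (hq : Measurable q) (hq0 : ∀ u, 0 < q u)
    (hQ : Q = μ.withDensity fun u => ENNReal.ofReal (q u)) (hρ0 : ∀ u, 0 < ρ u)
    (hi : Integrable (fun u => Real.log (q u) - Real.log (ρ u)) Q)
    (hP : P ∈ compatibleLaws μ Q ρ) (hfin : InformationTheory.klDiv Q P ≠ ∞) :
    ∃ t : Ω → ℝ, Integrable t Q ∧ ∫⁻ u, ENNReal.ofReal (Real.exp (t u)) ∂Q ≤ 1 ∧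
      (t =ᵐ[Q] fun u => Real.log (P.rnDeriv μ u).toReal - Real.log (ρ u)) ∧
      -∫ u, t u ∂Q = (InformationTheory.klDiv Q P).toReal -
        ∫ u, (Real.log (q u) - Real.log (ρ u)) ∂Q := by
  obtain ⟨hPprob, p, hp, hPp, hle⟩ := hP
  obtain ⟨hac, hint⟩ := InformationTheory.klDiv_ne_top_iff.1 hfin
  obtain ⟨h1, h2⟩ := log_rnDeriv_eq hq hq0 hQ hp hPp hac
  have hQμ : Q ≪ μ := hQ ▸ withDensity_absolutelyContinuous _ _
  have h3 : P.rnDeriv μ =ᵐ[Q] p := hQμ.ae_le (hPp ▸ Measure.rnDeriv_withDensity μ hp)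
  have hint2 := hint.congr h2
  -- Finite divergence makes log(q/p) integrable, so log(p/ρ) is a difference of two integrable
  -- functions.
  have heq : ∀ u, Real.log (p u).toReal - Real.log (ρ u) = (Real.log (q u) - Real.log (ρ u)) -
      (Real.log (q u) - Real.log (p u).toReal) := fun u => by ring
  refine ⟨fun u => Real.log (p u).toReal - Real.log (ρ u), ?_, ?_, ?_, ?_⟩
  · simp_rw [heq]
    exact hi.sub hint2
  · refine (lintegral_mono_ae ?_).trans hle
    filter_upwards [h1] with u hu
    rw [Real.exp_sub, Real.exp_log hu, Real.exp_log (hρ0 u), ENNReal.ofReal_div_of_pos (hρ0 u)]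
    gcongr
    exact ENNReal.ofReal_toReal_le
  · filter_upwards [h3] with u hu
    rw [hu]
  · simp_rw [heq]
    rw [integral_sub hi hint2, InformationTheory.toReal_klDiv_of_measure_eq hac (by simp),
      integral_congr_ae h2]
    ring

end RIPr

section

variable {Ω : Type*} [MeasureSpace Ω]

/-- A criterion for reverse information projections. -/
theorem isRIPr_of_compatibleLaws [SigmaFinite (volume : Measure Ω)] {Q : Measure Ω} [IsProbabilityMeasure Q]
    {C : Set (Measure Ω)} {q ρ : Ω → ℝ} (hq : Measurable q) (hq0 : ∀ u, 0 < q u)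
    (hQ : Q = volume.withDensity fun u => ENNReal.ofReal (q u)) (hρ : Measurable ρ)
    (hρ0 : ∀ u, 0 < ρ u) (hρ1 : ∫⁻ u, ENNReal.ofReal (ρ u) ≤ 1)
    (hi : Integrable (fun u => Real.log (q u) - Real.log (ρ u)) Q)
    (hC : C ⊆ compatibleLaws volume Q ρ)
    {P₀ : ℕ → Measure Ω} (hP₀ : ∀ k, P₀ k ∈ convexHull ℝ≥0 C)
    (hlim : Tendsto (fun k => InformationTheory.klDiv Q (P₀ k)) atTop
      (𝓝 (ENNReal.ofReal (∫ u, (Real.log (q u) - Real.log (ρ u)) ∂Q)))) :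
    IsRIPr Q C ρ := by
  have hhull : convexHull ℝ≥0 C ⊆ compatibleLaws volume Q ρ :=
    convexHull_min hC (convex_compatibleLaws Q hρ)
  set D := ∫ u, (Real.log (q u) - Real.log (ρ u)) ∂Q with hD
  have hD0 : 0 ≤ D := by
    have h := integral_nonpos_of_lintegral_exp (t := fun u => -(Real.log (q u) - Real.log (ρ u)))
      hi.neg ?_
    · rw [integral_neg] at h
      linarith
    · refine le_trans (le_of_eq ?_) hρ1
      rw [hQ, lintegral_withDensity_eq_lintegral_mul _ hq.ennreal_ofReal (by fun_prop)]
      refine lintegral_congr fun u => ?_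
      rw [Pi.mul_apply, ← ENNReal.ofReal_mul (hq0 u).le, neg_sub, Real.exp_sub,
        Real.exp_log (hq0 u), Real.exp_log (hρ0 u), mul_div_cancel₀ _ (hq0 u).ne']
  -- The nonpositive mean of log(p/ρ) is exactly the gap D - D(Q‖P); with `hlim` this identifies the
  -- infimum.
  have hge : ∀ P ∈ convexHull ℝ≥0 C, ENNReal.ofReal D ≤ InformationTheory.klDiv Q P := by
    intro P hP
    by_cases hfin : InformationTheory.klDiv Q P = ∞
    · simp [hfin]
    obtain ⟨t, ht, ht1, -, ht2⟩ :=
      log_ratio_of_mem_compatibleLaws hq hq0 hQ hρ0 hi (hhull hP) hfin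
    refine ENNReal.ofReal_le_of_le_toReal ?_
    have := integral_nonpos_of_lintegral_exp ht ht1
    linarith
  have hinf : ⨅ P ∈ convexHull ℝ≥0 C, InformationTheory.klDiv Q P = ENNReal.ofReal D := by
    refine le_antisymm (ge_of_tendsto' hlim fun k => iInf₂_le _ (hP₀ k)) (le_iInf₂ hge)
  refine ⟨hρ, fun u => (hρ0 u).le, hρ1, Eventually.of_forall hρ0, ?_, ?_⟩
  · rw [hinf]; exact ENNReal.ofReal_lt_top
  intro P hP hPlim
  rw [hinf] at hPlim
  have hfin : ∀ᶠ k in atTop, InformationTheory.klDiv Q (P k) ≠ ∞ :=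
    (hPlim.eventually_lt_const ENNReal.ofReal_lt_top).mono fun k h => h.ne
  have hreal : Tendsto (fun k => (InformationTheory.klDiv Q (P k)).toReal) atTop (𝓝 D) := by
    have := (ENNReal.tendsto_toReal ENNReal.ofReal_ne_top).comp hPlim
    rwa [ENNReal.toReal_ofReal hD0] at this
  rw [ENNReal.tendsto_atTop_zero]
  intro η hη
  -- The L¹ bound has two summands: ε itself, and (1 + 2/ε) times the excess divergence, which falls
  -- below ε eventually once ε is fixed.
  obtain ⟨ε, hε, hεη⟩ : ∃ ε : ℝ, 0 < ε ∧ ENNReal.ofReal (2 * ε) ≤ η := by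
    rcases eq_or_ne η ∞ with rfl | hη'
    · exact ⟨1, one_pos, le_top⟩
    · refine ⟨η.toReal / 2, half_pos (ENNReal.toReal_pos hη.ne' hη'), ?_⟩
      rw [mul_div_cancel₀ _ two_ne_zero, ENNReal.ofReal_toReal hη']
  have hsmall : ∀ᶠ k in atTop,
      (1 + 2 / ε) * ((InformationTheory.klDiv Q (P k)).toReal - D) < ε := by
    have : Tendsto (fun k => (1 + 2 / ε) * ((InformationTheory.klDiv Q (P k)).toReal - D)) atTop
        (𝓝 ((1 + 2 / ε) * (D - D))) := (hreal.sub_const D).const_mul _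
    rw [sub_self, mul_zero] at this
    exact this.eventually_lt_const hε
  obtain ⟨N, hN⟩ := eventually_atTop.1 (hfin.and hsmall)
  refine ⟨N, fun k hk => ?_⟩
  obtain ⟨hfk, hsk⟩ := hN k hk
  obtain ⟨t, ht, ht1, hte, ht2⟩ :=
    log_ratio_of_mem_compatibleLaws hq hq0 hQ hρ0 hi (hhull (hP k)) hfk
  rw [← eLpNorm_congr_ae hte, eLpNorm_one_eq_lintegral_enorm, ← ofReal_integral_norm_eq_lintegral_enorm ht]
  refine le_trans (ENNReal.ofReal_le_ofReal ?_) hεη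
  have := integral_abs_le_of_lintegral_exp ht ht1 hε
  rw [ht2] at this
  simp_rw [Real.norm_eq_abs]
  linarith

/-- Along a single minimizing sequence both logarithms are L¹ limits of the same log densities, and
log is injective on positive numbers. -/
theorem IsRIPr.ae_eq {Q : Measure Ω} {C : Set (Measure Ω)} {ρ₁ ρ₂ : Ω → ℝ}
    (h₁ : IsRIPr Q C ρ₁) (h₂ : IsRIPr Q C ρ₂) : ρ₁ =ᵐ[Q] ρ₂ := by
  -- An infimum over the empty set would be ∞, against finiteness.
  have hne : (convexHull ℝ≥0 C).Nonempty := by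
    by_contra h
    have := h₁.finite
    simp [Set.not_nonempty_iff_eq_empty.1 h] at this
  obtain ⟨v, -, hv, hmem⟩ := exists_seq_tendsto_sInf
    (hne.image (InformationTheory.klDiv Q)) (OrderBot.bddBelow _)
  choose P hP hPv using hmem
  rw [sInf_image] at hv
  obtain rfl : (fun k => InformationTheory.klDiv Q (P k)) = v := funext hPv
  have hlim := (h₁.tendsto P hP hv).add (h₂.tendsto P hP hv)
  rw [add_zero] at hlim
  have hm₁ : Measurable fun u => Real.log (ρ₁ u) := h₁.measurable.log
  have hm₂ : Measurable fun u => Real.log (ρ₂ u) := h₂.measurable.log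
  have hmP : ∀ k, Measurable fun u => Real.log ((P k).rnDeriv volume u).toReal := fun k =>
    (Measure.measurable_rnDeriv _ _).ennreal_toReal.log
  have hle : ∀ k, eLpNorm (fun u => Real.log (ρ₁ u) - Real.log (ρ₂ u)) 1 Q ≤
      eLpNorm (fun u => Real.log ((P k).rnDeriv volume u).toReal - Real.log (ρ₁ u)) 1 Q +
      eLpNorm (fun u => Real.log ((P k).rnDeriv volume u).toReal - Real.log (ρ₂ u)) 1 Q := by
    intro k
    rw [add_comm]
    convert! eLpNorm_sub_le ((hmP k).sub hm₂).aestronglyMeasurable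
      ((hmP k).sub hm₁).aestronglyMeasurable le_rfl using 2
    ext u
    simp
  have h0 : eLpNorm (fun u => Real.log (ρ₁ u) - Real.log (ρ₂ u)) 1 Q = 0 :=
    le_antisymm (ge_of_tendsto' hlim hle) zero_le
  have hm : Measurable fun u => Real.log (ρ₁ u) - Real.log (ρ₂ u) := hm₁.sub hm₂
  rw [eLpNorm_eq_zero_iff hm.aestronglyMeasurable one_ne_zero] at h0
  filter_upwards [h0, h₁.pos, h₂.pos] with u hu hp₁ hp₂
  exact Real.log_injOn_pos hp₁ hp₂ (sub_eq_zero.1 hu)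

end

end GaussE

namespace GaussE

/-! ### Growth-rate optimality -/

lemma extEPower_of_integrable {Ω : Type*} [MeasurableSpace Ω] {Q : Measure Ω} {S : Ω → ℝ≥0∞}
    {l : Ω → ℝ} (hl : Integrable l Q) (h : ∀ᵐ u ∂Q, ENNReal.log (S u) = (l u : EReal)) :
    extEPower Q S = ((∫ u, l u ∂Q : ℝ) : EReal) := by
  have h1 : ∫⁻ u, (ENNReal.log (S u)).toENNReal ∂Q = ∫⁻ u, ENNReal.ofReal (l u) ∂Q :=
    lintegral_congr_ae (h.mono fun u hu => by simp only [hu, EReal.real_coe_toENNReal])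
  have h2 : ∫⁻ u, (-ENNReal.log (S u)).toENNReal ∂Q = ∫⁻ u, ENNReal.ofReal (-l u) ∂Q :=
    lintegral_congr_ae (h.mono fun u hu => by
      simp only [hu, ← EReal.coe_neg, EReal.real_coe_toENNReal])
  have f1 : ∫⁻ u, ENNReal.ofReal (l u) ∂Q ≠ ∞ := hl.lintegral_lt_top.ne
  have f2 : ∫⁻ u, ENNReal.ofReal (-l u) ∂Q ≠ ∞ := hl.neg.lintegral_lt_top.ne
  rw [extEPower, h1, h2, integral_eq_lintegral_pos_part_sub_lintegral_neg_part hl, EReal.coe_sub,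
    EReal.coe_ennreal_toReal f1, EReal.coe_ennreal_toReal f2]

/-- Since S = exp s, the hypothesis `hmix` says E_Q[S'/S] ≤ 1, so E_Q[log S' - log S] ≤ 0. The work
lies in reaching a case where log S' is real-valued and integrable. -/
theorem isGRO_of_lintegral_le {Ω : Type*} [MeasurableSpace Ω] {Q : Measure Ω}
    [IsProbabilityMeasure Q] {C : Set (Measure Ω)} {S : Ω → ℝ≥0∞} {s : Ω → ℝ}
    (hS : IsEVariable C S) (hs : Integrable s Q) (hSs : ∀ᵐ u ∂Q, S u = ENNReal.ofReal (Real.exp (s u)))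
    (hmix : ∀ S', IsEVariable C S' → ∫⁻ u, S' u * ENNReal.ofReal (Real.exp (-s u)) ∂Q ≤ 1) :
    IsGRO C Q S := by
  refine ⟨hS, fun S' hS' => ?_⟩
  have hSlog : ∀ᵐ u ∂Q, ENNReal.log (S u) = (s u : EReal) := by
    filter_upwards [hSs] with u hu
    rw [hu, ENNReal.log_ofReal_of_pos (Real.exp_pos _), Real.log_exp]
  rw [extEPower_of_integrable hs hSlog]
  have hY := hmix S' hS'
  -- An infinite negative part gives the value -∞ by the convention in `extEPower`, and there is
  -- nothing to prove.
  by_cases hB : ∫⁻ u, (-ENNReal.log (S' u)).toENNReal ∂Q = ∞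
  · rw [extEPower, hB]
    simp [sub_eq_add_neg]
  have hmeasY : Measurable S' := hS'.1
  have hfin : ∀ᵐ u ∂Q, S' u * ENNReal.ofReal (Real.exp (-s u)) < ∞ := by
    refine ae_lt_top' ?_ (hY.trans_lt ENNReal.one_lt_top).ne
    refine hmeasY.aemeasurable.mul ?_
    exact (Real.measurable_exp.comp_aemeasurable hs.1.aemeasurable.neg).ennreal_ofReal
  have hpos : ∀ᵐ u ∂Q, (-ENNReal.log (S' u)).toENNReal < ∞ := by
    refine ae_lt_top' ?_ hB
    exact (measurable_ereal_toENNReal.comp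
      (measurable_id.neg.comp (ENNReal.measurable_log.comp hmeasY))).aemeasurable
  have hreal : ∀ᵐ u ∂Q, 0 < (S' u).toReal ∧ S' u ≠ ∞ := by
    filter_upwards [hfin, hpos] with u h1 h2
    have h3 : S' u ≠ ∞ := by
      intro h
      rw [h, ENNReal.top_mul (by simp [Real.exp_pos])] at h1
      exact lt_irrefl _ h1
    have h4 : S' u ≠ 0 := by
      intro h
      simp [h] at h2
    exact ⟨ENNReal.toReal_pos h4 h3, h3⟩
  have hS'log : ∀ᵐ u ∂Q, ENNReal.log (S' u) = (Real.log (S' u).toReal : EReal) := by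
    filter_upwards [hreal] with u hu
    rw [ENNReal.log_pos_real' hu.1]
  set l : Ω → ℝ := fun u => Real.log (S' u).toReal with hl
  have hexp : ∫⁻ u, ENNReal.ofReal (Real.exp (l u - s u)) ∂Q ≤ 1 := by
    refine (lintegral_mono_ae ?_).trans hY
    filter_upwards [hreal] with u hu
    rw [sub_eq_add_neg, Real.exp_add, Real.exp_log hu.1, ENNReal.ofReal_mul hu.1.le,
      ENNReal.ofReal_toReal hu.2]
  have hlm : Measurable l := hmeasY.ennreal_toReal.log
  have hneg : Integrable (fun u => max (-l u) 0) Q := by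
    refine ⟨(hlm.neg.max measurable_const).aestronglyMeasurable, ?_⟩
    have h0 : 0 ≤ᵐ[Q] fun u => max (-l u) 0 := Eventually.of_forall fun u => le_max_right _ _
    rw [hasFiniteIntegral_iff_ofReal h0]
    refine lt_of_le_of_lt (le_of_eq (lintegral_congr_ae ?_)) (lt_top_iff_ne_top.2 hB)
    filter_upwards [hS'log] with u hu
    simp only [hu, ← EReal.coe_neg, EReal.real_coe_toENNReal]
    rw [ENNReal.ofReal_max, ENNReal.ofReal_zero, max_eq_left zero_le]
  obtain ⟨he1, -⟩ := integrable_exp_of_lintegral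
    (hlm.aestronglyMeasurable.sub hs.1) hexp
  -- The negative part is integrable by the case assumption; from above, l ≤ s + exp(l - s).
  have hlint : Integrable l Q := by
    refine Integrable.mono' ((hneg.add he1).add hs.abs) hlm.aestronglyMeasurable
      (Eventually.of_forall fun u => ?_)
    simp only [Pi.add_apply, Real.norm_eq_abs, Pi.sub_apply]
    have h1 := Real.add_one_le_exp (l u - s u)
    have h2 := le_max_left (-l u) 0
    have h3 := le_max_right (-l u) 0
    have h4 := le_abs_self (s u)
    have h5 := abs_nonneg (s u)
    have h6 := (Real.exp_pos (l u - s u)).le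
    exact abs_le.2 ⟨by linarith, by linarith⟩
  rw [extEPower_of_integrable hlint hS'log]
  have := integral_nonpos_of_lintegral_exp (hlint.sub hs) hexp
  rw [integral_sub' hlint hs] at this
  exact_mod_cast (by linarith : ∫ u, l u ∂Q ≤ ∫ u, s u ∂Q)

/-! ### Mixtures over a family of densities -/

/-- Induction: split off one point and rescale the other weights by their sum, unless that sum is
zero. The scalars are nonnegative because measures carry no negative multiples. -/
lemma _root_.Convex.nnreal_sum_mem {E ι : Type*} [AddCommMonoid E] [Module ℝ≥0 E] {K : Set E}
    (hK : Convex ℝ≥0 K) {z : ι → E} (s : Finset ι) :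
    ∀ w : ι → ℝ≥0, ∑ i ∈ s, w i = 1 → (∀ i ∈ s, z i ∈ K) → ∑ i ∈ s, w i • z i ∈ K := by
  classical
  induction s using Finset.induction_on with
  | empty => intro w h; simp at h
  | insert a s ha ih =>
    intro w hw hz
    rw [Finset.sum_insert ha] at hw ⊢
    by_cases h0 : ∑ i ∈ s, w i = 0
    · have h1 : ∀ i ∈ s, w i = 0 := by simpa using h0
      rw [h0, add_zero] at hw
      rw [hw, one_smul, Finset.sum_eq_zero fun i hi => by rw [h1 i hi, zero_smul], add_zero]
      exact hz a (Finset.mem_insert_self _ _)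
    · have h1 : ∑ i ∈ s, (w i / ∑ j ∈ s, w j) • z i ∈ K := by
        refine ih _ ?_ fun i hi => hz i (Finset.mem_insert_of_mem hi)
        rw [← Finset.sum_div, div_self h0]
      have h2 := hK (hz a (Finset.mem_insert_self _ _)) h1 zero_le zero_le hw
      convert h2 using 2
      rw [Finset.smul_sum]
      refine Finset.sum_congr rfl fun i _ => ?_
      rw [smul_smul, mul_div_cancel₀ _ h0]

variable {d : ℕ} {Ω : Type*} [MeasureSpace Ω]

/-- A family of probability densities, continuous in the parameter, bounded, and with
Gaussian-type lower bounds. -/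
structure IsDensityFamily (f : Vec d → Ω → ℝ) (G : Ω → ℝ) : Prop where
  measurable : Measurable (Function.uncurry f)
  continuous : ∀ u, Continuous fun m => f m u
  pos : ∀ m u, 0 < f m u
  bounded : ∃ c, ∀ m u, f m u ≤ c
  lower : ∃ a b, 0 ≤ a ∧ 0 < b ∧ ∀ m u, b * Real.exp (-(a * (‖m‖ ^ 2 + G u))) ≤ f m u
  lintegral_eq_one : ∀ m, ∫⁻ u, ENNReal.ofReal (f m u) = 1

namespace IsDensityFamily

variable {f : Vec d → Ω → ℝ} {G : Ω → ℝ}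

/-- The members of the family as measures. -/
noncomputable def law (_ : IsDensityFamily f G) (m : Vec d) : Measure Ω :=
  volume.withDensity fun u => ENNReal.ofReal (f m u)

lemma measurable_apply (hf : IsDensityFamily f G) (m : Vec d) : Measurable (f m) :=
  hf.measurable.comp measurable_prodMk_left

lemma measurable_comp (hf : IsDensityFamily f G) {T : Vec d → Vec d} (hT : Measurable T) :
    Measurable fun p : Ω × Vec d => f (T p.2) p.1 :=
  hf.measurable.comp ((hT.comp measurable_snd).prodMk measurable_fst)

lemma isProbabilityMeasure_law (hf : IsDensityFamily f G) (m : Vec d) :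
    IsProbabilityMeasure (hf.law m) := by
  refine ⟨?_⟩
  rw [law, withDensity_apply _ MeasurableSet.univ, Measure.restrict_univ, hf.lintegral_eq_one]

variable (W : Measure (Vec d)) [IsProbabilityMeasure W]

lemma integrable_comp (hf : IsDensityFamily f G) {T : Vec d → Vec d} (hT : Measurable T)
    (u : Ω) : Integrable (fun m => f (T m) u) W := by
  obtain ⟨c, hc⟩ := hf.bounded
  refine Integrable.of_bound (C := c)
    ((hf.continuous u).measurable.comp hT).aestronglyMeasurable
    (Eventually.of_forall fun m => ?_)
  rw [Real.norm_of_nonneg (hf.pos _ u).le]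
  exact hc _ u

lemma measurable_integral (hf : IsDensityFamily f G) {T : Vec d → Vec d} (hT : Measurable T) :
    Measurable fun u => ∫ m, f (T m) u ∂W :=
  ((hf.measurable_comp hT).stronglyMeasurable.integral_prod_right (ν := W)).measurable

lemma ofReal_integral (hf : IsDensityFamily f G) {T : Vec d → Vec d} (hT : Measurable T)
    (u : Ω) :
    ENNReal.ofReal (∫ m, f (T m) u ∂W) = ∫⁻ m, ENNReal.ofReal (f (T m) u) ∂W :=
  ofReal_integral_eq_lintegral_ofReal (hf.integrable_comp W hT u)
    (Eventually.of_forall fun _ => (hf.pos _ u).le)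

/-- Tonelli. The map `T` is the identity for the mixture itself and a simple function for its finite
approximations. -/
lemma lintegral_mul_integral [SFinite (volume : Measure Ω)] (hf : IsDensityFamily f G)
    {T : Vec d → Vec d} (hT : Measurable T) {S : Ω → ℝ≥0∞} (hS : Measurable S) :
    ∫⁻ u, S u * ENNReal.ofReal (∫ m, f (T m) u ∂W) = ∫⁻ m, ∫⁻ u, S u ∂hf.law (T m) ∂W := by
  have h1 : ∀ m, ∫⁻ u, S u ∂hf.law (T m) = ∫⁻ u, S u * ENNReal.ofReal (f (T m) u) := fun m => by
    rw [law, lintegral_withDensity_eq_lintegral_mul _ (hf.measurable_apply _).ennreal_ofReal hS]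
    exact lintegral_congr fun u => mul_comm _ _
  have h2 : Measurable fun p : Ω × Vec d => S p.1 * ENNReal.ofReal (f (T p.2) p.1) :=
    (hS.comp measurable_fst).mul (hf.measurable_comp hT).ennreal_ofReal
  have h3 : ∀ u, Measurable fun m => ENNReal.ofReal (f (T m) u) := fun u =>
    ((hf.continuous u).measurable.comp hT).ennreal_ofReal
  simp_rw [h1, hf.ofReal_integral W hT]
  rw [← lintegral_lintegral_swap h2.aemeasurable]
  exact lintegral_congr fun u => (lintegral_const_mul _ (h3 u)).symm

lemma withDensity_integral_apply [SFinite (volume : Measure Ω)] (hf : IsDensityFamily f G)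
    {T : Vec d → Vec d} (hT : Measurable T) {s : Set Ω} (hs : MeasurableSet s) :
    (volume.withDensity fun u => ENNReal.ofReal (∫ m, f (T m) u ∂W)) s =
      ∫⁻ m, hf.law (T m) s ∂W := by
  have h := hf.lintegral_mul_integral W hT (S := s.indicator 1) (measurable_one.indicator hs)
  simp_rw [lintegral_indicator_one hs] at h
  rw [← h, withDensity_apply _ hs, ← lintegral_indicator hs]
  refine lintegral_congr fun u => ?_
  by_cases hu : u ∈ s <;> simp [hu]

lemma lintegral_integral [SFinite (volume : Measure Ω)] (hf : IsDensityFamily f G)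
    {T : Vec d → Vec d} (hT : Measurable T) :
    ∫⁻ u, ENNReal.ofReal (∫ m, f (T m) u ∂W) = 1 := by
  have := hf.isProbabilityMeasure_law
  simpa using hf.lintegral_mul_integral W hT (S := fun _ => 1) measurable_const

/-- The prior gives mass above 1/2 to some ball, whose image under T stays in the ball of twice the
radius, where the lower bound of the family applies; boundedness gives the upper estimate. The
constants do not depend on T, so one dominating function serves all approximations, and the factor 2
is the growth bound of `SimpleFunc.approxOn` around 0. -/
lemma exists_log_bound (hf : IsDensityFamily f G) :
    ∃ a c : ℝ, ∀ T : Vec d → Vec d, Measurable T → (∀ m, ‖T m‖ ≤ 2 * ‖m‖) → ∀ u,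
      0 < ∫ m, f (T m) u ∂W ∧ |Real.log (∫ m, f (T m) u ∂W)| ≤ c + a * |G u| := by
  obtain ⟨c, hc⟩ := hf.bounded
  obtain ⟨a, b, ha, hb, hab⟩ := hf.lower
  obtain ⟨r, hr⟩ : ∃ r : ℕ, (1 / 2 : ℝ) < W.real (Metric.closedBall (0 : Vec d) r) := by
    have h : Tendsto (fun r : ℕ => W.real (Metric.closedBall (0 : Vec d) r)) atTop (𝓝 1) := by
      have h1 : ⋃ r : ℕ, Metric.closedBall (0 : Vec d) r = Set.univ := Metric.iUnion_closedBall_nat 0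
      have h2 := tendsto_measure_iUnion_atTop (μ := W)
        (s := fun r : ℕ => Metric.closedBall (0 : Vec d) r)
        (fun i j hij => Metric.closedBall_subset_closedBall (by exact_mod_cast hij))
      rw [h1, measure_univ] at h2
      exact (ENNReal.tendsto_toReal ENNReal.one_ne_top).comp h2
    exact (h.eventually_const_lt (by norm_num)).exists
  set B : ℝ := 1 / 2 * b with hB
  have hB0 : 0 < B := by positivity
  refine ⟨a, |Real.log c| + |Real.log B| + a * (2 * r) ^ 2, fun T hT hT2 u => ?_⟩
  have hlow : B * Real.exp (-(a * ((2 * r) ^ 2 + G u))) ≤ ∫ m, f (T m) u ∂W := by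
    have h1 : ∀ m ∈ Metric.closedBall (0 : Vec d) r,
        b * Real.exp (-(a * ((2 * r) ^ 2 + G u))) ≤ f (T m) u := by
      intro m hm
      refine le_trans ?_ (hab (T m) u)
      have h2 : ‖T m‖ ≤ 2 * r := (hT2 m).trans (by
        have := mem_closedBall_zero_iff.1 hm
        linarith)
      gcongr
    have h3 : ∫ m in Metric.closedBall (0 : Vec d) r, b * Real.exp (-(a * ((2 * r) ^ 2 + G u))) ∂W ≤
        ∫ m in Metric.closedBall (0 : Vec d) r, f (T m) u ∂W :=
      setIntegral_mono_on (integrable_const _) (hf.integrable_comp W hT u).integrableOn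
        Metric.isClosed_closedBall.measurableSet h1
    have h4 := setIntegral_le_integral (s := Metric.closedBall (0 : Vec d) r)
      (hf.integrable_comp W hT u) (Eventually.of_forall fun _ => (hf.pos _ u).le)
    refine le_trans ?_ (h3.trans h4)
    rw [setIntegral_const, smul_eq_mul, hB, mul_assoc]
    gcongr
  have hpos : 0 < ∫ m, f (T m) u ∂W := lt_of_lt_of_le (by positivity) hlow
  refine ⟨hpos, abs_le.2 ⟨?_, ?_⟩⟩
  · have h5 := Real.log_le_log (by positivity) hlow
    rw [Real.log_mul hB0.ne' (Real.exp_pos _).ne', Real.log_exp] at h5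
    have h6 := neg_abs_le (Real.log B)
    have h7 := abs_nonneg (Real.log c)
    have h8 : a * G u ≤ a * |G u| := by gcongr; exact le_abs_self _
    linarith
  · have h9 : ∫ m, f (T m) u ∂W ≤ c := by
      have := integral_mono (hf.integrable_comp W hT u) (integrable_const c) fun m => hc _ u
      simpa using this
    have h5 := Real.log_le_log hpos h9
    have h6 := le_abs_self (Real.log c)
    have h7 := abs_nonneg (Real.log B)
    have h8 : 0 ≤ a * |G u| := by positivity
    have h10 : 0 ≤ a * (2 * (r : ℝ)) ^ 2 := by positivity
    linarith

/-- A simple T pushes the prior to a finitely supported one, with weights W(T⁻¹{y}). -/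
lemma withDensity_simpleFunc_mem_convexHull [SFinite (volume : Measure Ω)]
    (hf : IsDensityFamily f G) (T : SimpleFunc (Vec d) (Vec d)) :
    (volume.withDensity fun u => ENNReal.ofReal (∫ m, f (T m) u ∂W)) ∈
      convexHull ℝ≥0 (Set.range hf.law) := by
  have h : (volume.withDensity fun u => ENNReal.ofReal (∫ m, f (T m) u ∂W)) =
      ∑ y ∈ T.range, (W (T ⁻¹' {y})).toNNReal • hf.law y := by
    ext s hs
    rw [hf.withDensity_integral_apply W T.measurable hs]
    have h1 := SimpleFunc.map_lintegral (μ := W) (fun y => hf.law y s) T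
    rw [← SimpleFunc.lintegral_eq_lintegral] at h1
    simp only [SimpleFunc.coe_map, Function.comp] at h1
    rw [h1, Measure.finsetSum_apply]
    refine Finset.sum_congr rfl fun y _ => ?_
    rw [Measure.smul_apply, ENNReal.smul_def, ENNReal.coe_toNNReal (measure_ne_top _ _), mul_comm,
      smul_eq_mul]
  rw [h]
  refine (convex_convexHull ℝ≥0 _).nnreal_sum_mem _ _ ?_ fun y _ =>
    subset_convexHull _ _ ⟨y, rfl⟩
  have h2 : ∑ y ∈ T.range, W (T ⁻¹' {y}) = 1 := by
    rw [T.sum_range_measure_preimage_singleton W, measure_univ]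
  rw [← ENNReal.toNNReal_sum fun y _ => measure_ne_top _ _, h2, ENNReal.toNNReal_one]

end IsDensityFamily

end GaussE

namespace GaussE

/-! ### Mixtures as limits of finite mixtures, and their optimality -/

namespace IsDensityFamily

variable {d : ℕ} {Ω : Type*} [MeasureSpace Ω]
variable {f : Vec d → Ω → ℝ} {G : Ω → ℝ}
variable (W : Measure (Vec d)) [IsProbabilityMeasure W]

lemma integral_pos (hf : IsDensityFamily f G) (u : Ω) : 0 < ∫ m, f m u ∂W := by
  obtain ⟨a, c, h⟩ := hf.exists_log_bound W
  exact (h id measurable_id (fun m => by simpa using by linarith [norm_nonneg m]) u).1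

lemma integrable_log_integral (hf : IsDensityFamily f G) {Q : Measure Ω} [IsFiniteMeasure Q]
    (hG : Integrable G Q) : Integrable (fun u => Real.log (∫ m, f m u ∂W)) Q := by
  obtain ⟨a, c, h⟩ := hf.exists_log_bound W
  refine Integrable.mono' ((integrable_const c).add (hG.abs.const_mul a))
    (hf.measurable_integral W measurable_id).log.aestronglyMeasurable
    (Eventually.of_forall fun u => ?_)
  exact (h id measurable_id (fun m => by simpa using by linarith [norm_nonneg m]) u).2

lemma integrable_log_apply (hf : IsDensityFamily f G) {Q : Measure Ω} [IsFiniteMeasure Q]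
    (hG : Integrable G Q) (m : Vec d) : Integrable (fun u => Real.log (f m u)) Q := by
  simpa using hf.integrable_log_integral (Measure.dirac m) hG

variable [SigmaFinite (volume : Measure Ω)]

lemma measurable_law (hf : IsDensityFamily f G) : Measurable hf.law := by
  refine Measure.measurable_of_measurable_coe _ fun s hs => ?_
  have h1 : Measurable fun p : Vec d × Ω => ENNReal.ofReal (f p.1 p.2) :=
    hf.measurable.ennreal_ofReal
  simp_rw [law, withDensity_apply _ hs]
  exact Measurable.lintegral_prod_right h1

lemma bind_law (hf : IsDensityFamily f G) :
    W.bind hf.law = volume.withDensity fun u => ENNReal.ofReal (∫ m, f m u ∂W) := by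
  ext s hs
  rw [Measure.bind_apply hs hf.measurable_law.aemeasurable]
  exact (hf.withDensity_integral_apply W measurable_id hs).symm

/-- The prior is replaced by its images under simple functions tending to the identity. Dominated
convergence is used twice: under the prior, where the densities are bounded, and under Q, where the
logarithms are dominated through `exists_log_bound`. -/
lemma exists_tendsto_klDiv (hf : IsDensityFamily f G) {Q : Measure Ω} [IsProbabilityMeasure Q]
    {q : Ω → ℝ} (hq : Measurable q) (hq0 : ∀ u, 0 < q u)
    (hQ : Q = volume.withDensity fun u => ENNReal.ofReal (q u))
    (hqlog : Integrable (fun u => Real.log (q u)) Q) (hG : Integrable G Q) :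
    ∃ P : ℕ → Measure Ω, (∀ k, P k ∈ convexHull ℝ≥0 (Set.range hf.law)) ∧
      Tendsto (fun k => InformationTheory.klDiv Q (P k)) atTop
        (𝓝 (ENNReal.ofReal (∫ u, (Real.log (q u) - Real.log (∫ m, f m u ∂W)) ∂Q))) := by
  obtain ⟨c, hc⟩ := hf.bounded
  obtain ⟨a, b, hab⟩ := hf.exists_log_bound W
  let T : ℕ → SimpleFunc (Vec d) (Vec d) := fun k =>
    SimpleFunc.approxOn id measurable_id Set.univ 0 (Set.mem_univ _) k
  have hT : ∀ k m, ‖T k m‖ ≤ 2 * ‖m‖ := fun k m =>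
    (SimpleFunc.norm_approxOn_zero_le measurable_id (Set.mem_univ _) m k).trans_eq (two_mul _).symm
  have hTlim : ∀ m, Tendsto (fun k => T k m) atTop (𝓝 m) := fun m =>
    SimpleFunc.tendsto_approxOn measurable_id (Set.mem_univ _) (by simp)
  have hlog : ∀ k, Integrable (fun u => Real.log (∫ m, f (T k m) u ∂W)) Q := fun k =>
    Integrable.mono' ((integrable_const b).add (hG.abs.const_mul a))
      (hf.measurable_integral W (T k).measurable).log.aestronglyMeasurable
      (Eventually.of_forall fun u => (hab _ (T k).measurable (hT k) u).2)
  refine ⟨fun k => volume.withDensity fun u => ENNReal.ofReal (∫ m, f (T k m) u ∂W),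
    fun k => hf.withDensity_simpleFunc_mem_convexHull W (T k), ?_⟩
  have hkl : ∀ k, InformationTheory.klDiv Q
      (volume.withDensity fun u => ENNReal.ofReal (∫ m, f (T k m) u ∂W)) =
      ENNReal.ofReal (∫ u, (Real.log (q u) - Real.log (∫ m, f (T k m) u ∂W)) ∂Q) := by
    intro k
    have : IsProbabilityMeasure
        (volume.withDensity fun u => ENNReal.ofReal (∫ m, f (T k m) u ∂W)) := ⟨by
      rw [withDensity_apply _ MeasurableSet.univ, Measure.restrict_univ,
        hf.lintegral_integral W (T k).measurable]⟩
    exact klDiv_eq_ofReal_integral hq hq0 hQ (hf.measurable_integral W (T k).measurable)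
      (fun u => (hab _ (T k).measurable (hT k) u).1) rfl (hqlog.sub (hlog k))
  simp_rw [hkl]
  refine ENNReal.tendsto_ofReal ?_
  refine tendsto_integral_of_dominated_convergence
    (fun u => |Real.log (q u)| + (b + a * |G u|))
    (fun k => (hqlog.sub (hlog k)).1)
    (hqlog.abs.add ((integrable_const b).add (hG.abs.const_mul a)))
    (fun k => Eventually.of_forall fun u => ?_) (Eventually.of_forall fun u => ?_)
  · refine (abs_sub _ _).trans ?_
    gcongr
    exact (hab _ (T k).measurable (hT k) u).2
  · refine tendsto_const_nhds.sub (Tendsto.log ?_ (hf.integral_pos W u).ne')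
    refine tendsto_integral_of_dominated_convergence (fun _ => c)
      (fun k => (hf.integrable_comp W (T k).measurable u).1) (integrable_const c)
      (fun k => Eventually.of_forall fun m => ?_)
      (Eventually.of_forall fun m => ((hf.continuous u).tendsto m).comp (hTlim m))
    rw [Real.norm_of_nonneg (hf.pos _ u).le]
    exact hc _ u

/-- A mixture for which `q / ρ` is an e-variable is the reverse information projection. -/
theorem isRIPr (hf : IsDensityFamily f G) {Q : Measure Ω} [IsProbabilityMeasure Q]
    {q : Ω → ℝ} (hq : Measurable q) (hq0 : ∀ u, 0 < q u)
    (hQ : Q = volume.withDensity fun u => ENNReal.ofReal (q u))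
    (hqlog : Integrable (fun u => Real.log (q u)) Q) (hG : Integrable G Q)
    (he : ∀ m, ∫⁻ u, ENNReal.ofReal (f m u * q u / ∫ m, f m u ∂W) ≤ 1) :
    IsRIPr Q (Set.range hf.law) (fun u => ∫ m, f m u ∂W) := by
  obtain ⟨P, hP, hlim⟩ := hf.exists_tendsto_klDiv W hq hq0 hQ hqlog hG
  refine isRIPr_of_compatibleLaws hq hq0 hQ (hf.measurable_integral W measurable_id)
    (hf.integral_pos W) (hf.lintegral_integral W measurable_id).le
    (hqlog.sub (hf.integrable_log_integral W hG)) ?_ hP hlim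
  rintro _ ⟨m, rfl⟩
  have hρm : Measurable fun u => ∫ m, f m u ∂W := hf.measurable_integral W measurable_id
  have hfm := hf.measurable_apply m
  refine ⟨hf.isProbabilityMeasure_law m, _, hfm.ennreal_ofReal, rfl, ?_⟩
  refine le_trans (le_of_eq ?_) (he m)
  have h1 : Measurable fun u =>
      ENNReal.ofReal (f m u) / ENNReal.ofReal (∫ m, f m u ∂W) :=
    hfm.ennreal_ofReal.div hρm.ennreal_ofReal
  rw [hQ, lintegral_withDensity_eq_lintegral_mul _ hq.ennreal_ofReal h1]
  refine lintegral_congr fun u => ?_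
  rw [Pi.mul_apply, ← ENNReal.ofReal_div_of_pos (hf.integral_pos W u),
    ← ENNReal.ofReal_mul (hq0 u).le]
  congr 1
  ring

/-- For an e-variable S', E_Q[S'ρ/q] is the integral of S' against the mixture ρ, hence a prior
average of numbers at most 1. -/
theorem isGRO (hf : IsDensityFamily f G) {Q : Measure Ω} [IsProbabilityMeasure Q]
    {q : Ω → ℝ} (hq : Measurable q) (hq0 : ∀ u, 0 < q u)
    (hQ : Q = volume.withDensity fun u => ENNReal.ofReal (q u))
    (hqlog : Integrable (fun u => Real.log (q u)) Q) (hG : Integrable G Q)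
    (he : ∀ m, ∫⁻ u, ENNReal.ofReal (f m u * q u / ∫ m, f m u ∂W) ≤ 1)
    {S : Ω → ℝ≥0∞} (hS : Measurable S)
    (hSe : ∀ᵐ u, S u = ENNReal.ofReal (q u / ∫ m, f m u ∂W)) :
    IsGRO (Set.range hf.law) Q S := by
  have hρm : Measurable fun u => ∫ m, f m u ∂W := hf.measurable_integral W measurable_id
  have hQv : Q ≪ volume := hQ ▸ withDensity_absolutelyContinuous _ _
  have hρ0 := hf.integral_pos W
  refine isGRO_of_lintegral_le (s := fun u => Real.log (q u) - Real.log (∫ m, f m u ∂W)) ⟨hS, ?_⟩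
    (hqlog.sub (hf.integrable_log_integral W hG)) ?_ ?_
  · rintro _ ⟨m, rfl⟩
    refine le_trans (le_of_eq ?_) (he m)
    rw [law, lintegral_withDensity_eq_lintegral_mul _ (hf.measurable_apply m).ennreal_ofReal hS]
    refine lintegral_congr_ae ?_
    filter_upwards [hSe] with u hu
    rw [Pi.mul_apply, hu, ← ENNReal.ofReal_mul (hf.pos m u).le, mul_div_assoc]
  · filter_upwards [hQv.ae_le hSe] with u hu
    rw [hu, Real.exp_sub, Real.exp_log (hq0 u), Real.exp_log (hρ0 u)]
  · intro S' hS'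
    have h1 : Measurable fun u => S' u * ENNReal.ofReal
        (Real.exp (-(Real.log (q u) - Real.log (∫ m, f m u ∂W)))) :=
      hS'.1.mul (Real.measurable_exp.comp (hq.log.sub hρm.log).neg).ennreal_ofReal
    rw [hQ, lintegral_withDensity_eq_lintegral_mul _ hq.ennreal_ofReal h1]
    have h2 := hf.lintegral_mul_integral W measurable_id hS'.1
    simp only [id] at h2
    have h3 : ∫⁻ m, ∫⁻ u, S' u ∂hf.law m ∂W ≤ ∫⁻ _, 1 ∂W :=
      lintegral_mono fun m => hS'.2 _ ⟨m, rfl⟩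
    rw [lintegral_const, measure_univ, mul_one, ← h2] at h3
    refine le_trans (le_of_eq (lintegral_congr fun u => ?_)) h3
    rw [Pi.mul_apply, neg_sub, Real.exp_sub, Real.exp_log (hq0 u), Real.exp_log (hρ0 u),
      mul_left_comm, ← ENNReal.ofReal_mul (hq0 u).le, mul_div_cancel₀ _ (hq0 u).ne']

end IsDensityFamily

end GaussE

namespace GaussE

variable {d : ℕ}

/-! ### Reverse information projections of Gaussian location families -/

lemma exists_gaussPDF_lower {S : Matrix (Fin d) (Fin d) ℝ} (hS : S.PosDef) :
    ∃ a b : ℝ, 0 ≤ a ∧ 0 < b ∧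
      ∀ m x : Vec d, b * Real.exp (-(a * (‖m‖ ^ 2 + ‖x‖ ^ 2))) ≤ gaussPDF m S x := by
  obtain ⟨C, hC, hCq⟩ := exists_quad_le S⁻¹
  have hpos := gaussPDF_const_pos hS
  refine ⟨C, _, hC, inv_pos.2 (Real.sqrt_pos.2 hpos), fun m x => ?_⟩
  have h1 : quad S⁻¹ (x - m) ≤ C * ‖x - m‖ ^ 2 := (le_abs_self _).trans (hCq _)
  have h2 : ‖x - m‖ ^ 2 ≤ 2 * (‖m‖ ^ 2 + ‖x‖ ^ 2) := by
    have h := norm_sub_le x m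
    have := norm_nonneg (x - m)
    nlinarith [sq_nonneg (‖x‖ - ‖m‖)]
  have h3 : C * ‖x - m‖ ^ 2 ≤ C * (2 * (‖m‖ ^ 2 + ‖x‖ ^ 2)) := by gcongr
  unfold gaussPDF
  gcongr
  linarith

lemma isDensityFamily_gaussPDF {S : Matrix (Fin d) (Fin d) ℝ} (hS : S.PosDef) :
    IsDensityFamily (fun m x : Vec d => gaussPDF m S x) fun x => ‖x‖ ^ 2 where
  measurable := measurable_gaussPDF_uncurry S
  continuous _ := continuous_gaussPDF S continuous_id continuous_const
  pos m u := gaussPDF_pos hS m u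
  bounded := ⟨_, gaussPDF_le hS⟩
  lower := exists_gaussPDF_lower hS
  lintegral_eq_one := lintegral_gaussPDF hS

lemma isDensityFamily_gaussPDFn {S : Matrix (Fin d) (Fin d) ℝ} (hS : S.PosDef) (n : ℕ) :
    IsDensityFamily (fun (m : Vec d) (u : Sample d n) => gaussPDFn m S u)
      fun u => ∑ i, ‖u i‖ ^ 2 where
  measurable := (continuous_gaussPDFn S continuous_fst continuous_snd).measurable
  continuous _ := continuous_gaussPDFn S continuous_id continuous_const
  pos m u := gaussPDFn_pos hS m u
  bounded := ⟨∏ _i : Fin n, (Real.sqrt ((2 * Real.pi) ^ d * S.det))⁻¹, fun m u =>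
    Finset.prod_le_prod (fun _ _ => (gaussPDF_pos hS _ _).le) fun _ _ => gaussPDF_le hS _ _⟩
  lower := by
    obtain ⟨a, b, ha, hb, h⟩ := exists_gaussPDF_lower hS
    -- The product contains the squared norm of m with multiplicity n and each outcome once; n + 1
    -- dominates both multiplicities, also for n = 0.
    refine ⟨a * (n + 1), b ^ n, by positivity, by positivity, fun m u => ?_⟩
    have h1 : ∏ i : Fin n, (b * Real.exp (-(a * (‖m‖ ^ 2 + ‖u i‖ ^ 2)))) ≤ gaussPDFn m S u :=
      Finset.prod_le_prod (fun _ _ => by positivity) fun i _ => h m (u i)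
    refine le_trans ?_ h1
    rw [Finset.prod_mul_distrib, ← Real.exp_sum, Finset.sum_neg_distrib, ← Finset.mul_sum,
      Finset.sum_add_distrib]
    simp only [Finset.prod_const, Finset.card_univ, Fintype.card_fin, Finset.sum_const,
      nsmul_eq_mul]
    have h2 : 0 ≤ ∑ i, ‖u i‖ ^ 2 := by positivity
    have h3 : n * ‖m‖ ^ 2 + ∑ i, ‖u i‖ ^ 2 ≤ (n + 1) * (‖m‖ ^ 2 + ∑ i, ‖u i‖ ^ 2) := by
      have h4 : (0 : ℝ) ≤ n * ∑ i, ‖u i‖ ^ 2 := by positivity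
      have h5 := sq_nonneg ‖m‖
      linarith
    rw [mul_assoc]
    gcongr
  lintegral_eq_one m := by
    have : IsProbabilityMeasure (gaussLaw n m S) := inferInstance
    rw [gaussLaw_eq_withDensity hS] at this
    have h := this.measure_univ
    rwa [withDensity_apply _ MeasurableSet.univ, Measure.restrict_univ] at h

lemma law_gaussPDF {S : Matrix (Fin d) (Fin d) ℝ} (hS : S.PosDef) :
    (isDensityFamily_gaussPDF hS).law = fun m => multivariateGaussian m S :=
  funext fun m => (multivariateGaussian_eq_withDensity hS m).symm

lemma law_gaussPDFn {S : Matrix (Fin d) (Fin d) ℝ} (hS : S.PosDef) (n : ℕ) :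
    (isDensityFamily_gaussPDFn hS n).law = fun m => gaussLaw n m S :=
  funext fun m => (gaussLaw_eq_withDensity hS n m).symm

lemma integrable_sq_norm_multivariateGaussian (m : Vec d) (S : Matrix (Fin d) (Fin d) ℝ) :
    Integrable (fun x => ‖x‖ ^ 2) (multivariateGaussian m S) :=
  (IsGaussian.memLp_two_id (μ := multivariateGaussian m S)).integrable_norm_pow two_ne_zero

lemma volume_absolutelyContinuous_multivariateGaussian {S : Matrix (Fin d) (Fin d) ℝ}
    (hS : S.PosDef) (m : Vec d) :
    (volume : Measure (Vec d)) ≪ multivariateGaussian m S := by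
  rw [multivariateGaussian_eq_withDensity hS]
  refine withDensity_absolutelyContinuous'
    (continuous_gaussPDF S continuous_const continuous_id).measurable.ennreal_ofReal.aemeasurable
    (Eventually.of_forall fun u => ?_)
  simpa using gaussPDF_pos hS m u

lemma isRIPr_gauss {Sp Sq : Matrix (Fin d) (Fin d) ℝ} (hSp : Sp.PosDef) (hSq : Sq.PosDef)
    (W : Measure (Vec d)) [IsProbabilityMeasure W] (m₀ : Vec d)
    (he : ∀ m, ∫⁻ x, ENNReal.ofReal
      (gaussPDF m Sp x * gaussPDF m₀ Sq x / ∫ m, gaussPDF m Sp x ∂W) ≤ 1) :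
    IsRIPr (multivariateGaussian m₀ Sq) (family Sp) fun x => ∫ m, gaussPDF m Sp x ∂W := by
  have h := (isDensityFamily_gaussPDF hSp).isRIPr W
    ((isDensityFamily_gaussPDF hSq).measurable_apply m₀) (gaussPDF_pos hSq m₀)
    (multivariateGaussian_eq_withDensity hSq m₀)
    ((isDensityFamily_gaussPDF hSq).integrable_log_apply
      (integrable_sq_norm_multivariateGaussian m₀ Sq) m₀)
    (integrable_sq_norm_multivariateGaussian m₀ Sq) he
  rwa [law_gaussPDF hSp] at h

/-- The likelihood ratio of two members of the null is an exponential tilt with parameter a = Sp⁻¹(m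
- m₀). Tilting N(m₀, Sq) by a moves its mean to m₀ + Sq a, and the constant left over is exp(aᵀ(Sq -
Sp)a / 2) ≤ 1. -/
lemma gaussPDF_mul_div {Sp Sq : Matrix (Fin d) (Fin d) ℝ} (hSp : Sp.PosDef) (hSq : Sq.PosDef)
    (hle : (Sp - Sq).PosSemidef) (m₀ m : Vec d) :
    ∃ m', ∀ x, gaussPDF m Sp x * gaussPDF m₀ Sq x / gaussPDF m₀ Sp x ≤ gaussPDF m' Sq x := by
  have hup : IsUnit Sp.det := isUnit_iff_ne_zero.2 hSp.det_pos.ne'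
  have huq : IsUnit Sq.det := isUnit_iff_ne_zero.2 hSq.det_pos.ne'
  set a : Fin d → ℝ := Sp⁻¹ *ᵥ WithLp.ofLp (m - m₀) with ha
  have hδ : WithLp.ofLp (m - m₀) = Sp *ᵥ a := by
    rw [ha, Matrix.mulVec_mulVec, Matrix.mul_nonsing_inv _ hup, Matrix.one_mulVec]
  refine ⟨m₀ + WithLp.toLp 2 (Sq *ᵥ a), fun x => ?_⟩
  have hsymq := posDef_transpose hSq.inv
  have h1 : quad Sp⁻¹ (x - m) = quad Sp⁻¹ (x - m₀) + quad Sp⁻¹ (m - m₀) -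
      2 * (WithLp.ofLp (x - m₀) ⬝ᵥ a) := by
    have : x - m = (x - m₀) + -(m - m₀) := by abel
    rw [this, quad_add (posDef_transpose hSp.inv), quad_neg, WithLp.ofLp_neg, Matrix.mulVec_neg,
      ← ha, dotProduct_neg]
    ring
  have h2 : quad Sq⁻¹ (x - (m₀ + WithLp.toLp 2 (Sq *ᵥ a))) = quad Sq⁻¹ (x - m₀) + a ⬝ᵥ (Sq *ᵥ a) -
      2 * (WithLp.ofLp (x - m₀) ⬝ᵥ a) := by
    have h3 : x - (m₀ + WithLp.toLp 2 (Sq *ᵥ a)) = (x - m₀) + -WithLp.toLp 2 (Sq *ᵥ a) := by abel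
    have h4 : Sq⁻¹ *ᵥ (Sq *ᵥ a) = a := by
      rw [Matrix.mulVec_mulVec, Matrix.nonsing_inv_mul _ huq, Matrix.one_mulVec]
    have h5 : quad Sq⁻¹ (WithLp.toLp 2 (Sq *ᵥ a)) = a ⬝ᵥ (Sq *ᵥ a) := by
      rw [quad, h4, dotProduct_comm]
    rw [h3, quad_add hsymq, quad_neg, WithLp.ofLp_neg, Matrix.mulVec_neg, h4, dotProduct_neg, h5]
    ring
  have h5 : quad Sp⁻¹ (m - m₀) = a ⬝ᵥ (Sp *ᵥ a) := by
    rw [quad, ← ha, hδ, dotProduct_comm]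
  have h6 : 0 ≤ a ⬝ᵥ (Sp *ᵥ a) - a ⬝ᵥ (Sq *ᵥ a) := by
    have := hle.dotProduct_mulVec_nonneg a
    simpa [Matrix.sub_mulVec, dotProduct_sub] using this
  have hcp := Real.sqrt_pos.2 (gaussPDF_const_pos hSp)
  have hcq := Real.sqrt_pos.2 (gaussPDF_const_pos hSq)
  rw [div_le_iff₀ (gaussPDF_pos hSp _ _)]
  unfold gaussPDF
  rw [mul_mul_mul_comm,
    mul_mul_mul_comm (Real.sqrt ((2 * Real.pi) ^ d * Sq.det))⁻¹ (Real.exp _), ← Real.exp_add,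
    ← Real.exp_add, mul_comm (Real.sqrt ((2 * Real.pi) ^ d * Sp.det))⁻¹]
  refine mul_le_mul_of_nonneg_left (Real.exp_le_exp.2 ?_) (by positivity)
  rw [h1, h2, h5]
  linarith

/-- The reverse information projection in the simple case. -/
lemma isRIPr_gauss_simple {Sp Sq : Matrix (Fin d) (Fin d) ℝ} (hSp : Sp.PosDef) (hSq : Sq.PosDef)
    (hle : (Sp - Sq).PosSemidef) (m₀ : Vec d) :
    IsRIPr (multivariateGaussian m₀ Sq) (family Sp) (gaussPDF m₀ Sp) := by
  -- The projection is a single element of the null, so the mixing prior is a point mass.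
  have h := isRIPr_gauss hSp hSq (Measure.dirac m₀) m₀ fun m => by
    obtain ⟨m', hm'⟩ := gaussPDF_mul_div hSp hSq hle m₀ m
    refine le_trans (lintegral_mono fun x => ENNReal.ofReal_le_ofReal ?_)
      (lintegral_gaussPDF hSq m').le
    simpa using hm' x
  simpa using h

/-- The reverse information projection in the anti-simple case. -/
lemma isRIPr_gauss_antisimple {Sp Sq : Matrix (Fin d) (Fin d) ℝ} (hSp : Sp.PosDef)
    (hSq : Sq.PosDef) (hle : (Sq - Sp).PosSemidef) (m₀ : Vec d) :
    IsRIPr (multivariateGaussian m₀ Sq) (family Sp) (gaussPDF m₀ Sq) := by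
  -- The prior with covariance Sq - Sp reproduces the alternative exactly, so q/ρ = 1.
  have hmix : ∀ x, ∫ m, gaussPDF m Sp x ∂multivariateGaussian m₀ (Sq - Sp) = gaussPDF m₀ Sq x :=
    fun x => by rw [integral_gaussPDF_multivariateGaussian hSp hle, sub_add_cancel]
  have h := isRIPr_gauss hSp hSq (multivariateGaussian m₀ (Sq - Sp)) m₀ fun m => by
    refine le_trans (lintegral_mono fun x => ENNReal.ofReal_le_ofReal ?_)
      (lintegral_gaussPDF hSp m).le
    rw [hmix, mul_div_cancel_right₀ _ (gaussPDF_pos hSq m₀ x).ne']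
  simpa only [hmix] using h

/-! ### The projection of a Bayes marginal -/

lemma mixLaw_eq_withDensity {S : Matrix (Fin d) (Fin d) ℝ} (hS : S.PosDef) (n : ℕ)
    (W : Measure (Vec d)) [IsProbabilityMeasure W] :
    mixLaw n W S = volume.withDensity fun u => ENNReal.ofReal (mixPDF W S u) := by
  have h := (isDensityFamily_gaussPDFn hS n).bind_law W
  rwa [law_gaussPDFn hS n] at h

lemma isProbabilityMeasure_mixLaw {S : Matrix (Fin d) (Fin d) ℝ} (hS : S.PosDef) (n : ℕ)
    (W : Measure (Vec d)) [IsProbabilityMeasure W] : IsProbabilityMeasure (mixLaw n W S) := by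
  refine ⟨?_⟩
  rw [mixLaw_eq_withDensity hS, withDensity_apply _ MeasurableSet.univ, Measure.restrict_univ]
  exact (isDensityFamily_gaussPDFn hS n).lintegral_integral W measurable_id

lemma measurable_mixPDF {S : Matrix (Fin d) (Fin d) ℝ} (hS : S.PosDef) {n : ℕ}
    (W : Measure (Vec d)) [IsProbabilityMeasure W] :
    Measurable (mixPDF W S : Sample d n → ℝ) :=
  (isDensityFamily_gaussPDFn hS n).measurable_integral W measurable_id

lemma mixPDF_pos {S : Matrix (Fin d) (Fin d) ℝ} (hS : S.PosDef) {n : ℕ}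
    (W : Measure (Vec d)) [IsProbabilityMeasure W] (u : Sample d n) : 0 < mixPDF W S u :=
  (isDensityFamily_gaussPDFn hS n).integral_pos W u

lemma volume_absolutelyContinuous_mixLaw {S : Matrix (Fin d) (Fin d) ℝ} (hS : S.PosDef) (n : ℕ)
    (W : Measure (Vec d)) [IsProbabilityMeasure W] :
    (volume : Measure (Sample d n)) ≪ mixLaw n W S := by
  rw [mixLaw_eq_withDensity hS]
  refine withDensity_absolutelyContinuous' (measurable_mixPDF hS W).ennreal_ofReal.aemeasurable
    (Eventually.of_forall fun u => ?_)
  simpa using mixPDF_pos hS W u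

/-- Under the mixture each single outcome has law N(m, V + S), whose second moment is finite. -/
lemma integrable_sq_norm_mixLaw {S V : Matrix (Fin d) (Fin d) ℝ} (hS : S.PosDef) (n : ℕ)
    (hV : V.PosSemidef) (m : Vec d) :
    Integrable (fun u : Sample d n => ∑ i, ‖u i‖ ^ 2)
      (mixLaw n (multivariateGaussian m V) S) := by
  have hlaw := (isDensityFamily_gaussPDFn hS n).measurable_law
  rw [law_gaussPDFn hS n] at hlaw
  refine integrable_finsetSum _ fun i _ => ?_
  have hm : Measurable fun u : Sample d n => ‖u i‖ ^ 2 :=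
    (measurable_pi_apply i).norm.pow_const 2
  refine ⟨hm.aestronglyMeasurable, ?_⟩
  have h0 : 0 ≤ᵐ[mixLaw n (multivariateGaussian m V) S] fun u : Sample d n => ‖u i‖ ^ 2 :=
    Eventually.of_forall fun u => by positivity
  rw [hasFiniteIntegral_iff_ofReal h0, mixLaw,
    Measure.lintegral_bind hlaw.aemeasurable hm.ennreal_ofReal.aemeasurable]
  have h1 : ∀ y : Vec d, ∫⁻ u : Sample d n, ENNReal.ofReal (‖u i‖ ^ 2) ∂gaussLaw n y S =
      ∫⁻ x, ENNReal.ofReal (‖x‖ ^ 2) ∂multivariateGaussian y S := fun y =>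
    (measurePreserving_eval (fun _ : Fin n => multivariateGaussian y S) i).lintegral_comp
      (f := fun x => ENNReal.ofReal (‖x‖ ^ 2)) (by fun_prop)
  simp_rw [h1]
  have h2 := (isDensityFamily_gaussPDF hS).lintegral_mul_integral (multivariateGaussian m V)
    measurable_id (S := fun x => ENNReal.ofReal (‖x‖ ^ 2)) (by fun_prop)
  simp only [id, law_gaussPDF hS, integral_gaussPDF_multivariateGaussian hS hV] at h2
  rw [← h2]
  have hVS : (V + S).PosDef := hS.posSemidef_add hV
  have h3 := (integrable_sq_norm_multivariateGaussian m (V + S)).2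
  have h4 : 0 ≤ᵐ[multivariateGaussian m (V + S)] fun x : Vec d => ‖x‖ ^ 2 :=
    Eventually.of_forall fun u => by positivity
  have h5 : Measurable fun x => ENNReal.ofReal (gaussPDF m (V + S) x) :=
    (continuous_gaussPDF _ continuous_const continuous_id).measurable.ennreal_ofReal
  rw [hasFiniteIntegral_iff_ofReal h4, multivariateGaussian_eq_withDensity hVS,
    lintegral_withDensity_eq_lintegral_mul _ h5 (by fun_prop)] at h3
  simpa only [Pi.mul_apply, mul_comm] using h3

/-- Multiply and divide by the density of the mean under N(0, S/n) and push the sample law forward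
to the mean. The value does not depend on S, so one profile may be exchanged for another under
integrals against functions of the mean. -/
lemma lintegral_profile_mul {n : ℕ} (hn : 1 ≤ n) {S : Matrix (Fin d) (Fin d) ℝ} (hS : S.PosDef)
    {h : Vec d → ℝ≥0∞} (hh : Measurable h) :
    ∫⁻ u : Sample d n, ENNReal.ofReal (profile S u) * h (mle u) = ∫⁻ z, h z := by
  have hSn := posDef_inv_smul hn hS
  set k : Vec d → ℝ≥0∞ := fun z => ENNReal.ofReal (gaussPDF 0 ((n : ℝ)⁻¹ • S) z) with hk
  have hkm : Measurable k :=
    (continuous_gaussPDF _ continuous_const continuous_id).measurable.ennreal_ofReal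
  have hk0 : ∀ z, k z ≠ 0 := fun z => by simpa [hk] using gaussPDF_pos hSn 0 z
  have hkt : ∀ z, k z ≠ ∞ := fun z => ENNReal.ofReal_ne_top
  have hhk : Measurable fun z => h z / k z := hh.div hkm
  have h1 : ∫⁻ u : Sample d n, h (mle u) / k (mle u) ∂gaussLaw n 0 S = ∫⁻ z, h z := by
    rw [← lintegral_map (f := fun z => h z / k z) hhk continuous_mle.measurable,
      gaussLaw_map_mle hn hS, multivariateGaussian_eq_withDensity hSn,
      lintegral_withDensity_eq_lintegral_mul _ hkm hhk]
    exact lintegral_congr fun z => ENNReal.mul_div_cancel (hk0 z) (hkt z)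
  have hg : Measurable fun u : Sample d n => ENNReal.ofReal (gaussPDFn 0 S u) :=
    (continuous_gaussPDFn S continuous_const continuous_id).measurable.ennreal_ofReal
  have hhkm : Measurable fun u : Sample d n => h (mle u) / k (mle u) :=
    hhk.comp continuous_mle.measurable
  rw [← h1, gaussLaw_eq_withDensity hS, lintegral_withDensity_eq_lintegral_mul _ hg hhkm]
  refine lintegral_congr fun u => ?_
  rw [Pi.mul_apply, gaussPDFn_eq_profile_mul hn hS, ENNReal.ofReal_mul (profile_pos hn hS u).le,
    mul_assoc]
  congr 1
  exact (ENNReal.mul_div_cancel (hk0 _) (hkt _)).symm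

/-- The ratio of the conditional densities of a sample given its mean. -/
noncomputable def condRatio (Sp Sq : Matrix (Fin d) (Fin d) ℝ) {n : ℕ} (u : Sample d n) : ℝ :=
  profile Sq u / profile Sp u

lemma condRatio_pos {n : ℕ} (hn : 1 ≤ n) {Sp Sq : Matrix (Fin d) (Fin d) ℝ} (hSp : Sp.PosDef)
    (hSq : Sq.PosDef) (u : Sample d n) : 0 < condRatio Sp Sq u :=
  div_pos (profile_pos hn hSq u) (profile_pos hn hSp u)

lemma continuous_condRatio {n : ℕ} (hn : 1 ≤ n) {Sp : Matrix (Fin d) (Fin d) ℝ}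
    (hSp : Sp.PosDef) (Sq : Matrix (Fin d) (Fin d) ℝ) :
    Continuous (condRatio Sp Sq : Sample d n → ℝ) :=
  (continuous_profile Sq).div (continuous_profile Sp) fun u => (profile_pos hn hSp u).ne'

/-- The null prior covariance V₀ is chosen so that V₀ + Sp/n = V + Sq/n: both marginals give the
mean the same density, and only the profiles remain. -/
lemma mixPDF_div_mixPDF {n : ℕ} (hn : 1 ≤ n) {Sp Sq V : Matrix (Fin d) (Fin d) ℝ}
    (hSp : Sp.PosDef) (hSq : Sq.PosDef) (hV : V.PosDef)
    (hV₀ : (V + (n : ℝ)⁻¹ • (Sq - Sp)).PosSemidef) (m : Vec d) (u : Sample d n) :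
    mixPDF (multivariateGaussian m V) Sq u /
      mixPDF (multivariateGaussian m (V + (n : ℝ)⁻¹ • (Sq - Sp))) Sp u = condRatio Sp Sq u := by
  rw [mixPDF_multivariateGaussian hn hSq hV.posSemidef, mixPDF_multivariateGaussian hn hSp hV₀,
    smul_sub, add_assoc, sub_add_cancel]
  exact mul_div_mul_right _ _
    (gaussPDF_pos (hV.add_posSemidef (posDef_inv_smul hn hSq).posSemidef) _ _).ne'

/-- Multiplying by `condRatio` replaces the profile of Sp by that of Sq while keeping the null
density of the mean. -/
lemma lintegral_gaussPDFn_mul_condRatio {n : ℕ} (hn : 1 ≤ n) {Sp Sq : Matrix (Fin d) (Fin d) ℝ}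
    (hSp : Sp.PosDef) (hSq : Sq.PosDef) (m : Vec d) :
    ∫⁻ u : Sample d n, ENNReal.ofReal (gaussPDFn m Sp u * condRatio Sp Sq u) = 1 := by
  have hm : Measurable fun z => ENNReal.ofReal (gaussPDF m ((n : ℝ)⁻¹ • Sp) z) :=
    (continuous_gaussPDF _ continuous_const continuous_id).measurable.ennreal_ofReal
  rw [← lintegral_gaussPDF (posDef_inv_smul hn hSp) m, ← lintegral_profile_mul hn hSq hm]
  refine lintegral_congr fun u => ?_
  rw [← ENNReal.ofReal_mul (profile_pos hn hSq u).le, gaussPDFn_eq_profile_mul hn hSp, condRatio]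
  congr 1
  have := (profile_pos hn hSp u).ne'
  field_simp

lemma lintegral_mix_evar {n : ℕ} (hn : 1 ≤ n) {Sp Sq V : Matrix (Fin d) (Fin d) ℝ}
    (hSp : Sp.PosDef) (hSq : Sq.PosDef) (hV : V.PosDef)
    (hV₀ : (V + (n : ℝ)⁻¹ • (Sq - Sp)).PosSemidef) (m₁ m : Vec d) :
    ∫⁻ u : Sample d n, ENNReal.ofReal (gaussPDFn m Sp u * mixPDF (multivariateGaussian m₁ V) Sq u /
      mixPDF (multivariateGaussian m₁ (V + (n : ℝ)⁻¹ • (Sq - Sp))) Sp u) ≤ 1 := by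
  simp_rw [mul_div_assoc, mixPDF_div_mixPDF hn hSp hSq hV hV₀]
  exact (lintegral_gaussPDFn_mul_condRatio hn hSp hSq m).le

lemma isRIPr_mixLaw {n : ℕ} (hn : 1 ≤ n) {Sp Sq V : Matrix (Fin d) (Fin d) ℝ}
    (hSp : Sp.PosDef) (hSq : Sq.PosDef) (hV : V.PosDef)
    (hV₀ : (V + (n : ℝ)⁻¹ • (Sq - Sp)).PosSemidef) (m₁ : Vec d) :
    IsRIPr (mixLaw n (multivariateGaussian m₁ V) Sq) (familyN n Sp)
      (mixPDF (multivariateGaussian m₁ (V + (n : ℝ)⁻¹ • (Sq - Sp))) Sp) := by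
  have := isProbabilityMeasure_mixLaw hSq n (multivariateGaussian m₁ V)
  have hG := integrable_sq_norm_mixLaw hSq n hV.posSemidef m₁
  have h := (isDensityFamily_gaussPDFn hSp n).isRIPr
    (multivariateGaussian m₁ (V + (n : ℝ)⁻¹ • (Sq - Sp)))
    (measurable_mixPDF hSq (multivariateGaussian m₁ V)) (mixPDF_pos hSq _)
    (mixLaw_eq_withDensity hSq n _)
    ((isDensityFamily_gaussPDFn hSq n).integrable_log_integral (multivariateGaussian m₁ V) hG)
    hG (lintegral_mix_evar hn hSp hSq hV hV₀ m₁)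
  rwa [law_gaussPDFn hSp n] at h

lemma isGRO_mixLaw {n : ℕ} (hn : 1 ≤ n) {Sp Sq V : Matrix (Fin d) (Fin d) ℝ}
    (hSp : Sp.PosDef) (hSq : Sq.PosDef) (hV : V.PosDef)
    (hV₀ : (V + (n : ℝ)⁻¹ • (Sq - Sp)).PosSemidef) (m₁ : Vec d) {S : Sample d n → ℝ}
    (hS : Measurable S) (hSe : S =ᵐ[volume] condRatio Sp Sq) :
    IsGRO (familyN n Sp) (mixLaw n (multivariateGaussian m₁ V) Sq)
      fun u => ENNReal.ofReal (S u) := by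
  have := isProbabilityMeasure_mixLaw hSq n (multivariateGaussian m₁ V)
  have hG := integrable_sq_norm_mixLaw hSq n hV.posSemidef m₁
  have h := (isDensityFamily_gaussPDFn hSp n).isGRO
    (multivariateGaussian m₁ (V + (n : ℝ)⁻¹ • (Sq - Sp)))
    (measurable_mixPDF hSq (multivariateGaussian m₁ V)) (mixPDF_pos hSq _)
    (mixLaw_eq_withDensity hSq n _)
    ((isDensityFamily_gaussPDFn hSq n).integrable_log_integral (multivariateGaussian m₁ V) hG)
    hG (lintegral_mix_evar hn hSp hSq hV hV₀ m₁) hS.ennreal_ofReal ?_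
  · rwa [law_gaussPDFn hSp n] at h
  · filter_upwards [hSe] with u hu
    rw [hu, ← mixPDF_div_mixPDF hn hSp hSq hV hV₀ m₁ u, mixPDF, mixPDF]

end GaussE

namespace GaussE

variable {d : ℕ}

/-! ### Moments of quadratic forms -/

lemma integral_quad {Ω : Type*} [MeasurableSpace Ω] {P : Measure Ω} [IsProbabilityMeasure P]
    {X : Ω → Vec d} (hX : ∀ k, MemLp (fun ω => X ω k) 2 P) {m : Vec d}
    (hm : ∀ k, ∫ ω, X ω k ∂P = m k) {Γ : Matrix (Fin d) (Fin d) ℝ}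
    (hcov : ∀ k l, covariance (fun ω => X ω k) (fun ω => X ω l) P = Γ k l)
    (A : Matrix (Fin d) (Fin d) ℝ) :
    Integrable (fun ω => quad A (X ω)) P ∧
      ∫ ω, quad A (X ω) ∂P = quad A m + ∑ k, ∑ l, A k l * Γ k l := by
  have hi : ∀ k l, Integrable (fun ω => A k l * (X ω k * X ω l)) P := fun k l =>
    ((hX k).integrable_mul (hX l)).const_mul _
  have hkl : ∀ k l, ∫ ω, X ω k * X ω l ∂P = m k * m l + Γ k l := by
    intro k l
    have h := covariance_eq_sub (hX k) (hX l)
    rw [hcov, hm, hm] at h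
    simp only [Pi.mul_apply] at h
    linarith
  simp_rw [quad_eq_sum]
  refine ⟨integrable_finsetSum _ fun k _ => integrable_finsetSum _ fun l _ => hi k l, ?_⟩
  rw [integral_finsetSum _ fun k _ => integrable_finsetSum _ fun l _ => hi k l,
    ← Finset.sum_add_distrib]
  refine Finset.sum_congr rfl fun k _ => ?_
  rw [integral_finsetSum _ fun l _ => hi k l, ← Finset.sum_add_distrib]
  refine Finset.sum_congr rfl fun l _ => ?_
  rw [integral_const_mul, hkl, mul_add]

lemma sum_inv_mul_eq_dTr {S : Matrix (Fin d) (Fin d) ℝ} (hS : S.PosDef)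
    (Γ : Matrix (Fin d) (Fin d) ℝ) : ∑ k, ∑ l, S⁻¹ k l * Γ k l = dTr Γ S := by
  rw [dTr, Matrix.trace]
  refine Finset.sum_congr rfl fun k _ => ?_
  rw [Matrix.diag_apply, Matrix.mul_apply]
  refine Finset.sum_congr rfl fun l _ => ?_
  have h : S⁻¹ l k = S⁻¹ k l := congrFun (congrFun (posDef_transpose hS.inv) k) l
  rw [h, mul_comm]

/-- `R` has finite second moments, mean `m` and covariance matrix `Γ`. -/
structure HasMeanCov (R : Measure (Vec d)) (m : Vec d) (Γ : Matrix (Fin d) (Fin d) ℝ) :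
    Prop where
  memLp : MemLp id 2 R
  mean : ∫ x, x ∂ R = m
  cov : ∀ i j, covariance (fun x : Vec d => x i) (fun x : Vec d => x j) R = Γ i j

namespace HasMeanCov

variable {R : Measure (Vec d)} {m : Vec d} {Γ : Matrix (Fin d) (Fin d) ℝ}

lemma memLp_apply (h : HasMeanCov R m Γ) (k : Fin d) : MemLp (fun x : Vec d => x k) 2 R := by
  refine h.memLp.of_le (by fun_prop) (Eventually.of_forall fun x => ?_)
  exact PiLp.norm_apply_le x k

variable [IsProbabilityMeasure R]

lemma integral_apply (h : HasMeanCov R m Γ) (k : Fin d) : ∫ x : Vec d, x k ∂ R = m k := by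
  rw [← h.mean]
  exact (EuclideanSpace.proj (𝕜 := ℝ) k).integral_comp_comm (h.memLp.integrable (by norm_num))

lemma quad_sub (h : HasMeanCov R m Γ) {S : Matrix (Fin d) (Fin d) ℝ} (hS : S.PosDef) :
    Integrable (fun x => quad S⁻¹ (x - m)) R ∧ ∫ x, quad S⁻¹ (x - m) ∂ R = dTr Γ S := by
  have h1 : ∀ k, MemLp (fun x : Vec d => (x - m) k) 2 R := fun k =>
    (h.memLp_apply k).sub (memLp_const (m k))
  have h3 := integral_quad h1 (m := 0) (Γ := Γ) (fun k => by
    simp only [PiLp.sub_apply]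
    rw [integral_sub ((h.memLp_apply k).integrable (by norm_num)) (integrable_const _),
      h.integral_apply]
    simp) (fun k l => by
    simp only [PiLp.sub_apply]
    simp only [sub_eq_add_neg]
    rw [covariance_add_const_left ((h.memLp_apply k).integrable (by norm_num)),
      covariance_add_const_right ((h.memLp_apply l).integrable (by norm_num)), h.cov]) S⁻¹
  rwa [quad_zero, zero_add, sum_inv_mul_eq_dTr hS] at h3

variable {n : ℕ}

lemma memLp_eval (h : HasMeanCov R m Γ) (k : Fin d) (i : Fin n) :
    MemLp (fun u : Sample d n => u i k) 2 (Measure.pi fun _ => R) :=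
  (h.memLp_apply k).comp_measurePreserving (measurePreserving_eval (fun _ : Fin n => R) i)

lemma covariance_eval (h : HasMeanCov R m Γ) (k l : Fin d) (i j : Fin n) :
    covariance (fun u : Sample d n => u i k) (fun u => u j l) (Measure.pi fun _ => R) =
      if i = j then Γ k l else 0 := by
  split_ifs with hij
  · subst hij
    have h1 := covariance_map (μ := Measure.pi fun _ : Fin n => R) (Z := fun u => u i)
      (X := fun x : Vec d => x k) (Y := fun x : Vec d => x l) (by fun_prop) (by fun_prop)
      (measurable_pi_apply i).aemeasurable
    rw [(measurePreserving_eval (fun _ : Fin n => R) i).map_eq, h.cov] at h1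
    exact h1.symm
  · have h2 := (iIndepFun_pi (μ := fun _ : Fin n => R) (X := fun _ x => x)
      fun _ => aemeasurable_id).indepFun hij
    have h3 : IndepFun (fun u : Sample d n => u i k) (fun u => u j l) (Measure.pi fun _ => R) :=
      h2.comp (φ := fun x : Vec d => x k) (ψ := fun x : Vec d => x l) (by fun_prop) (by fun_prop)
    exact h3.covariance_eq_zero (h.memLp_eval k i) (h.memLp_eval l j)

/-- Independence makes the covariance of the linear combination equal to (∑ aⱼ²)Γ. The deviations
involving the sample mean and the plug-in estimator are obtained by choosing a and b. -/
lemma quad_linear (h : HasMeanCov R m Γ) {S : Matrix (Fin d) (Fin d) ℝ} (hS : S.PosDef)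
    (a : Fin n → ℝ) (b : Vec d) :
    Integrable (fun u : Sample d n => quad S⁻¹ (∑ j, a j • u j + b)) (Measure.pi fun _ => R) ∧
      ∫ u : Sample d n, quad S⁻¹ (∑ j, a j • u j + b) ∂(Measure.pi fun _ => R) =
        quad S⁻¹ ((∑ j, a j) • m + b) + (∑ j, a j ^ 2) * dTr Γ S := by
  have hX : ∀ (k : Fin d) (u : Sample d n),
      (∑ j, a j • u j + b) k = ∑ j, a j * u j k + b k := by
    intro k u
    simp
  have hL : ∀ k, MemLp (fun u : Sample d n => ∑ j, a j * u j k) 2 (Measure.pi fun _ => R) :=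
    fun k => memLp_finsetSum _ fun j _ => (h.memLp_eval k j).const_mul (a j)
  have hLi : ∀ k, Integrable (fun u : Sample d n => ∑ j, a j * u j k) (Measure.pi fun _ => R) :=
    fun k => (hL k).integrable (by norm_num)
  have h1 := integral_quad (P := Measure.pi fun _ : Fin n => R)
    (X := fun u : Sample d n => ∑ j, a j • u j + b) (m := (∑ j, a j) • m + b)
    (Γ := (∑ j, a j ^ 2) • Γ)
    (fun k => by simp_rw [hX]; exact (hL k).add (memLp_const (b k)))
    (fun k => by
      simp_rw [hX]
      rw [integral_add (hLi k) (integrable_const _), integral_finsetSum _ fun j _ =>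
        ((h.memLp_eval k j).integrable (by norm_num)).const_mul (a j)]
      simp_rw [integral_const_mul]
      have h2 : ∀ j, ∫ u : Sample d n, u j k ∂(Measure.pi fun _ => R) = m k := fun j => by
        rw [← h.integral_apply k]
        exact integral_comp_eval (μ := fun _ : Fin n => R) (i := j) (f := fun x : Vec d => x k)
          (by fun_prop)
      simp_rw [h2]
      simp [Finset.sum_mul])
    (fun k l => by
      simp_rw [hX]
      rw [covariance_add_const_left (hLi k), covariance_add_const_right (hLi l),
        covariance_fun_sum_fun_sum (fun j => (h.memLp_eval k j).const_mul (a j))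
        (fun j => (h.memLp_eval l j).const_mul (a j))]
      simp_rw [covariance_const_mul_left, covariance_const_mul_right, h.covariance_eval]
      simp only [mul_ite, mul_zero, Finset.sum_ite_eq, Finset.mem_univ, if_true,
        Matrix.smul_apply, smul_eq_mul, Finset.sum_mul]
      exact Finset.sum_congr rfl fun j _ => by ring) S⁻¹
  refine ⟨h1.1, h1.2.trans ?_⟩
  rw [← sum_inv_mul_eq_dTr hS]
  congr 1
  simp only [Matrix.smul_apply, smul_eq_mul, Finset.mul_sum]
  exact Finset.sum_congr rfl fun k _ => Finset.sum_congr rfl fun l _ => by ring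

lemma quad_mle_sub (h : HasMeanCov R m Γ) (hn : 1 ≤ n) {S : Matrix (Fin d) (Fin d) ℝ}
    (hS : S.PosDef) (c : Vec d) :
    Integrable (fun u : Sample d n => quad S⁻¹ (mle u - c)) (Measure.pi fun _ => R) ∧
      ∫ u : Sample d n, quad S⁻¹ (mle u - c) ∂(Measure.pi fun _ => R) =
        quad S⁻¹ (m - c) + (n : ℝ)⁻¹ * dTr Γ S := by
  have hn0 : (n : ℝ) ≠ 0 := by positivity
  have h1 := h.quad_linear hS (fun _ : Fin n => (n : ℝ)⁻¹) (-c)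
  have h2 : ∀ u : Sample d n, ∑ j, ((n : ℝ)⁻¹ • u j) + -c = mle u - c := fun u => by
    rw [← Finset.smul_sum, sub_eq_add_neg, mle]
  have h3 : ∑ _j : Fin n, (n : ℝ)⁻¹ = 1 := by simp [hn0]
  have h4 : ∑ _j : Fin n, (n : ℝ)⁻¹ ^ 2 = (n : ℝ)⁻¹ := by
    simp
    field_simp
  simp_rw [h2] at h1
  rwa [h3, h4, one_smul, ← sub_eq_add_neg] at h1

lemma quad_sub_mle (h : HasMeanCov R m Γ) (hn : 1 ≤ n) {S : Matrix (Fin d) (Fin d) ℝ}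
    (hS : S.PosDef) (i : Fin n) :
    Integrable (fun u : Sample d n => quad S⁻¹ (u i - mle u)) (Measure.pi fun _ => R) ∧
      ∫ u : Sample d n, quad S⁻¹ (u i - mle u) ∂(Measure.pi fun _ => R) =
        (1 - (n : ℝ)⁻¹) * dTr Γ S := by
  have hn0 : (n : ℝ) ≠ 0 := by positivity
  have h1 := h.quad_linear hS (fun j : Fin n => (if j = i then 1 else 0) - (n : ℝ)⁻¹) 0
  have h2 : ∀ u : Sample d n,
      ∑ j, (((if j = i then 1 else 0) - (n : ℝ)⁻¹) • u j) + 0 = u i - mle u := fun u => by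
    simp [sub_smul, Finset.sum_sub_distrib, ite_smul, mle, Finset.smul_sum]
  have h3 : ∑ j : Fin n, ((if j = i then (1 : ℝ) else 0) - (n : ℝ)⁻¹) = 0 := by
    simp [Finset.sum_sub_distrib, hn0]
  have h4 : ∑ j : Fin n, ((if j = i then (1 : ℝ) else 0) - (n : ℝ)⁻¹) ^ 2 = 1 - (n : ℝ)⁻¹ := by
    have h5 : ∀ j : Fin n, ((if j = i then (1 : ℝ) else 0) - (n : ℝ)⁻¹) ^ 2 =
        (if j = i then 1 - 2 * (n : ℝ)⁻¹ else 0) + (n : ℝ)⁻¹ ^ 2 := fun j => by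
      split_ifs <;> ring
    simp_rw [h5, Finset.sum_add_distrib]
    simp
    field_simp
    ring
  simp_rw [h2] at h1
  rwa [h3, h4, zero_smul, zero_add, quad_zero, zero_add] at h1

lemma quad_sub_plugin (h : HasMeanCov R m Γ) {S : Matrix (Fin d) (Fin d) ℝ}
    (hS : S.PosDef) (x₀ : Vec d) {n₀ : ℝ} (hn₀ : 0 < n₀) (i : Fin n) :
    Integrable (fun u : Sample d n => quad S⁻¹ (u i - plugin x₀ n₀ u i)) (Measure.pi fun _ => R) ∧
      ∫ u : Sample d n, quad S⁻¹ (u i - plugin x₀ n₀ u i) ∂(Measure.pi fun _ => R) =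
        1 / (1 + ((i : ℕ) : ℝ) / n₀) ^ 2 * quad S⁻¹ (m - x₀) +
          (1 + ((i : ℕ) : ℝ) / (n₀ + (i : ℕ)) ^ 2) * dTr Γ S := by
  set c : ℝ := ((i : ℕ) : ℝ) + n₀ with hc
  have hc0 : 0 < c := by positivity
  -- The outcome being predicted has coefficient 1 and each of the i earlier ones -1/c with c = i +
  -- n₀. These coefficients sum to n₀/c and their squares to 1 + i/c², the index sets being
  -- disjoint.
  have h1 := h.quad_linear hS
    (fun j : Fin n => (if j = i then 1 else 0) - c⁻¹ * (if j ∈ Finset.Iio i then 1 else 0))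
    (-(c⁻¹ • n₀ • x₀))
  have h2 : ∀ u : Sample d n,
      ∑ j, (((if j = i then 1 else 0) - c⁻¹ * (if j ∈ Finset.Iio i then 1 else 0)) • u j) +
        -(c⁻¹ • n₀ • x₀) = u i - plugin x₀ n₀ u i := fun u => by
    have h3 : ∀ j, ((if j = i then (1 : ℝ) else 0) - c⁻¹ * (if j ∈ Finset.Iio i then 1 else 0)) •
        u j = (if j = i then u j else 0) - c⁻¹ • (if j ∈ Finset.Iio i then u j else 0) := fun j => by
      split_ifs <;> simp [sub_smul]
    simp_rw [h3, Finset.sum_sub_distrib, ← Finset.smul_sum]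
    rw [Finset.sum_ite_eq' Finset.univ i, if_pos (Finset.mem_univ _), Finset.sum_ite_mem,
      Finset.univ_inter, plugin, smul_add]
    abel
  have h3 : ∑ j : Fin n, ((if j = i then (1 : ℝ) else 0) -
      c⁻¹ * (if j ∈ Finset.Iio i then 1 else 0)) = 1 - c⁻¹ * (i : ℕ) := by
    rw [Finset.sum_sub_distrib, ← Finset.mul_sum, Finset.sum_ite_mem]
    simp
  have h4 : ∑ j : Fin n, ((if j = i then (1 : ℝ) else 0) -
      c⁻¹ * (if j ∈ Finset.Iio i then 1 else 0)) ^ 2 = 1 + c⁻¹ ^ 2 * (i : ℕ) := by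
    have h5 : ∀ j : Fin n, ((if j = i then (1 : ℝ) else 0) -
        c⁻¹ * (if j ∈ Finset.Iio i then 1 else 0)) ^ 2 =
        (if j = i then 1 else 0) + c⁻¹ ^ 2 * (if j ∈ Finset.Iio i then 1 else 0) := fun j => by
      by_cases h6 : j = i
      · simp [h6]
      · simp [h6]
    simp_rw [h5, Finset.sum_add_distrib, ← Finset.mul_sum, Finset.sum_ite_mem]
    simp
  have h5 : (1 - c⁻¹ * (i : ℕ)) • m + -(c⁻¹ • n₀ • x₀) = (n₀ / c) • (m - x₀) := by
    have h6 : (1 - c⁻¹ * ((i : ℕ) : ℝ)) = n₀ / c := by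
      field_simp
      rw [hc]; ring
    rw [h6, smul_sub, smul_smul, ← div_eq_inv_mul, sub_eq_add_neg]
  simp_rw [h2] at h1
  rw [h3, h4, h5, quad_smul] at h1
  refine ⟨h1.1, h1.2.trans ?_⟩
  congr 1
  · congr 1
    have : 1 + ((i : ℕ) : ℝ) / n₀ = c / n₀ := by rw [hc]; field_simp; ring
    rw [this]
    field_simp
  · congr 2
    rw [add_comm n₀, ← hc]
    field_simp

end HasMeanCov

end GaussE

namespace GaussE

variable {d : ℕ}

/-! ### Expected logarithms -/

section HasEPower

variable {Ω : Type*} [MeasurableSpace Ω] {R : Measure Ω} {S T : Ω → ℝ} {a b : ℝ}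

lemma HasEPower.mul (hS : HasEPower R S a) (hT : HasEPower R T b) :
    HasEPower R (fun u => S u * T u) (a + b) := by
  have h : (fun u => Real.log (S u * T u)) =ᵐ[R] fun u => Real.log (S u) + Real.log (T u) := by
    filter_upwards [hS.1, hT.1] with u h1 h2
    exact Real.log_mul h1.ne' h2.ne'
  refine ⟨?_, (hS.2.1.add hT.2.1).congr h.symm, ?_⟩
  · filter_upwards [hS.1, hT.1] with u h1 h2
    exact mul_pos h1 h2
  · rw [integral_congr_ae h, integral_add hS.2.1 hT.2.1, hS.2.2, hT.2.2]

lemma HasEPower.div (hS : HasEPower R S a) (hT : HasEPower R T b) :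
    HasEPower R (fun u => S u / T u) (a - b) := by
  have h : (fun u => Real.log (S u / T u)) =ᵐ[R] fun u => Real.log (S u) - Real.log (T u) := by
    filter_upwards [hS.1, hT.1] with u h1 h2
    exact Real.log_div h1.ne' h2.ne'
  refine ⟨?_, (hS.2.1.sub hT.2.1).congr h.symm, ?_⟩
  · filter_upwards [hS.1, hT.1] with u h1 h2
    exact div_pos h1 h2
  · rw [integral_congr_ae h, integral_sub hS.2.1 hT.2.1, hS.2.2, hT.2.2]

lemma HasEPower.congr_ae (hS : HasEPower R S a) (h : S =ᵐ[R] T) : HasEPower R T a := by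
  have h2 : (fun u => Real.log (S u)) =ᵐ[R] fun u => Real.log (T u) :=
    h.mono fun u hu => by simp only [hu]
  refine ⟨?_, hS.2.1.congr h2, (integral_congr_ae h2).symm.trans hS.2.2⟩
  filter_upwards [hS.1, h] with u h1 h3
  rwa [← h3]

lemma HasEPower.congr_val (hS : HasEPower R S a) (h : a = b) : HasEPower R S b := h ▸ hS

lemma hasEPower_const [IsProbabilityMeasure R] {c : ℝ} (hc : 0 < c) :
    HasEPower R (fun _ => c) (Real.log c) :=
  ⟨Eventually.of_forall fun _ => hc, integrable_const _, by simp⟩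

lemma hasEPower_prod {ι : Type*} (s : Finset ι) {f : ι → Ω → ℝ} {c : ι → ℝ}
    [IsProbabilityMeasure R] (h : ∀ i ∈ s, HasEPower R (f i) (c i)) :
    HasEPower R (fun u => ∏ i ∈ s, f i u) (∑ i ∈ s, c i) := by
  classical
  induction s using Finset.induction_on with
  | empty => simpa using hasEPower_const (R := R) one_pos
  | insert j s hj ih =>
    simp_rw [Finset.prod_insert hj, Finset.sum_insert hj]
    exact (h j (Finset.mem_insert_self _ _)).mul
      (ih fun i hi => h i (Finset.mem_insert_of_mem hi))

/-- Both the argument and the centre may be random, so that plug-in predictions and maximized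
likelihoods are covered. -/
lemma hasEPower_gaussPDF [IsProbabilityMeasure R] {S : Matrix (Fin d) (Fin d) ℝ}
    (hS : S.PosDef) {X Y : Ω → Vec d} {c : ℝ}
    (h : Integrable (fun u => quad S⁻¹ (X u - Y u)) R ∧ ∫ u, quad S⁻¹ (X u - Y u) ∂ R = c) :
    HasEPower R (fun u => gaussPDF (Y u) S (X u))
      (-(1 / 2) * Real.log ((2 * Real.pi) ^ d * S.det) - c / 2) := by
  refine ⟨Eventually.of_forall fun u => gaussPDF_pos hS _ _, ?_, ?_⟩
  · simp_rw [log_gaussPDF hS]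
    exact (integrable_const _).sub (h.1.div_const 2)
  · simp_rw [log_gaussPDF hS]
    rw [integral_sub (integrable_const _) (h.1.div_const 2), integral_div, h.2]
    simp

end HasEPower

lemma log_const_eq {S : Matrix (Fin d) (Fin d) ℝ} (hS : S.PosDef) :
    Real.log ((2 * Real.pi) ^ d * S.det) = d * Real.log (2 * Real.pi) + Real.log S.det := by
  rw [Real.log_mul (by positivity) hS.det_pos.ne', Real.log_pow]

lemma covDiv_eq {Sr Sq Sp : Matrix (Fin d) (Fin d) ℝ} (hSp : Sp.PosDef) (hSq : Sq.PosDef) :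
    covDiv Sr Sq Sp = -(1 / 2) * (Real.log Sq.det - Real.log Sp.det) +
      (dTr Sr Sp - dTr Sr Sq) / 2 := by
  rw [covDiv, Matrix.det_mul, Real.log_mul hSq.det_pos.ne' hSp.inv.det_pos.ne',
    Matrix.det_nonsing_inv, Ring.inverse_eq_inv', Real.log_inv, ← sub_eq_add_neg]

lemma log_det_inv_smul {n : ℕ} (hn : 1 ≤ n) {S : Matrix (Fin d) (Fin d) ℝ} (hS : S.PosDef) :
    Real.log ((n : ℝ)⁻¹ • S).det = -(d * Real.log n) + Real.log S.det := by
  have hn0 : (n : ℝ)⁻¹ ≠ 0 := by positivity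
  rw [Matrix.det_smul, Fintype.card_fin, Real.log_mul (pow_ne_zero _ hn0) hS.det_pos.ne',
    Real.log_pow, Real.log_inv]
  ring

lemma sum_div_sq_eq_remB (n₀ : ℝ) {n : ℕ} (hn : 1 ≤ n) :
    ∑ i ∈ Finset.range n, (i : ℝ) / (n₀ + i) ^ 2 = remB n₀ n + Real.log n := by
  rw [remB, ← Finset.sum_range_add_sum_Ico _ hn]
  simp

/-- Rescaling Sq + nV to V + Sq/n extracts (d/2) log n from the determinant, which cancels the
explicit logarithm; what remains converges term by term. -/
lemma remBayesUI_eq {n : ℕ} (hn : 1 ≤ n) {Sq : Matrix (Fin d) (Fin d) ℝ} (hSq : Sq.PosDef)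
    {V : Matrix (Fin d) (Fin d) ℝ} (hV : V.PosDef) (Sp Sr : Matrix (Fin d) (Fin d) ℝ) (w : Vec d) :
    remBayesUI Sp Sq Sr V w n = -(dTr Sr Sp / 2) -
      (-(1 / 2) * (Real.log Sq.det - Real.log (V + (n : ℝ)⁻¹ • Sq).det) +
        ((n : ℝ)⁻¹ * dTr Sr (V + (n : ℝ)⁻¹ • Sq) - dTr Sr Sq) / 2) -
      (d : ℝ) / 2 * Real.log (2 * Real.pi) - 1 / 2 * quad (V + (n : ℝ)⁻¹ • Sq)⁻¹ w := by
  have hn0 : (n : ℝ) ≠ 0 := by positivity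
  have hSV : (Sq + (n : ℝ) • V).PosDef := hSq.add_posSemidef (hV.smul (by positivity)).posSemidef
  have hVSeq : V + (n : ℝ)⁻¹ • Sq = (n : ℝ)⁻¹ • (Sq + (n : ℝ) • V) := by
    rw [smul_add, smul_smul, inv_mul_cancel₀ hn0, one_smul, add_comm]
  have htr : (n : ℝ)⁻¹ * dTr Sr (V + (n : ℝ)⁻¹ • Sq) = dTr Sr (Sq + (n : ℝ) • V) := by
    rw [hVSeq, dTr, inv_inv_smul hn _ hSV, Matrix.mul_smul, Matrix.trace_smul, smul_eq_mul,
      inv_mul_cancel_left₀ hn0, dTr]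
  have hdet : Real.log (V + (n : ℝ)⁻¹ • Sq).det =
      -(d * Real.log n) + Real.log (Sq + (n : ℝ) • V).det := by
    rw [hVSeq, log_det_inv_smul hn hSV]
  rw [remBayesUI, covDiv_eq hSV hSq, htr, hdet, Real.log_div hn0 (by positivity)]
  ring

/-! ### E-powers of the individual e-variables -/

namespace HasMeanCov

variable {R : Measure (Vec d)} [IsProbabilityMeasure R] {m : Vec d}
  {Sr Sp Sq : Matrix (Fin d) (Fin d) ℝ} {n : ℕ}

lemma hasEPower_mle (h : HasMeanCov R m Sr) (hn : 1 ≤ n) {S : Matrix (Fin d) (Fin d) ℝ}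
    (hS : S.PosDef) :
    HasEPower (Measure.pi fun _ : Fin n => R) (fun u : Sample d n => gaussPDFn (mle u) S u)
      (-(n / 2) * (d * Real.log (2 * Real.pi) + Real.log S.det) - (n - 1) / 2 * dTr Sr S) := by
  have h1 := hasEPower_prod (R := Measure.pi fun _ : Fin n => R) Finset.univ
    fun i _ => hasEPower_gaussPDF hS (h.quad_sub_mle hn hS i)
  refine HasEPower.congr_val h1 ?_
  have hn0 : (n : ℝ) ≠ 0 := by positivity
  rw [Finset.sum_const, Finset.card_univ, Fintype.card_fin, nsmul_eq_mul, log_const_eq hS]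
  field_simp

lemma hasEPower_plugin (h : HasMeanCov R m Sr) (hn : 1 ≤ n) {S : Matrix (Fin d) (Fin d) ℝ}
    (hS : S.PosDef) (x₀ : Vec d) {n₀ : ℝ} (hn₀ : 0 < n₀) :
    HasEPower (Measure.pi fun _ : Fin n => R)
      (fun u : Sample d n => ∏ i, gaussPDF (plugin x₀ n₀ u i) S (u i))
      (-(n / 2) * (d * Real.log (2 * Real.pi) + Real.log S.det) - 1 / 2 * remA S n₀ (m - x₀) n -
        dTr Sr S / 2 * (n + (remB n₀ n + Real.log n))) := by
  have h1 := hasEPower_prod (R := Measure.pi fun _ : Fin n => R) Finset.univ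
    fun i _ => hasEPower_gaussPDF hS (h.quad_sub_plugin hS x₀ hn₀ i)
  refine HasEPower.congr_val h1 ?_
  have hA : ∑ i : Fin n, 1 / (1 + (i : ℝ) / n₀) ^ 2 * quad S⁻¹ (m - x₀) =
      remA S n₀ (m - x₀) n :=
    Fin.sum_univ_eq_sum_range (fun i : ℕ => 1 / (1 + (i : ℝ) / n₀) ^ 2 * quad S⁻¹ (m - x₀)) n
  have hB : ∑ i : Fin n, (i : ℝ) / (n₀ + (i : ℝ)) ^ 2 = remB n₀ n + Real.log n :=
    (Fin.sum_univ_eq_sum_range (fun i : ℕ => (i : ℝ) / (n₀ + (i : ℝ)) ^ 2) n).trans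
      (sum_div_sq_eq_remB n₀ hn)
  rw [← hA, ← hB, log_const_eq hS, Finset.sum_sub_distrib, ← Finset.sum_div,
    Finset.sum_add_distrib, ← Finset.sum_mul _ _ (dTr Sr S), Finset.sum_add_distrib]
  simp only [Finset.sum_const, Finset.card_univ, Fintype.card_fin, nsmul_eq_mul, mul_one]
  ring

lemma genKL_eq (h : HasMeanCov R m Sr) (hSp : Sp.PosDef) (hSq : Sq.PosDef) :
    Integrable (fun x => Real.log (gaussPDF m Sq x / gaussPDF m Sp x)) R ∧
      genKL R (gaussPDF m Sq) (gaussPDF m Sp) = covDiv Sr Sq Sp := by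
  have h1 := (hasEPower_gaussPDF (Y := fun _ => m) hSq (h.quad_sub hSq)).div
    (hasEPower_gaussPDF (Y := fun _ => m) hSp (h.quad_sub hSp))
  refine ⟨h1.2.1, h1.2.2.trans ?_⟩
  rw [log_const_eq hSp, log_const_eq hSq, covDiv_eq hSp hSq]
  ring

lemma hasEPower_pluginUI (h : HasMeanCov R m Sr) (hn : 1 ≤ n) (hSp : Sp.PosDef)
    (hSq : Sq.PosDef) (x₀ : Vec d) {n₀ : ℝ} (hn₀ : 0 < n₀) :
    HasEPower (Measure.pi fun _ : Fin n => R) (pluginUI Sp Sq x₀ n₀)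
      (n * covDiv Sr Sq Sp - dTr Sr Sq / 2 * Real.log n +
        remPluginUI Sp Sq Sr n₀ (m - x₀) n) := by
  have h1 := (h.hasEPower_plugin hn hSq x₀ hn₀).div (h.hasEPower_mle hn hSp)
  refine HasEPower.congr_val h1 ?_
  rw [remPluginUI, covDiv_eq hSp hSq]
  ring

lemma hasEPower_seq (h : HasMeanCov R m Sr) (hn : 1 ≤ n) (hSp : Sp.PosDef)
    (hSq : Sq.PosDef) (x₀ : Vec d) {n₀ : ℝ} (hn₀ : 0 < n₀) :
    HasEPower (Measure.pi fun _ : Fin n => R)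
      (fun u : Sample d n => ∏ i, gaussPDF (plugin x₀ n₀ u i) Sq (u i) /
        gaussPDF (plugin x₀ n₀ u i) Sp (u i))
      (n * covDiv Sr Sq Sp + (dTr Sr Sp - dTr Sr Sq) / 2 * Real.log n +
        remSeqRIPr Sp Sq Sr n₀ (m - x₀) n) := by
  simp_rw [Finset.prod_div_distrib]
  have h1 := (h.hasEPower_plugin hn hSq x₀ hn₀).div (h.hasEPower_plugin hn hSp x₀ hn₀)
  refine HasEPower.congr_val h1 ?_
  rw [remSeqRIPr, covDiv_eq hSp hSq]
  ring

/-- Removing the density of the mean removes one of the n log-determinants and so matches the n - 1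
in the trace term. The terms in π and in log n do not depend on S and cancel in `condRatio`. -/
lemma hasEPower_profile (h : HasMeanCov R m Sr) (hn : 1 ≤ n) {S : Matrix (Fin d) (Fin d) ℝ}
    (hS : S.PosDef) :
    HasEPower (Measure.pi fun _ : Fin n => R) (profile S : Sample d n → ℝ)
      (-(n / 2) * (d * Real.log (2 * Real.pi) + Real.log S.det) - (n - 1) / 2 * dTr Sr S +
        1 / 2 * (d * Real.log (2 * Real.pi) - d * Real.log n + Real.log S.det)) := by
  have hpos := gaussPDF_const_pos (posDef_inv_smul hn hS)
  have h1 := (h.hasEPower_mle hn hS).mul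
    (hasEPower_const (R := Measure.pi fun _ : Fin n => R) (Real.sqrt_pos.2 hpos))
  refine HasEPower.congr_val h1 ?_
  rw [Real.log_sqrt hpos.le, log_const_eq (posDef_inv_smul hn hS), log_det_inv_smul hn hS]
  ring

lemma hasEPower_condRatio (h : HasMeanCov R m Sr) (hn : 1 ≤ n) (hSp : Sp.PosDef)
    (hSq : Sq.PosDef) :
    HasEPower (Measure.pi fun _ : Fin n => R) (condRatio Sp Sq : Sample d n → ℝ)
      ((n - 1) * covDiv Sr Sq Sp) := by
  have h1 := (h.hasEPower_profile hn hSq).div (h.hasEPower_profile hn hSp)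
  refine HasEPower.congr_val h1 ?_
  rw [covDiv_eq hSp hSq]
  ring

lemma hasEPower_bayesUI (h : HasMeanCov R m Sr) (hn : 1 ≤ n) (hSp : Sp.PosDef)
    (hSq : Sq.PosDef) {V : Matrix (Fin d) (Fin d) ℝ} (hV : V.PosDef) (m₁ : Vec d) :
    HasEPower (Measure.pi fun _ : Fin n => R) (bayesUI Sp Sq (multivariateGaussian m₁ V))
      (n * covDiv Sr Sq Sp - (d : ℝ) / 2 * Real.log (n / (2 * Real.pi)) +
        remBayesUI Sp Sq Sr V (m - m₁) n) := by
  have hn0 : (n : ℝ) ≠ 0 := by positivity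
  have hVS : (V + (n : ℝ)⁻¹ • Sq).PosDef := hV.add_posSemidef (posDef_inv_smul hn hSq).posSemidef
  have h1 := ((h.hasEPower_profile hn hSq).mul (hasEPower_gaussPDF (Y := fun _ => m₁) hVS
    (h.quad_mle_sub hn hVS m₁))).div (h.hasEPower_mle hn hSp)
  have h2 : (fun u : Sample d n => profile Sq u * gaussPDF m₁ (V + (n : ℝ)⁻¹ • Sq) (mle u) /
      gaussPDFn (mle u) Sp u) = bayesUI Sp Sq (multivariateGaussian m₁ V) := by
    ext u
    rw [bayesUI, mixPDF_multivariateGaussian hn hSq hV.posSemidef]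
  simp_rw [gaussPDF_comm _ m₁] at h1 h2
  simp_rw [← gaussPDF_comm _ m₁] at h1 h2
  rw [h2] at h1
  refine HasEPower.congr_val h1 ?_
  have hl : Real.log (n / (2 * Real.pi)) = Real.log n - Real.log (2 * Real.pi) :=
    Real.log_div hn0 (by positivity)
  rw [remBayesUI_eq hn hSq hV, covDiv_eq hSp hSq, log_const_eq hVS, hl]
  ring

end HasMeanCov

/-! ### Asymptotics of the remainders -/

/-- These are partial sums of a series dominated by n₀²/i² for i ≥ 1, up to a constant factor. -/
lemma isBigO_remA (S : Matrix (Fin d) (Fin d) ℝ) {n₀ : ℝ} (hn₀ : 0 < n₀) (v : Vec d) :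
    remA S n₀ v =O[atTop] fun _ => (1 : ℝ) := by
  have hs : Summable fun i : ℕ => 1 / (1 + (i : ℝ) / n₀) ^ 2 * quad S⁻¹ v := by
    refine Summable.mul_right _ ?_
    have h1 : Summable fun i : ℕ => (n₀ ^ 2) * (1 / (i : ℝ) ^ 2) + if i = 0 then 1 else 0 :=
      ((Real.summable_one_div_nat_pow.2 (by norm_num)).mul_left _).add
        (summable_of_ne_finset_zero (s := {0}) fun b hb => by simpa using hb)
    refine Summable.of_nonneg_of_le (fun i => by positivity) (fun i => ?_) h1
    rcases Nat.eq_zero_or_pos i with rfl | hi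
    · simp
    · have hi0 : (0 : ℝ) < i := by exact_mod_cast hi
      rw [if_neg hi.ne', add_zero]
      have : n₀ ^ 2 * (1 / (i : ℝ) ^ 2) = 1 / ((i : ℝ) / n₀) ^ 2 := by field_simp
      rw [this]
      gcongr
      linarith
  exact hs.hasSum.tendsto_sum_nat.isBigO_one ℝ

/-- The term i = 0 contributes the default value 0⁻¹ = 0. -/
lemma sum_range_inv (n : ℕ) : ∑ i ∈ Finset.range n, (i : ℝ)⁻¹ = harmonic n - (n : ℝ)⁻¹ := by
  induction n with
  | zero => simp
  | succ k ih =>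
    rw [Finset.sum_range_succ, ih, harmonic_succ]
    push_cast
    ring

/-- The summands differ from 1/i by O(i⁻²), and the harmonic numbers minus log n converge to Euler's
constant. -/
lemma isBigO_remB {n₀ : ℝ} (hn₀ : 0 < n₀) : remB n₀ =O[atTop] fun _ => (1 : ℝ) := by
  have hs : Summable fun i : ℕ => (i : ℝ)⁻¹ - (i : ℝ) / (n₀ + i) ^ 2 := by
    have h1 : Summable fun i : ℕ => (2 * n₀ + n₀ ^ 2) * (1 / (i : ℝ) ^ 2) :=
      (Real.summable_one_div_nat_pow.2 (by norm_num)).mul_left _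
    have key : ∀ i : ℕ, 0 < i → (i : ℝ)⁻¹ - (i : ℝ) / (n₀ + i) ^ 2 =
        (2 * n₀ * i + n₀ ^ 2) / (i * (n₀ + i) ^ 2) := fun i hi => by
      have hi0 : (0 : ℝ) < i := by exact_mod_cast hi
      field_simp
      ring
    refine Summable.of_nonneg_of_le (fun i => ?_) (fun i => ?_) h1
    · rcases Nat.eq_zero_or_pos i with rfl | hi
      · simp
      · rw [key i hi]
        positivity
    · rcases Nat.eq_zero_or_pos i with rfl | hi
      · simp
      · have hi1 : (1 : ℝ) ≤ i := by exact_mod_cast hi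
        have hi0 : (0 : ℝ) < i := by linarith
        rw [key i hi, mul_one_div, div_le_div_iff₀ (by positivity) (by positivity)]
        have h2 : (2 * n₀ * i + n₀ ^ 2) ≤ (2 * n₀ + n₀ ^ 2) * i := by nlinarith [sq_nonneg n₀]
        have h3 : (i : ℝ) ^ 2 ≤ (n₀ + i) ^ 2 := by gcongr; linarith
        calc (2 * n₀ * i + n₀ ^ 2) * (i : ℝ) ^ 2
            ≤ ((2 * n₀ + n₀ ^ 2) * i) * (n₀ + i) ^ 2 := by gcongr
          _ = _ := by ring
  have h2 : Tendsto (fun n : ℕ => (harmonic n - Real.log n) - (n : ℝ)⁻¹ -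
      ∑ i ∈ Finset.range n, ((i : ℝ)⁻¹ - (i : ℝ) / (n₀ + i) ^ 2)) atTop (𝓝 _) :=
    (Real.tendsto_harmonic_sub_log.sub tendsto_inv_atTop_nhds_zero_nat).sub
      hs.hasSum.tendsto_sum_nat
  refine (h2.isBigO_one ℝ).congr' ?_ EventuallyEq.rfl
  filter_upwards [eventually_ge_atTop 1] with n hn
  rw [Finset.sum_sub_distrib, sum_range_inv, sum_div_sq_eq_remB n₀ hn]
  ring

lemma isBigO_remPluginUI (Sp Sq Sr : Matrix (Fin d) (Fin d) ℝ) {n₀ : ℝ} (hn₀ : 0 < n₀)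
    (v : Vec d) : remPluginUI Sp Sq Sr n₀ v =O[atTop] fun _ => (1 : ℝ) :=
  ((isBigO_const_const _ one_ne_zero _).sub ((isBigO_remA Sq hn₀ v).const_mul_left _)).sub
    ((isBigO_remB hn₀).const_mul_left _)

lemma isBigO_remSeqRIPr (Sp Sq Sr : Matrix (Fin d) (Fin d) ℝ) {n₀ : ℝ} (hn₀ : 0 < n₀)
    (v : Vec d) : remSeqRIPr Sp Sq Sr n₀ v =O[atTop] fun _ => (1 : ℝ) :=
  (((isBigO_remA Sp hn₀ v).sub (isBigO_remA Sq hn₀ v)).const_mul_left _).add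
    ((isBigO_remB hn₀).const_mul_left _)

lemma tendsto_remBayesUI {Sp Sq : Matrix (Fin d) (Fin d) ℝ} (hSq : Sq.PosDef)
    (Sr : Matrix (Fin d) (Fin d) ℝ) {V : Matrix (Fin d) (Fin d) ℝ} (hV : V.PosDef)
    (m m₁ : Vec d) :
    Tendsto (remBayesUI Sp Sq Sr V (m - m₁)) atTop
      (𝓝 ((dTr Sr Sq - dTr Sr Sp) / 2 + 1 / 2 * Real.log Sq.det
        + Real.log (gaussPDF m₁ V m))) := by
  have hinv : Tendsto (fun n : ℕ => (n : ℝ)⁻¹) atTop (𝓝 0) := tendsto_inv_atTop_nhds_zero_nat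
  have hM : Tendsto (fun n : ℕ => V + (n : ℝ)⁻¹ • Sq) atTop (𝓝 V) := by
    simpa using tendsto_const_nhds.add (hinv.smul_const Sq)
  have hdet : Tendsto (fun n : ℕ => (V + (n : ℝ)⁻¹ • Sq).det) atTop (𝓝 V.det) :=
    ((Continuous.matrix_det continuous_id).tendsto V).comp hM
  have hlog : Tendsto (fun n : ℕ => Real.log (V + (n : ℝ)⁻¹ • Sq).det) atTop
      (𝓝 (Real.log V.det)) := hdet.log hV.det_pos.ne'
  have hMinv : Tendsto (fun n : ℕ => (V + (n : ℝ)⁻¹ • Sq)⁻¹) atTop (𝓝 V⁻¹) := by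
    simp_rw [Matrix.inv_def, Ring.inverse_eq_inv']
    exact (hdet.inv₀ hV.det_pos.ne').smul
      (((Continuous.matrix_adjugate continuous_id).tendsto V).comp hM)
  have hquad : Tendsto (fun n : ℕ => quad (V + (n : ℝ)⁻¹ • Sq)⁻¹ (m - m₁)) atTop
      (𝓝 (quad V⁻¹ (m - m₁))) := by
    simp_rw [quad_eq_sum]
    exact tendsto_finsetSum _ fun i _ => tendsto_finsetSum _ fun j _ =>
      (((continuous_id.matrix_elem i j).tendsto V⁻¹).comp hMinv).mul_const _
  have htr : Tendsto (fun n : ℕ => (n : ℝ)⁻¹ * dTr Sr (V + (n : ℝ)⁻¹ • Sq)) atTop (𝓝 0) := by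
    have h1 : Tendsto (fun n : ℕ => dTr Sr (V + (n : ℝ)⁻¹ • Sq)) atTop (𝓝 (dTr Sr V)) :=
      ((Continuous.matrix_trace (continuous_const.matrix_mul continuous_id)).tendsto V⁻¹).comp
        hMinv
    simpa using hinv.mul h1
  have hlim : Tendsto (fun n : ℕ => -(dTr Sr Sp / 2) -
      (-(1 / 2) * (Real.log Sq.det - Real.log (V + (n : ℝ)⁻¹ • Sq).det) +
        ((n : ℝ)⁻¹ * dTr Sr (V + (n : ℝ)⁻¹ • Sq) - dTr Sr Sq) / 2) -
      (d : ℝ) / 2 * Real.log (2 * Real.pi) -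
      1 / 2 * quad (V + (n : ℝ)⁻¹ • Sq)⁻¹ (m - m₁)) atTop (𝓝 _) :=
    ((tendsto_const_nhds.sub (((tendsto_const_nhds.sub hlog).const_mul _).add
      ((htr.sub tendsto_const_nhds).div_const 2))).sub tendsto_const_nhds).sub
      (hquad.const_mul _)
  refine Tendsto.congr' ?_ (hlim.trans (le_of_eq (congrArg 𝓝 ?_)))
  · filter_upwards [eventually_ge_atTop 1] with n hn
    rw [remBayesUI_eq hn hSq hV]
  · rw [log_gaussPDF hV, log_const_eq hV]
    ring

end GaussE

namespace GaussE

variable {d : ℕ}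

/-! ### Conditional distributions given a sufficient statistic -/

section CondDistrib

variable {Ω 𝓧 : Type*} [MeasurableSpace Ω] [MeasurableSpace 𝓧] {X : Ω → 𝓧} {P : Measure Ω}
  [IsProbabilityMeasure P] {κ : Kernel 𝓧 Ω} [IsMarkovKernel κ]

lemma lintegral_hasCondDistrib (h : HasCondDistrib id X κ P) (hX : Measurable X)
    {F : 𝓧 × Ω → ℝ≥0∞} (hF : Measurable F) :
    ∫⁻ ω, F (X ω, ω) ∂P = ∫⁻ z, ∫⁻ u, F (z, u) ∂κ z ∂(P.map X) := by
  have : IsProbabilityMeasure (P.map X) := Measure.isProbabilityMeasure_map hX.aemeasurable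
  rw [← Measure.lintegral_compProd hF, ← HasLaw.map_eq h,
    lintegral_map hF (hX.prodMk measurable_id)]
  rfl

/-- Reweighting by the product of a function of the conditioning variable and a function `g`
reweights the conditional distribution by `g`. -/
lemma hasCondDistrib_withDensity (h : HasCondDistrib id X κ P) (hX : Measurable X)
    {κ' : Kernel 𝓧 Ω} [IsMarkovKernel κ'] {g : Ω → ℝ≥0∞} (hg : Measurable g)
    {k : 𝓧 → ℝ≥0∞} (hk : Measurable k)
    (hκ' : ∀ᵐ z ∂(P.map X), κ' z = (κ z).withDensity g)
    [hQ : IsProbabilityMeasure (P.withDensity fun ω => k (X ω) * g ω)] :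
    HasCondDistrib id X κ' (P.withDensity fun ω => k (X ω) * g ω) := by
  set Q := P.withDensity fun ω => k (X ω) * g ω with hQdef
  have : IsProbabilityMeasure (Q.map X) := Measure.isProbabilityMeasure_map hX.aemeasurable
  have hw : Measurable fun ω => k (X ω) * g ω := (hk.comp hX).mul hg
  -- Disintegrate under P: the weight k is constant on fibres and leaves the inner integral, while g
  -- is absorbed into the new kernel.
  have key : ∀ F : 𝓧 × Ω → ℝ≥0∞, Measurable F →
      ∫⁻ ω, F (X ω, ω) ∂Q = ∫⁻ z, k z * ∫⁻ u, F (z, u) ∂κ' z ∂(P.map X) := fun F hF => by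
    rw [hQdef, lintegral_withDensity_eq_lintegral_mul _ hw
      (show Measurable fun ω => F (X ω, ω) from hF.comp (hX.prodMk measurable_id))]
    have hF' : Measurable fun p : 𝓧 × Ω => k p.1 * (g p.2 * F p) := by fun_prop
    calc ∫⁻ ω, ((fun ω => k (X ω) * g ω) * fun ω => F (X ω, ω)) ω ∂P
        = ∫⁻ ω, (fun p : 𝓧 × Ω => k p.1 * (g p.2 * F p)) (X ω, ω) ∂P := by
          simp only [Pi.mul_apply, mul_assoc]
      _ = _ := by
          rw [lintegral_hasCondDistrib h hX hF']
          refine lintegral_congr_ae (hκ'.mono fun z hz => ?_)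
          have hFz : Measurable fun u => F (z, u) := hF.comp measurable_prodMk_left
          simp only
          rw [lintegral_const_mul _ (show Measurable fun u => g u * F (z, u) from hg.mul hFz), hz,
            lintegral_withDensity_eq_lintegral_mul _ hg hFz]
          rfl
  have hmeas : Measurable fun ω => (X ω, id ω) := hX.prodMk measurable_id
  refine ⟨hmeas.aemeasurable, ?_⟩
  ext s hs
  have hind : Measurable (s.indicator (1 : 𝓧 × Ω → ℝ≥0∞)) := measurable_one.indicator hs
  rw [← lintegral_indicator_one hs, ← lintegral_indicator_one hs, lintegral_map hind hmeas,
    Measure.lintegral_compProd hind]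
  have hin : Measurable fun z => ∫⁻ u, s.indicator 1 (z, u) ∂κ' z :=
    hind.lintegral_kernel_prod_right'
  rw [lintegral_map hin hX]
  -- Use `key` a second time for a function of the conditioning variable alone, on which the Markov
  -- kernel acts trivially.
  refine (key _ hind).trans (Eq.symm ((key (fun p => ∫⁻ u, s.indicator 1 (p.1, u) ∂κ' p.1)
    (hin.comp measurable_fst)).trans ?_))
  simp

end CondDistrib

lemma mle_eq_smul_suffStat {n : ℕ} (u : Sample d n) : mle u = (Real.sqrt n)⁻¹ • suffStat u := by
  rw [mle, suffStat, smul_smul, ← mul_inv, Real.mul_self_sqrt (Nat.cast_nonneg n)]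

/-! ### Conditional laws of Gaussian samples given the sufficient statistic -/

section GaussCond

variable {n : ℕ} {Sp Sq : Matrix (Fin d) (Fin d) ℝ}

/-- Every Gaussian sampling law is a reweighting of another one by the product of a function of
the sufficient statistic and the ratio of the conditional densities. -/
lemma exists_gaussLaw_eq_withDensity (hn : 1 ≤ n) (hSp : Sp.PosDef) (hSq : Sq.PosDef)
    (m m' : Vec d) :
    ∃ k : Vec d → ℝ≥0∞, Measurable k ∧ gaussLaw n m' Sq = (gaussLaw n m Sp).withDensity
      fun u => k (suffStat u) * ENNReal.ofReal (condRatio Sp Sq u) := by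
  have hp := posDef_inv_smul hn hSp
  have hq := posDef_inv_smul hn hSq
  have hk : Continuous fun z : Vec d =>
      gaussPDF m' ((n : ℝ)⁻¹ • Sq) ((Real.sqrt n)⁻¹ • z) /
        gaussPDF m ((n : ℝ)⁻¹ • Sp) ((Real.sqrt n)⁻¹ • z) :=
    (continuous_gaussPDF _ continuous_const (by fun_prop)).div
      (continuous_gaussPDF _ continuous_const (by fun_prop)) fun z => (gaussPDF_pos hp _ _).ne'
  refine ⟨fun z => ENNReal.ofReal _, hk.measurable.ennreal_ofReal, ?_⟩
  have hg := (continuous_condRatio hn hSp Sq).measurable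
  rw [gaussLaw_eq_withDensity hSq, gaussLaw_eq_withDensity hSp, ← withDensity_mul]
  · congr 1
    ext u
    have h1 := profile_pos hn hSp u
    have h2 := gaussPDF_pos hp m (mle u)
    have := gaussPDF_pos hq m' (mle u)
    rw [Pi.mul_apply, ← ENNReal.ofReal_mul (by rw [← mle_eq_smul_suffStat]; positivity),
      ← ENNReal.ofReal_mul (gaussPDFn_pos hSp _ _).le, gaussPDFn_eq_profile_mul hn hSp,
      gaussPDFn_eq_profile_mul hn hSq, ← mle_eq_smul_suffStat, condRatio]
    have key : ∀ {a b c e : ℝ}, 0 < a → 0 < b → c * e = a * b * (e / b * (c / a)) := by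
      intro a b c e ha hb
      field_simp
    exact congrArg ENNReal.ofReal (key h1 h2)
  · exact (continuous_gaussPDFn Sp continuous_const continuous_id).measurable.ennreal_ofReal
  · exact (hk.measurable.comp continuous_suffStat.measurable).ennreal_ofReal.mul hg.ennreal_ofReal

/-- Exchange the profiles by `lintegral_profile_mul`. Tested on indicators, this shows that
`condRatio` has conditional mean one, hence that reweighting by it yields a probability kernel. -/
lemma lintegral_condRatio_mul (hn : 1 ≤ n) (hSp : Sp.PosDef) (hSq : Sq.PosDef)
    {k : Vec d → ℝ≥0∞} (hk : Measurable k) :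
    ∫⁻ u, ENNReal.ofReal (condRatio Sp Sq u) * k (suffStat u) ∂gaussLaw n 0 Sp =
      ∫⁻ u, k (suffStat u) ∂gaussLaw n 0 Sp := by
  have hp := posDef_inv_smul hn hSp
  have hn0 : (Real.sqrt n) ≠ 0 := (Real.sqrt_pos.2 (by positivity)).ne'
  have hs : ∀ u : Sample d n, suffStat u = Real.sqrt n • mle u := fun u => by
    rw [mle_eq_smul_suffStat, smul_smul, mul_inv_cancel₀ hn0, one_smul]
  have hg := (continuous_condRatio (n := n) hn hSp Sq).measurable.ennreal_ofReal
  have hd : Measurable fun u : Sample d n => ENNReal.ofReal (gaussPDFn 0 Sp u) :=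
    (continuous_gaussPDFn Sp continuous_const continuous_id).measurable.ennreal_ofReal
  have hks : Measurable fun u : Sample d n => k (suffStat u) :=
    hk.comp continuous_suffStat.measurable
  set l : Vec d → ℝ≥0∞ := fun z =>
    ENNReal.ofReal (gaussPDF 0 ((n : ℝ)⁻¹ • Sp) z) * k (Real.sqrt n • z) with hl
  have hlm : Measurable l :=
    (continuous_gaussPDF _ continuous_const continuous_id).measurable.ennreal_ofReal.mul
      (hk.comp (by fun_prop))
  rw [gaussLaw_eq_withDensity hSp, lintegral_withDensity_eq_lintegral_mul _ hd
      (show Measurable fun u : Sample d n => ENNReal.ofReal (condRatio Sp Sq u) * k (suffStat u) from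
        hg.mul hks),
    lintegral_withDensity_eq_lintegral_mul _ hd hks]
  refine Eq.trans ?_ ((lintegral_profile_mul hn hSq hlm).trans
    ((lintegral_profile_mul hn hSp hlm).symm.trans ?_))
  · refine lintegral_congr fun u => ?_
    have h1 := profile_pos hn hSp u
    simp only [Pi.mul_apply, hl]
    rw [← mul_assoc, ← mul_assoc, ← ENNReal.ofReal_mul (gaussPDFn_pos hSp _ _).le,
      ← ENNReal.ofReal_mul (profile_pos hn hSq u).le, hs, gaussPDFn_eq_profile_mul hn hSp,
      condRatio]
    congr 2
    field_simp
  · refine lintegral_congr fun u => ?_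
    simp only [Pi.mul_apply, hl]
    rw [← mul_assoc, ← ENNReal.ofReal_mul (profile_pos hn hSp u).le, hs,
      gaussPDFn_eq_profile_mul hn hSp]

lemma lintegral_condRatio_kernel (hn : 1 ≤ n) (hSp : Sp.PosDef) (hSq : Sq.PosDef)
    {κ : Kernel (Vec d) (Sample d n)} [IsMarkovKernel κ]
    (h : HasCondDistrib id suffStat κ (gaussLaw n 0 Sp)) :
    ∀ᵐ z ∂((gaussLaw n 0 Sp).map suffStat),
      ∫⁻ u, ENNReal.ofReal (condRatio Sp Sq u) ∂κ z = 1 := by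
  have hZ : Measurable (suffStat : Sample d n → Vec d) := continuous_suffStat.measurable
  have hg := (continuous_condRatio (n := n) hn hSp Sq).measurable.ennreal_ofReal
  have : IsProbabilityMeasure ((gaussLaw n 0 Sp).map suffStat) :=
    Measure.isProbabilityMeasure_map hZ.aemeasurable
  refine ae_eq_of_forall_setLIntegral_eq_of_sigmaFinite hg.lintegral_kernel measurable_const
    fun s hs _ => ?_
  have hk : Measurable (s.indicator (1 : Vec d → ℝ≥0∞)) := measurable_one.indicator hs
  have h1 := lintegral_hasCondDistrib h hZ
    (F := fun p => ENNReal.ofReal (condRatio Sp Sq p.2) * s.indicator 1 p.1)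
    ((hg.comp measurable_snd).mul (hk.comp measurable_fst))
  simp only [lintegral_condRatio_mul hn hSp hSq hk] at h1
  rw [← lintegral_indicator hs, ← lintegral_indicator hs]
  refine Eq.trans ?_ (h1.symm.trans ?_)
  · refine lintegral_congr fun z => ?_
    rw [lintegral_mul_const _ hg]
    by_cases hz : z ∈ s <;> simp [hz]
  · rw [lintegral_map (measurable_const.indicator hs) hZ]
    rfl

/-- Regular conditional distributions of the sample given the sufficient statistic, for both
families, one of which is a reweighting of the other by `condRatio`. -/
lemma exists_condKernels (hn : 1 ≤ n) (hSp : Sp.PosDef) (hSq : Sq.PosDef) :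
    ∃ (κp κq : Kernel (Vec d) (Sample d n)) (s : Set (Vec d)),
      IsMarkovKernel κp ∧ IsMarkovKernel κq ∧ MeasurableSet s ∧
      (∀ m, HasCondDistrib id suffStat κp (gaussLaw n m Sp)) ∧
      (∀ m, HasCondDistrib id suffStat κq (gaussLaw n m Sq)) ∧
      (∀ᵐ z ∂((gaussLaw n 0 Sp).map suffStat), z ∈ s) ∧
      (∀ z ∈ s, κq z = (κp z).withDensity fun u => ENNReal.ofReal (condRatio Sp Sq u)) ∧
      ∀ z, z ∉ s → κq z = κp z := by
  classical
  have hZ : Measurable (suffStat : Sample d n → Vec d) := continuous_suffStat.measurable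
  have hg := (continuous_condRatio (n := n) hn hSp Sq).measurable.ennreal_ofReal
  have hg2 : Measurable (Function.uncurry fun (_ : Vec d) (u : Sample d n) =>
      ENNReal.ofReal (condRatio Sp Sq u)) := hg.comp measurable_snd
  set κ := condDistrib (id : Sample d n → Sample d n) suffStat (gaussLaw n 0 Sp) with hκ
  have h0 : HasCondDistrib id suffStat κ (gaussLaw n 0 Sp) :=
    ⟨(hZ.prodMk measurable_id).aemeasurable,
      (compProd_map_condDistrib measurable_id.aemeasurable).symm⟩
  -- The reweighted kernel is normalized only almost everywhere; off this set the original kernel is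
  -- kept, so that the result is Markov at every point.
  set s : Set (Vec d) := {z | ∫⁻ u, ENNReal.ofReal (condRatio Sp Sq u) ∂κ z = 1}
  have hs : MeasurableSet s := hg.lintegral_kernel (measurableSet_singleton _)
  have hsae := lintegral_condRatio_kernel hn hSp hSq h0
  set κq : Kernel (Vec d) (Sample d n) := Kernel.piecewise hs
    (Kernel.withDensity κ fun _ u => ENNReal.ofReal (condRatio Sp Sq u)) κ with hκq
  have hκq1 : ∀ z ∈ s, κq z = (κ z).withDensity fun u => ENNReal.ofReal (condRatio Sp Sq u) :=
    fun z hz => by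
      rw [hκq, Kernel.piecewise_apply, if_pos hz, Kernel.withDensity_apply _ hg2]
  have hκq2 : ∀ z, z ∉ s → κq z = κ z := fun z hz => by
    rw [hκq, Kernel.piecewise_apply, if_neg hz]
  have hM : IsMarkovKernel κq := ⟨fun z => by
    by_cases hz : z ∈ s
    · refine ⟨?_⟩
      rw [hκq1 z hz, withDensity_apply _ MeasurableSet.univ, Measure.restrict_univ]
      exact hz
    · rw [hκq2 z hz]
      infer_instance⟩
  refine ⟨κ, κq, s, inferInstance, hM, hs, fun m => ?_, fun m => ?_, hsae, hκq1, hκq2⟩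
  -- With both covariances equal the ratio is 1: changing the mean reweights by a function of the
  -- statistic only, and the kernel is unchanged.
  · obtain ⟨k, hk, he⟩ := exists_gaussLaw_eq_withDensity hn hSp hSp 0 m
    have h1 : ∀ u : Sample d n, ENNReal.ofReal (condRatio Sp Sp u) = (1 : Sample d n → ℝ≥0∞) u :=
      fun u => by simp [condRatio, div_self (profile_pos hn hSp u).ne']
    simp_rw [h1] at he
    have : IsProbabilityMeasure ((gaussLaw n 0 Sp).withDensity fun u =>
      k (suffStat u) * (1 : Sample d n → ℝ≥0∞) u) := by rw [← he]; infer_instance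
    rw [he]
    exact hasCondDistrib_withDensity h0 hZ measurable_one hk
      (Eventually.of_forall fun z => withDensity_one.symm)
  · obtain ⟨k, hk, he⟩ := exists_gaussLaw_eq_withDensity hn hSp hSq 0 m
    have : IsProbabilityMeasure ((gaussLaw n 0 Sp).withDensity fun u =>
      k (suffStat u) * ENNReal.ofReal (condRatio Sp Sq u)) := by rw [← he]; infer_instance
    rw [he]
    exact hasCondDistrib_withDensity h0 hZ hg hk (hsae.mono hκq1)

lemma exists_isCond (hn : 1 ≤ n) (hSp : Sp.PosDef) (hSq : Sq.PosDef) :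
    ∃ S : Sample d n → ℝ, IsCond Sp Sq S := by
  classical
  obtain ⟨κp, κq, s, hMp, hMq, hs, hp, hq, -, h1, h2⟩ := exists_condKernels hn hSp hSq
  have hg := (continuous_condRatio (n := n) hn hSp Sq).measurable
  -- The null kernel serves as the common reference measure, so its own density is 1.
  set q : Vec d → Sample d n → ℝ := fun z u => if z ∈ s then condRatio Sp Sq u else 1 with hqdef
  refine ⟨_, κp, κq, κp, fun _ _ => 1, q, hMp, hMq, hp, hq, measurable_const, ?_,
    fun _ _ => zero_le_one, fun z u => ?_, fun z => by simp, fun z => ?_, fun u => rfl⟩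
  · exact Measurable.ite (hs.preimage measurable_fst) (hg.comp measurable_snd) measurable_const
  · simp only [hqdef]
    split_ifs
    exacts [(condRatio_pos hn hSp hSq u).le, zero_le_one]
  · by_cases hz : z ∈ s
    · simp only [hqdef, if_pos hz, h1 z hz]
    · simp [hqdef, if_neg hz, h2 z hz]

lemma gaussLaw_absolutelyContinuous (hSp : Sp.PosDef) (hSq : Sq.PosDef) (m m' : Vec d) :
    gaussLaw n m Sp ≪ gaussLaw n m' Sq := by
  have hd : Measurable fun u : Sample d n => ENNReal.ofReal (gaussPDFn m' Sq u) :=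
    (continuous_gaussPDFn Sq continuous_const continuous_id).measurable.ennreal_ofReal
  rw [gaussLaw_eq_withDensity hSp, gaussLaw_eq_withDensity hSq]
  exact (withDensity_absolutelyContinuous _ _).trans
    (withDensity_absolutelyContinuous' hd.aemeasurable
      (Eventually.of_forall fun u => by simpa using gaussPDFn_pos hSq m' u))

lemma volume_absolutelyContinuous_gaussLaw (hSp : Sp.PosDef) (m : Vec d) :
    (volume : Measure (Sample d n)) ≪ gaussLaw n m Sp := by
  have hd : Measurable fun u : Sample d n => ENNReal.ofReal (gaussPDFn m Sp u) :=
    (continuous_gaussPDFn Sp continuous_const continuous_id).measurable.ennreal_ofReal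
  rw [gaussLaw_eq_withDensity hSp]
  exact withDensity_absolutelyContinuous' hd.aemeasurable
    (Eventually.of_forall fun u => by simpa using gaussPDFn_pos hSp m u)

lemma kernel_ae_eq_of_hasCondDistrib {Ω 𝓧 : Type*} [MeasurableSpace Ω] [StandardBorelSpace Ω]
    [Nonempty Ω] [MeasurableSpace 𝓧] {X : Ω → 𝓧} {P : Measure Ω} [IsProbabilityMeasure P]
    {κ κ' : Kernel 𝓧 Ω} [IsMarkovKernel κ] [IsMarkovKernel κ']
    (h : HasCondDistrib id X κ P) (h' : HasCondDistrib id X κ' P) : κ =ᵐ[P.map X] κ' :=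
  (condDistrib_ae_eq_of_measure_eq_compProd X aemeasurable_id (HasLaw.map_eq h)).symm.trans
    (condDistrib_ae_eq_of_measure_eq_compProd X aemeasurable_id (HasLaw.map_eq h'))

/-- Finite total mass suffices to identify densities over an arbitrary reference measure; the zeros
of p, where the quotient is meaningless, are null for the measure in the conclusion. -/
lemma div_ae_eq_of_withDensity_eq {Ω : Type*} [MeasurableSpace Ω] {ν : Measure Ω} {p q g : Ω → ℝ}
    (hp : Measurable p) (hq : Measurable q) (hg : Measurable g) (hp0 : ∀ u, 0 ≤ p u)
    (hq0 : ∀ u, 0 ≤ q u) (hg0 : ∀ u, 0 ≤ g u)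
    [hfin : IsFiniteMeasure (ν.withDensity fun u => ENNReal.ofReal (q u))]
    (h : (ν.withDensity fun u => ENNReal.ofReal (q u)) =
      (ν.withDensity fun u => ENNReal.ofReal (p u)).withDensity fun u => ENNReal.ofReal (g u)) :
    ∀ᵐ u ∂(ν.withDensity fun u => ENNReal.ofReal (p u)), q u / p u = g u := by
  rw [← withDensity_mul _ hp.ennreal_ofReal hg.ennreal_ofReal, withDensity_eq_iff
    hq.ennreal_ofReal.aemeasurable (hp.ennreal_ofReal.mul hg.ennreal_ofReal).aemeasurable] at h
  · rw [ae_withDensity_iff hp.ennreal_ofReal]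
    filter_upwards [h] with u hu hpu
    have hpos : 0 < p u := by simpa using hpu
    rw [Pi.mul_apply, ← ENNReal.ofReal_mul (hp0 u),
      ENNReal.ofReal_eq_ofReal_iff (hq0 u) (mul_nonneg (hp0 u) (hg0 u))] at hu
    rw [hu, mul_div_cancel_left₀ _ hpos.ne']
  · have := measure_ne_top (ν.withDensity fun u => ENNReal.ofReal (q u)) Set.univ
    rwa [withDensity_apply _ MeasurableSet.univ, Measure.restrict_univ] at this

/-- Regular conditional distributions are unique for almost every value of the statistic, so any
version's kernels agree with those of `exists_condKernels`. The two Gaussian families have the same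
null sets, which lets both exceptional sets be discarded together. -/
lemma IsCond.ae_eq (hn : 1 ≤ n) (hSp : Sp.PosDef) (hSq : Sq.PosDef) {S : Sample d n → ℝ}
    (hS : IsCond Sp Sq S) : S =ᵐ[volume] condRatio Sp Sq := by
  obtain ⟨κp, κq, ν, p, q, hMp, hMq, hp, hq, hpm, hqm, hp0, hq0, hpd, hqd, hSe⟩ := hS
  obtain ⟨κp', κq', s, hMp', hMq', hs, hp', hq', hsae, h1, -⟩ := exists_condKernels hn hSp hSq
  have hZ : Measurable (suffStat : Sample d n → Vec d) := continuous_suffStat.measurable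
  have hg := (continuous_condRatio (n := n) hn hSp Sq).measurable
  have hP : IsProbabilityMeasure ((gaussLaw n 0 Sp).map suffStat) :=
    Measure.isProbabilityMeasure_map hZ.aemeasurable
  have hac : (gaussLaw n 0 Sp).map suffStat ≪ (gaussLaw n 0 Sq).map suffStat :=
    (gaussLaw_absolutelyContinuous hSp hSq 0 0).map hZ
  have hz : ∀ᵐ z ∂((gaussLaw n 0 Sp).map suffStat), ∀ᵐ u ∂κp z,
      q z u / p z u = condRatio Sp Sq u := by
    filter_upwards [kernel_ae_eq_of_hasCondDistrib (hp 0) (hp' 0),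
      hac.ae_le (kernel_ae_eq_of_hasCondDistrib (hq 0) (hq' 0)), hsae] with z hz1 hz2 hz3
    have hfin : IsFiniteMeasure ((ν z).withDensity fun u => ENNReal.ofReal (q z u)) := by
      rw [← hqd]; infer_instance
    rw [hpd]
    refine div_ae_eq_of_withDensity_eq (hpm.comp measurable_prodMk_left)
      (hqm.comp measurable_prodMk_left) hg (hp0 z) (hq0 z)
      (fun u => (condRatio_pos hn hSp hSq u).le) ?_
    rw [← hqd, ← hpd, hz2, hz1, h1 z hz3]
  have hmeas : MeasurableSet {x : Vec d × Sample d n | q x.1 x.2 / p x.1 x.2 =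
      condRatio Sp Sq x.2} := measurableSet_eq_fun (hqm.div hpm) (hg.comp measurable_snd)
  -- The joint law of statistic and sample turns fibrewise statements into one about almost every
  -- sample.
  have hc := (Measure.ae_compProd_iff (κ := κp) hmeas).2 hz
  rw [← HasLaw.map_eq (hp 0), ae_map_iff (hZ.prodMk measurable_id).aemeasurable hmeas] at hc
  filter_upwards [(volume_absolutelyContinuous_gaussLaw hSp 0).ae_le hc] with u hu
  rw [hSe]
  exact hu

end GaussCond

end GaussE

namespace GaussE

variable {d : ℕ}

/-! ### Versions of the e-variables -/

/-- Either Lebesgue-null sets are null for the product of R, or two continuous functions that agree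
almost everywhere agree everywhere. -/
lemma HasEPower.of_ae_eq_volume {n : ℕ} {R : Measure (Vec d)} [IsProbabilityMeasure R]
    {S T : Sample d n → ℝ} {c : ℝ} (hT : HasEPower (Measure.pi fun _ : Fin n => R) T c)
    (hTc : Continuous T) (hST : S =ᵐ[volume] T) (hS : R ≪ volume ∨ Continuous S) :
    HasEPower (Measure.pi fun _ : Fin n => R) S c := by
  rcases hS with hR | hS
  · exact hT.congr_ae ((pi_absolutelyContinuous hR).ae_le hST.symm)
  · rwa [(hS.ae_eq_iff_eq volume hTc).1 hST]

/-- Fubini with the i-th coordinate innermost: T ignores that coordinate, so the parameter is frozen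
and the hypothesis applies on each fibre. In this way the exceptional null sets, which vary with the
parameter, combine into one null set. -/
lemma ae_eq_comp_eval {n : ℕ} {Y : Type*} [MeasurableSpace Y] {f g : Y → Vec d → ℝ}
    (hf : Measurable (Function.uncurry f)) (hg : Measurable (Function.uncurry g))
    (hfg : ∀ y, f y =ᵐ[volume] g y) (i : Fin n) {T : Sample d n → Y} (hT : Measurable T)
    (hTi : ∀ u x, T (Function.update u i x) = T u) :
    ∀ᵐ u : Sample d n, f (T u) (u i) = g (T u) (u i) := by
  obtain ⟨k, rfl⟩ : ∃ k, n = k + 1 := ⟨n - 1, by have := i.pos; omega⟩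
  have he := (volume_preserving_piFinSuccAbove (fun _ : Fin (k + 1) => Vec d) i).symm
  have hm : MeasurableSet {u : Sample d (k + 1) | f (T u) (u i) = g (T u) (u i)} :=
    measurableSet_eq_fun (hf.comp (hT.prodMk (measurable_pi_apply i)))
      (hg.comp (hT.prodMk (measurable_pi_apply i)))
  rw [← he.map_eq, ae_map_iff he.measurable.aemeasurable hm]
  have hm2 := he.measurable hm
  refine (Measure.ae_prod_iff_ae_ae hm2).2 ((Measure.ae_ae_comm (p := fun x y =>
    (MeasurableEquiv.piFinSuccAbove (fun _ : Fin (k + 1) => Vec d) i).symm (x, y) ∈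
      {u : Sample d (k + 1) | f (T u) (u i) = g (T u) (u i)}) hm2).2 (Eventually.of_forall fun y => ?_))
  filter_upwards [hfg (T (i.insertNth 0 y))] with x hx
  have h1 : T (i.insertNth x y) = T (i.insertNth 0 y) := by
    rw [← hTi (i.insertNth 0 y) x, Fin.update_insertNth]
  change f (T (i.insertNth x y)) (i.insertNth (α := fun _ => Vec d) x y i) =
    g (T (i.insertNth x y)) (i.insertNth (α := fun _ => Vec d) x y i)
  rw [h1, Fin.insertNth_apply_same]
  exact hx

lemma continuous_plugin {n : ℕ} (x₀ : Vec d) (n₀ : ℝ) (i : Fin n) :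
    Continuous fun u : Sample d n => plugin x₀ n₀ u i := by
  unfold plugin; fun_prop

lemma plugin_update {n : ℕ} (x₀ : Vec d) (n₀ : ℝ) (i : Fin n) (u : Sample d n) (x : Vec d) :
    plugin x₀ n₀ (Function.update u i x) i = plugin x₀ n₀ u i := by
  have h : ∑ j ∈ Finset.Iio i, Function.update u i x j = ∑ j ∈ Finset.Iio i, u j :=
    Finset.sum_congr rfl fun j hj =>
      Function.update_of_ne (Finset.mem_Iio.1 hj).ne _ _
  rw [plugin, plugin, h]

lemma IsSeqRIPr.ae_eq {n : ℕ} {Sp Sq S₀ : Matrix (Fin d) (Fin d) ℝ} (hSq : Sq.PosDef)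
    (h₀ : ∀ m, IsRIPr (multivariateGaussian m Sq) (family Sp) (gaussPDF m S₀))
    {x₀ : Vec d} {n₀ : ℝ} {S : Sample d n → ℝ} (hS : IsSeqRIPr Sp Sq x₀ n₀ S) :
    S =ᵐ[volume] fun u => ∏ i, gaussPDF (plugin x₀ n₀ u i) Sq (u i) /
      gaussPDF (plugin x₀ n₀ u i) S₀ (u i) := by
  obtain ⟨ρ, hρ, hr, hSe⟩ := hS
  have h1 : ∀ i : Fin n, ∀ᵐ u : Sample d n, ρ (plugin x₀ n₀ u i) (u i) =
      gaussPDF (plugin x₀ n₀ u i) S₀ (u i) := fun i =>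
    ae_eq_comp_eval hρ (g := fun m x => gaussPDF m S₀ x) (measurable_gaussPDF_uncurry S₀)
      (fun m => (volume_absolutelyContinuous_multivariateGaussian hSq m).ae_le
        ((hr m).ae_eq (h₀ m))) i (continuous_plugin x₀ n₀ i).measurable
      (plugin_update x₀ n₀ i)
  filter_upwards [ae_all_iff.2 h1] with u hu
  rw [hSe]
  exact Finset.prod_congr rfl fun i _ => by rw [hu i]

lemma isSeqRIPr_gauss {n : ℕ} {Sp Sq S₀ : Matrix (Fin d) (Fin d) ℝ}
    (h₀ : ∀ m, IsRIPr (multivariateGaussian m Sq) (family Sp) (gaussPDF m S₀))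
    (x₀ : Vec d) (n₀ : ℝ) :
    IsSeqRIPr Sp Sq x₀ n₀ fun u : Sample d n => ∏ i, gaussPDF (plugin x₀ n₀ u i) Sq (u i) /
      gaussPDF (plugin x₀ n₀ u i) S₀ (u i) :=
  ⟨fun m x => gaussPDF m S₀ x, measurable_gaussPDF_uncurry S₀, h₀, fun _ => rfl⟩

lemma continuous_seq {n : ℕ} {Sp : Matrix (Fin d) (Fin d) ℝ} (hSp : Sp.PosDef)
    (Sq : Matrix (Fin d) (Fin d) ℝ) (x₀ : Vec d) (n₀ : ℝ) :
    Continuous fun u : Sample d n => ∏ i, gaussPDF (plugin x₀ n₀ u i) Sq (u i) /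
      gaussPDF (plugin x₀ n₀ u i) Sp (u i) :=
  continuous_finsetProd _ fun i _ =>
    (continuous_gaussPDF Sq (continuous_plugin x₀ n₀ i) (continuous_apply i)).div
      (continuous_gaussPDF Sp (continuous_plugin x₀ n₀ i) (continuous_apply i))
      fun _ => (gaussPDF_pos hSp _ _).ne'

/-! ### Versions of the projection of a Bayes marginal -/

section BayesRIPr

variable {n : ℕ} {Sp Sq V : Matrix (Fin d) (Fin d) ℝ}

lemma ae_eq_of_isRIPr_mixLaw (hn : 1 ≤ n) (hSp : Sp.PosDef) (hSq : Sq.PosDef) (hV : V.PosDef)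
    (hV₀ : (V + (n : ℝ)⁻¹ • (Sq - Sp)).PosSemidef) (m₁ : Vec d) {ρ : Sample d n → ℝ}
    (hρ : IsRIPr (mixLaw n (multivariateGaussian m₁ V) Sq) (familyN n Sp) ρ) :
    ρ =ᵐ[volume] mixPDF (multivariateGaussian m₁ (V + (n : ℝ)⁻¹ • (Sq - Sp))) Sp :=
  (volume_absolutelyContinuous_mixLaw hSq n _).ae_le
    (hρ.ae_eq (isRIPr_mixLaw hn hSp hSq hV hV₀ m₁))

lemma IsBayesRIPr.ae_eq (hn : 1 ≤ n) (hSp : Sp.PosDef) (hSq : Sq.PosDef) (hV : V.PosDef)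
    (hV₀ : (V + (n : ℝ)⁻¹ • (Sq - Sp)).PosSemidef) {m₁ : Vec d} {S : Sample d n → ℝ}
    (hS : IsBayesRIPr Sp Sq (multivariateGaussian m₁ V) S) :
    S =ᵐ[volume] fun u => mixPDF (multivariateGaussian m₁ V) Sq u /
      mixPDF (multivariateGaussian m₁ (V + (n : ℝ)⁻¹ • (Sq - Sp))) Sp u := by
  obtain ⟨ρ, hρ, hSe⟩ := hS
  filter_upwards [ae_eq_of_isRIPr_mixLaw hn hSp hSq hV hV₀ m₁ hρ] with u hu
  rw [hSe, hu]

lemma IsBayesRIPr.measurable (hSq : Sq.PosDef) {W : Measure (Vec d)} [IsProbabilityMeasure W]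
    {S : Sample d n → ℝ} (hS : IsBayesRIPr Sp Sq W S) : Measurable S := by
  obtain ⟨ρ, hρ, hSe⟩ := hS
  rw [funext hSe]
  exact (measurable_mixPDF hSq W).div hρ.measurable

end BayesRIPr

end GaussE

/-! ### Assembly of the theorem -/

theorem mainTheorem3 (d : ℕ) (hd : 1 ≤ d)
    (Sp Sq Sr : Matrix (Fin d) (Fin d) ℝ) (hSp : Sp.PosDef) (hSq : Sq.PosDef)
    (R : Measure (Vec d)) [IsProbabilityMeasure R] (hR2 : MemLp id 2 R)
    (μs : Vec d) (hmean : ∫ x, x ∂ R = μs)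
    (hcov : ∀ i j, covariance (fun x : Vec d => x i) (fun x : Vec d => x j) R = Sr i j) :
    -- `D_R(Q_{μ*} ‖ P_{μ*})` is finite, and its Gaussian expression
    (Integrable (fun x => Real.log (gaussPDF μs Sq x / gaussPDF μs Sp x)) R ∧
      genKL R (gaussPDF μs Sq) (gaussPDF μs Sp) = covDiv Sr Sq Sp) ∧
    -- the sample mean is the maximum likelihood estimator
    (∀ n : ℕ, 1 ≤ n → ∀ (u : Sample d n) (m : Vec d),
      gaussPDFn m Sp u ≤ gaussPDFn (mle u) Sp u) ∧
    -- UI, plug-in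
    (∀ (x₀ : Vec d) (n₀ : ℝ), 0 < n₀ →
      (∀ n : ℕ, 1 ≤ n →
        HasEPower (Measure.pi fun _ : Fin n => R) (pluginUI Sp Sq x₀ n₀)
          (n * genKL R (gaussPDF μs Sq) (gaussPDF μs Sp) - dTr Sr Sq / 2 * Real.log n
            + remPluginUI Sp Sq Sr n₀ (μs - x₀) n)) ∧
      remPluginUI Sp Sq Sr n₀ (μs - x₀) =O[atTop] fun _ => (1 : ℝ)) ∧
    -- UI, Gaussian prior
    (∀ (μ₁ : Vec d) (V : Matrix (Fin d) (Fin d) ℝ), V.PosDef →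
      (∀ n : ℕ, 1 ≤ n →
        HasEPower (Measure.pi fun _ : Fin n => R) (bayesUI Sp Sq (multivariateGaussian μ₁ V))
          (n * genKL R (gaussPDF μs Sq) (gaussPDF μs Sp)
            - (d : ℝ) / 2 * Real.log (n / (2 * Real.pi))
            + remBayesUI Sp Sq Sr V (μs - μ₁) n)) ∧
      Tendsto (remBayesUI Sp Sq Sr V (μs - μ₁)) atTop
        (𝓝 ((dTr Sr Sq - dTr Sr Sp) / 2 + 1 / 2 * Real.log Sq.det
          + Real.log (gaussPDF μ₁ V μs)))) ∧
    -- COND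
    (∀ n : ℕ, 1 ≤ n →
      (∃ S : Sample d n → ℝ, IsCond Sp Sq S) ∧
      ∀ S : Sample d n → ℝ, IsCond Sp Sq S → (R ≪ volume ∨ Continuous S) →
        HasEPower (Measure.pi fun _ : Fin n => R) S (((n : ℝ) - 1) * covDiv Sr Sq Sp) ∧
        ((n : ℝ) - 1) * covDiv Sr Sq Sp =
          n * genKL R (gaussPDF μs Sq) (gaussPDF μs Sp) - covDiv Sr Sq Sp) ∧
    -- seq-RIPr, simple case
    ((Sp - Sq).PosSemidef → ∀ (x₀ : Vec d) (n₀ : ℝ), 0 < n₀ →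
      (∀ n : ℕ, 1 ≤ n →
        (∀ (u : Sample d n) (i : Fin n),
          IsRIPr (multivariateGaussian (plugin x₀ n₀ u i) Sq) (family Sp)
            (gaussPDF (plugin x₀ n₀ u i) Sp) ∧
          ∀ ρ, IsRIPr (multivariateGaussian (plugin x₀ n₀ u i) Sq) (family Sp) ρ →
            ρ =ᵐ[volume] gaussPDF (plugin x₀ n₀ u i) Sp) ∧
        (∃ S : Sample d n → ℝ, IsSeqRIPr Sp Sq x₀ n₀ S) ∧
        ∀ S : Sample d n → ℝ, IsSeqRIPr Sp Sq x₀ n₀ S → (R ≪ volume ∨ Continuous S) →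
          HasEPower (Measure.pi fun _ : Fin n => R) S
            (n * genKL R (gaussPDF μs Sq) (gaussPDF μs Sp)
              + (dTr Sr Sp - dTr Sr Sq) / 2 * Real.log n
              + remSeqRIPr Sp Sq Sr n₀ (μs - x₀) n)) ∧
      remSeqRIPr Sp Sq Sr n₀ (μs - x₀) =O[atTop] fun _ => (1 : ℝ)) ∧
    -- seq-RIPr, anti-simple case
    ((Sq - Sp).PosSemidef → ∀ (x₀ : Vec d) (n₀ : ℝ), 0 < n₀ → ∀ n : ℕ, 1 ≤ n →
      IsSeqRIPr Sp Sq x₀ n₀ (fun _ : Sample d n => (1 : ℝ)) ∧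
      ∀ S : Sample d n → ℝ, IsSeqRIPr Sp Sq x₀ n₀ S → S =ᵐ[volume] fun _ => (1 : ℝ)) ∧
    -- RIPr with a Gaussian prior
    (∀ (μ₁ : Vec d) (V : Matrix (Fin d) (Fin d) ℝ), V.PosDef →
      ((Sq - Sp).PosSemidef → ∀ n : ℕ, 1 ≤ n → (V + (n : ℝ)⁻¹ • (Sq - Sp)).PosSemidef) ∧
      ∀ n : ℕ, 1 ≤ n → (V + (n : ℝ)⁻¹ • (Sq - Sp)).PosSemidef →
        (IsRIPr (mixLaw n (multivariateGaussian μ₁ V) Sq) (familyN n Sp)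
            (mixPDF (multivariateGaussian μ₁ (V + (n : ℝ)⁻¹ • (Sq - Sp))) Sp) ∧
          ∀ ρ, IsRIPr (mixLaw n (multivariateGaussian μ₁ V) Sq) (familyN n Sp) ρ →
            ρ =ᵐ[volume]
              mixPDF (multivariateGaussian μ₁ (V + (n : ℝ)⁻¹ • (Sq - Sp))) Sp) ∧
        (∀ S : Sample d n → ℝ, IsBayesRIPr Sp Sq (multivariateGaussian μ₁ V) S →
          IsGRO (familyN n Sp) (mixLaw n (multivariateGaussian μ₁ V) Sq)
            (fun u => ENNReal.ofReal (S u)) ∧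
          (S =ᵐ[volume] fun u => mixPDF (multivariateGaussian μ₁ V) Sq u /
            mixPDF (multivariateGaussian μ₁ (V + (n : ℝ)⁻¹ • (Sq - Sp))) Sp u) ∧
          ∀ S' : Sample d n → ℝ, IsCond Sp Sq S' → S =ᵐ[volume] S')) := by
  have h : HasMeanCov R μs Sr := ⟨hR2, hmean, hcov⟩
  have hK := h.genKL_eq hSp hSq
  refine ⟨hK, fun n hn u m => gaussPDFn_le_mle hn hSp u m, fun x₀ n₀ hn₀ => ⟨fun n hn => ?_, ?_⟩,
    fun μ₁ V hV => ⟨fun n hn => ?_, tendsto_remBayesUI hSq Sr hV μs μ₁⟩,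
    fun n hn => ⟨exists_isCond hn hSp hSq, fun S hS hSR => ⟨?_, ?_⟩⟩,
    fun hle x₀ n₀ hn₀ => ⟨fun n hn => ⟨fun u i => ?_, ?_, fun S hS hSR => ?_⟩,
      isBigO_remSeqRIPr Sp Sq Sr hn₀ _⟩,
    fun hle x₀ n₀ hn₀ n hn => ?_, fun μ₁ V hV => ⟨fun hle n hn => ?_, fun n hn hV₀ => ?_⟩⟩
  · rw [hK.2]
    exact h.hasEPower_pluginUI hn hSp hSq x₀ hn₀
  · exact isBigO_remPluginUI Sp Sq Sr hn₀ _
  · rw [hK.2]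
    exact h.hasEPower_bayesUI hn hSp hSq hV μ₁
  · exact (h.hasEPower_condRatio hn hSp hSq).of_ae_eq_volume (continuous_condRatio hn hSp Sq)
      (hS.ae_eq hn hSp hSq) hSR
  · rw [hK.2]
    ring
  · have hr := isRIPr_gauss_simple hSp hSq hle (plugin x₀ n₀ u i)
    exact ⟨hr, fun ρ hρ =>
      (volume_absolutelyContinuous_multivariateGaussian hSq _).ae_le (hρ.ae_eq hr)⟩
  · exact ⟨_, isSeqRIPr_gauss (isRIPr_gauss_simple hSp hSq hle) x₀ n₀⟩
  · rw [hK.2]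
    exact (h.hasEPower_seq hn hSp hSq x₀ hn₀).of_ae_eq_volume (continuous_seq hSp Sq x₀ n₀)
      (hS.ae_eq hSq (isRIPr_gauss_simple hSp hSq hle)) hSR
  · have hr := isRIPr_gauss_antisimple hSp hSq hle
    -- In the anti-simple case the projection is the predictive density itself, so every factor is
    -- 1.
    have h1 : (fun u : Sample d n => ∏ i, gaussPDF (plugin x₀ n₀ u i) Sq (u i) /
        gaussPDF (plugin x₀ n₀ u i) Sq (u i)) = fun _ => 1 :=
      funext fun u => Finset.prod_eq_one fun i _ => div_self (gaussPDF_pos hSq _ _).ne'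
    exact ⟨h1 ▸ isSeqRIPr_gauss hr x₀ n₀, fun S hS => h1 ▸ hS.ae_eq hSq hr⟩
  · exact hV.posSemidef.add (hle.smul (by positivity))
  · refine ⟨⟨isRIPr_mixLaw hn hSp hSq hV hV₀ μ₁,
      fun ρ hρ => ae_eq_of_isRIPr_mixLaw hn hSp hSq hV hV₀ μ₁ hρ⟩, fun S hS => ?_⟩
    have h1 := hS.ae_eq hn hSp hSq hV hV₀
    have h2 : S =ᵐ[volume] condRatio Sp Sq :=
      h1.trans (Eventually.of_forall fun u => mixPDF_div_mixPDF hn hSp hSq hV hV₀ μ₁ u)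
    exact ⟨isGRO_mixLaw hn hSp hSq hV hV₀ μ₁ (hS.measurable hSq) h2, h1,
      fun S' hS' => h2.trans (hS'.ae_eq hn hSp hSq).symm⟩
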